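/- **Setting.** On Minkowski spacetime with double null coordinates $u,v$ let $S_{u,v}$ be the sphere of radius $r=v-u$, with $D=\partial_v$, $\underline D=\partial_u$ (Lie derivatives of covariant tensors along the null generators). Identify all $S_{u,v}$ with the unit sphere; $d$, $\operatorname{div}$, $\Delta$, $\mathcal D_1^*(f,g)=-df+{}^*dg$ and $\mathcal D_2^*X=-\tfrac12(\nabla X+\nabla X^T-(\operatorname{div}X)\gamma)$ are taken with respect to the unit round metric $\gamma$. $f^{[l]}$ is the degree-$l$ part of a function $f$ and $f^{(lm)}=\int fY^{(lm)}$; $X^{[1]}=\sum_m X_E^{(1m)}E^{(1m)}+X_H^{(1m)}H^{(1m)}$ for a covector field $X$, where $E^{(1m)}=\tfrac1{\sqrt2}\mathcal D_1^*(Y^{(1m)},0)$, $H^{(1m)}=\tfrac1{\sqrt2}\mathcal D_1^*(0,Y^{(1m)})$ and $X_{E}^{(1m)},X_H^{(1m)}$ are the $L^2$ coefficients; $X^{[\ge2]}=X-X^{[1]}$; $W_\psi$ is the electric part of a tracefree symmetric 2-tensor $W$, determined by its $L^2$ products with all $\mathcal D_2^*\mathcal D_1^*(f,0)$. For an integer $m\ge0$,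 *smooth linearized higher-order sphere data of order $m$* is a tuple of smooth fields on the sphere: functions $\Omega,\phi,\mathrm X=\dot{(\Omega\mathrm{tr}\chi)},\mathrm Y=\dot{(\Omega\mathrm{tr}\underline\chi)}$, $D^k\omega,\underline D^k\underline\omega$ ($0\le k\le m+1$), a covector field $\eta$, and symmetric tracefree 2-tensors $g_c,\hat\chi,\hat{\underline\chi}$, $D^k\alpha,\underline D^k\underline\alpha$ ($0\le k\le m$). The linearized metric is $2r\phi\gamma+r^2g_c$. Here $x$ is the part of the tuple with $k\le1$ for $\omega,\underline\omega$ and $k=0$ for $\alpha,\underline\alpha$; $\mathcal D^{L,m}$ consists of the remaining $D^k\alpha,D^k\omega$, and $\mathcal D^{\underline L,m}$ of the remaining $\underline D^k\underline\alpha,\underline D^k\underline\omega$. Put $$\underline\eta=-\eta+2d\Omega,\quad K=\tfrac1{2r^2}\operatorname{div}\operatorname{div}g_c-\tfrac1{r^3}(\Delta+2)\phi,\quad \rho=-\Big(K+\tfrac{\mathrm Y-\mathrm X}{2r}+\tfrac{2\Omega}{r^2}\Big),$$ $$\beta=-\tfrac1{r^2}\operatorname{div}\hat\chi+\tfrac12d\mathrm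 X-\tfrac1r\underline\eta,\qquad \underline\beta=\tfrac1{r^2}\operatorname{div}\hat{\underline\chi}-\tfrac12d\mathrm Y-\tfrac1r\eta,$$ and let $\underline D^k\underline\beta,\underline D^k\rho$ and $D^k\beta,D^k\rho$ ($k\ge1$) be the expressions obtained by differentiating the linearized Bianchi equations $\underline D\underline\beta=\tfrac3r\underline\beta-\tfrac1{r^2}\operatorname{div}\underline\alpha$, $\underline D\rho=\tfrac3r\rho-\tfrac1{r^2}\operatorname{div}\underline\beta$, respectively $D\beta=-\tfrac3r\beta+\tfrac1{r^2}\operatorname{div}\alpha$, $D\rho=-\tfrac3r\rho+\tfrac1{r^2}\operatorname{div}\beta$, using $\underline Dr=-1$, $Dr=1$. The (homogeneous linearized) *higher-order null structure equations* on $\mathcal H_{u,[v_1,v_2]}$ are $$D\tfrac\phi r=\tfrac12\mathrm X,\quad D^2\phi=2\omega,\quad Dg_c=\tfrac2{r^2}\hat\chi,\quad D\hat\chi=-\alpha,\quad D\Omega=\omega,$$ $$D(r^2\eta)=4r\,d\Omega+\operatorname{div}\hat\chi-\tfrac{r^2}2d\mathrm X,\qquad D(r^2\mathrm Y)=2r\mathrm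 X-2\operatorname{div}(\eta-2d\Omega)-2r^2K-4\Omega,$$ $$D\tfrac{\hat{\underline\chi}}r=\tfrac2r\mathcal D_2^*(\eta-2d\Omega)+\tfrac1{r^2}\hat\chi,\quad D(\underline D^k\underline\omega)=-\underline D^k\rho\ (k\le m+1),\quad D(\underline D^k\underline\alpha)=\underline D^k\Big(\tfrac1r\underline\alpha+2\mathcal D_2^*\underline\beta\Big)\ (k\le m),$$ together with $D(D^k\omega)=D^{k+1}\omega$ ($k\le m$), $D(D^k\alpha)=D^{k+1}\alpha$ ($k<m$). On $\underline{\mathcal H}_{[u_1,u_2],v}$ they are $$\underline D\tfrac\phi r=\tfrac12\mathrm Y,\quad\underline D^2\phi=-2\underline\omega,\quad\underline Dg_c=\tfrac2{r^2}\hat{\underline\chi},\quad\underline D\hat{\underline\chi}=-\underline\alpha,\quad\underline D\Omega=\underline\omega,$$ $$\underline D(r^2\underline\eta)=-4r\,d\Omega+\operatorname{div}\hat{\underline\chi}-\tfrac{r^2}2d\mathrm Y,\qquad\underline D(r^2\mathrm X)=-2r\mathrm Y-2\operatorname{div}(\underline\eta-2d\Omega)-2r^2K-4\Omega,$$ $$\underline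 D\tfrac{\hat\chi}r=\tfrac2r\mathcal D_2^*(\underline\eta-2d\Omega)-\tfrac1{r^2}\hat{\underline\chi},\quad\underline D(D^k\omega)=-D^k\rho\ (k\le m+1),\quad\underline D(D^k\alpha)=-D^k\Big(\tfrac1r\alpha+2\mathcal D_2^*\beta\Big)\ (k\le m),$$ together with $\underline D(\underline D^k\underline\omega)=\underline D^{k+1}\underline\omega$ ($k\le m$), $\underline D(\underline D^k\underline\alpha)=\underline D^{k+1}\underline\alpha$ ($k<m$). With $\mathrm X'=\mathrm X-\tfrac4r\Omega$, the *charges* are $$\mathcal Q_0=r^2\eta^{[1]}+\tfrac{r^3}2d\mathrm X'^{[1]},\quad\mathcal Q_1=\tfrac r2\mathrm X'+\tfrac\phi r,\quad\mathcal Q_2=r^2\mathrm Y-\tfrac2r\operatorname{div}\big(r^2\eta+\tfrac{r^3}2d\mathrm X'\big)-r^2\mathrm X'+2r^3K,$$ $$\mathcal Q_3=\tfrac1r\hat{\underline\chi}-\tfrac12(\mathcal D_2^*\operatorname{div}+1)g_c+\mathcal D_2^*\big(\eta+\tfrac r2d\mathrm X'\big)-r\mathcal D_2^*d\mathrm X',$$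 $$\mathcal Q_4=\Big(\tfrac1r\underline\alpha+2\mathcal D_2^*\big(\tfrac1{r^2}\operatorname{div}\hat{\underline\chi}-\tfrac1r\eta-\tfrac12d\mathrm Y+\mathcal D_1^*(\underline\omega,0)\big)\Big)_\psi,$$ $$\mathcal Q_5=\underline\omega^{[\le1]}+\tfrac1{4r^2}\mathcal Q_2^{[\le1]}+\tfrac1{3r^3}\operatorname{div}\mathcal Q_0,\quad\mathcal Q_6=(\underline D\underline\omega)^{[\le1]}-\tfrac1{6r^3}(\Delta-3)\mathcal Q_2^{[\le1]}+\tfrac1{r^4}\operatorname{div}\mathcal Q_0,$$ $$\mathcal Q_7=\Big(\underline D\underline\omega+\tfrac3{2r^3}\mathcal Q_2+\tfrac1{2r^2}\operatorname{div}\operatorname{div}\mathcal Q_3-\tfrac{12}{r^2}\mathcal Q_1+\tfrac3{2r^2}\operatorname{div}\big(\eta+\tfrac r2d\mathrm X'\big)-\tfrac3{4r^2}\operatorname{div}\operatorname{div}g_c\Big)^{[2]},$$ and, for $0\le k\le m+1$, in the modes $l\le1$, $$\mathcal Q^{(k)}=(\underline D^k\underline\omega)^{[\le1]}+\tfrac{(k+1)!}{4r^{k+2}}\mathcal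 Q_2^{[\le1]}+\tfrac{(k+2)!}{6r^{k+3}}\operatorname{div}\mathcal Q_0+\tfrac{k\,(k+1)!}{6r^{k+2}}\mathcal Q_2^{[1]}\qquad(\mathcal Q^{(0)}=\mathcal Q_5,\ \mathcal Q^{(1)}=\mathcal Q_6).$$ The linearized *matching map* is $\mathfrak M=(\Omega,\phi,g_c,\mathrm X,\hat\chi,\mathrm Y^{[\ge2]},\hat{\underline\chi},\eta^{[\ge2]},\omega,D\omega,\underline\omega^{[\ge2]},(\underline D\underline\omega)^{[\ge2]},\mathcal Q_5,\mathcal Q_6,\alpha,\underline\alpha)$. Finally $\dot{\mathbf E},\dot{\mathbf P}^i,\dot{\mathbf L}^i,\dot{\mathbf G}^i$ ($i=-1,0,1$) are given by $$-\tfrac{8\pi}{\sqrt{4\pi}}\dot{\mathbf E}=2\phi^{(0)}-2r\Omega^{(0)}+\tfrac{r^2}2\mathrm X^{(0)}-\tfrac{r^2}2\mathrm Y^{(0)},\quad -\tfrac{8\pi}{\sqrt{4\pi/3}}\dot{\mathbf P}^i=2r\Omega^{(1i)}-\tfrac{r^2}2\mathrm X^{(1i)}-\tfrac{r^2}2\mathrm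 Y^{(1i)}+r(\operatorname{div}\eta)^{(1i)},$$ $$\tfrac{16\pi}{\sqrt{8\pi/3}}\dot{\mathbf L}^i=2r^2\eta_H^{(1i)},\qquad\tfrac{16\pi}{\sqrt{8\pi/3}}\dot{\mathbf G}^i=r^3(d\mathrm X)_E^{(1i)}+2r^2\eta_E^{(1i)}-4r^2(d\Omega)_E^{(1i)}.$$ **Theorem (linearized bifurcate characteristic gluing).** Let $m\ge0$, and let smooth linearized higher-order sphere data of order $m$ be given on $S_{0,1}$ (denoted $X_{0,1}$) and on $S_{-1,2}$ (denoted $X_{-1,2}$). Then there exist a solution $Z$ of the higher-order null structure equations on $\mathcal H_{-1,[1,2]}$ and a solution $\underline Z$ on $\underline{\mathcal H}_{[-1,0],1}$, both smooth up to the boundary, and smooth higher-order sphere data $X_{-1,1}$ on $S_{-1,1}$, such that: 1. $Z|_{S_{-1,1}}=\underline Z|_{S_{-1,1}}=X_{-1,1}$ and $\underline Z|_{S_{0,1}}=X_{0,1}$. 2. On $S_{-1,2}$ (where $r=3$), $Z|_{S_{-1,2}}$ and $X_{-1,2}$ match up to $\mathcal Q_0$ and $\mathcal Q_2^{[\le1]}$: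 they have the same $\mathfrak M$, the same $\mathcal D^{L,m}$, the same charges $\mathcal Q_1,\mathcal Q_2^{[\ge2]},\mathcal Q_3,\dots,\mathcal Q_7$, and the same higher-order charges, in the sense that they have the same $\mathcal Q^{(k)}$ and the same $(\underline D^k\underline\omega)^{[\ge2]}$ for $0\le k\le m+1$, and the same $\underline D^k\underline\alpha$ for $0\le k\le m$. In particular, if also $\mathcal Q_0$ and $\mathcal Q_2^{[\le1]}$ agree, then $Z|_{S_{-1,2}}=X_{-1,2}$. 3. For $i=-1,0,1$, $$(\dot{\mathbf E},\dot{\mathbf P}^i,\dot{\mathbf L}^i)(Z|_{S_{-1,2}})=(\dot{\mathbf E},\dot{\mathbf P}^i,\dot{\mathbf L}^i)(X_{0,1}),\qquad \dot{\mathbf G}^i(Z|_{S_{-1,2}})=\dot{\mathbf G}^i(X_{0,1})-2\,\dot{\mathbf P}^i(X_{0,1}).$$ -/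

import Mathlib

open scoped ContDiff

noncomputable section

namespace LinGlue

/-! ## Calculus on the unit round sphere

All tensors are covariant tensors on the unit sphere `S² ⊂ ℝ³`.  A covector field is given by its
three Euclidean components (it is tangent if it annihilates the outer normal `x`), a symmetric
2-tensor by its nine Euclidean components.  Every sphere `S_{u,v}` of Minkowski spacetime, of
radius `r = v - u`, is identified with the unit sphere along the generators of the two null
hypersurfaces, so that the derivatives `D` and `D̲` of covariant tensors (Lie derivatives along the
generators) are derivatives of components in `v` and in `u`. -/

abbrev E3 := EuclideanSpace ℝ (Fin 3)
abbrev Sph := Metric.sphere (0 : E3) 1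
abbrev Scal := Sph → ℝ
abbrev Cov := Sph → Fin 3 → ℝ
abbrev Ten := Sph → Fin 3 → Fin 3 → ℝ

/-- The radial (0-homogeneous) extension of a function on the unit sphere to `ℝ³ \ {0}`;
the value at the origin is irrelevant. -/
def rext (f : Scal) (y : E3) : ℝ :=
  if h : y = 0 then 0
  else f ⟨‖y‖⁻¹ • y, by
    rw [mem_sphere_zero_iff_norm, norm_smul, norm_inv, norm_norm]
    exact inv_mul_cancel₀ (norm_ne_zero_iff.mpr h)⟩

/-- The `i`-th Euclidean partial derivative of the radial extension, restricted to the sphere. -/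
def pd (i : Fin 3) (f : Scal) : Scal :=
  fun x => fderiv ℝ (rext f) x.1 (EuclideanSpace.single i 1)

/-- The orthogonal projection of `ℝ³` to the tangent plane at `x`
(the components of the round metric). -/
def proj (x : Sph) (i j : Fin 3) : ℝ := (if i = j then 1 else 0) - x.1 i * x.1 j

/-- The exterior derivative `d f` of a function. -/
def grad (f : Scal) : Cov := fun x i => pd i f x

/-- The divergence of a tangent covector field. -/
def dv (X : Cov) : Scal := fun x => ∑ i, pd i (fun y => X y i) x

/-- The Laplace-Beltrami operator of the unit sphere. -/
def lap (f : Scal) : Scal := dv (grad f)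

/-- The divergence of a tangent symmetric 2-tensor field. -/
def dvT (W : Ten) : Cov :=
  fun x j => ∑ k, proj x j k * ∑ i, pd i (fun y => W y i k) x

/-- The covariant derivative `(∇ X)_{ij} = ∇_i X_j` of a tangent covector field. -/
def nab (X : Cov) : Ten :=
  fun x i j => ∑ k, ∑ l, proj x i k * proj x j l * pd k (fun y => X y l) x

/-- The operator `D₂* X = - 1/2 (∇ X + (∇ X)ᵀ - (div X) γ)`. -/
def D2s (X : Cov) : Ten :=
  fun x i j => -(1 / 2) * (nab X x i j + nab X x j i - dv X x * proj x i j)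

/-- The Hodge dual `(*X)_A = ε_{AB} X^B` with respect to the outer orientation, that is `X × x`. -/
def hodge (X : Cov) : Cov :=
  fun x => ![X x 1 * x.1 2 - X x 2 * x.1 1, X x 2 * x.1 0 - X x 0 * x.1 2,
    X x 0 * x.1 1 - X x 1 * x.1 0]

/-- The operator `D₁*(f, g) = - d f + * d g`. -/
def D1s (f g : Scal) : Cov := -grad f + hodge (grad g)

/-- Smooth functions on the sphere. -/
def SmoothS (f : Scal) : Prop := ContDiffOn ℝ ∞ (rext f) {0}ᶜ

/-- One-parameter families of functions on the sphere that are smooth, up to the ends of the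
parameter interval `[a, b]`, jointly in the parameter and the point. -/
def SmoothFam (a b : ℝ) (F : ℝ → Scal) : Prop :=
  ContDiffOn ℝ ∞ (fun p : ℝ × E3 => rext (F p.1) p.2) (Set.Icc a b ×ˢ ({0}ᶜ : Set E3))

/-- Covector fields tangent to the sphere. -/
def IsTangent (X : Cov) : Prop := ∀ x : Sph, ∑ i, x.1 i * X x i = 0

/-- Symmetric tracefree 2-tensors tangent to the sphere. -/
def IsSTF (W : Ten) : Prop :=
  ∀ x : Sph, (∀ i j, W x i j = W x j i) ∧ (∀ j, ∑ i, x.1 i * W x i j = 0) ∧ ∑ i, W x i i = 0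

/-! ## Spherical harmonics -/

/-- The area measure of the unit sphere (total mass `4 π`). -/
def area : MeasureTheory.Measure Sph := (MeasureTheory.volume : MeasureTheory.Measure E3).toSphere

/-- The standard real spherical harmonic `Y^{(00)}`. -/
def Y0 : Scal := fun _ => 1 / √(4 * Real.pi)

/-- The standard real spherical harmonics of degree one, indexed by the three coordinates
`x, y, z`; these are the indices `m = 1, -1, 0` respectively. -/
def Y1 (i : Fin 3) : Scal := fun x => √(3 / (4 * Real.pi)) * x.1 i

def E1 (i : Fin 3) : Cov := (1 / √2) • D1s (Y1 i) 0
def H1 (i : Fin 3) : Cov := (1 / √2) • D1s 0 (Y1 i)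

/-- The coefficient `f^{(0)}`. -/
def c0 (f : Scal) : ℝ := ∫ x, f x * Y0 x ∂area
/-- The coefficients `f^{(1m)}`. -/
def c1 (i : Fin 3) (f : Scal) : ℝ := ∫ x, f x * Y1 i x ∂area
/-- The electric coefficients `X_E^{(1m)}`. -/
def cE (i : Fin 3) (X : Cov) : ℝ := ∫ x, ∑ j, X x j * E1 i x j ∂area
/-- The magnetic coefficients `X_H^{(1m)}`. -/
def cH (i : Fin 3) (X : Cov) : ℝ := ∫ x, ∑ j, X x j * H1 i x j ∂area

/-- The parts `f^{[0]}`, `f^{[1]}`, `f^{[≤1]}` and `f^{[≥2]}` of a function. -/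
def m0 (f : Scal) : Scal := c0 f • Y0
def m1 (f : Scal) : Scal := ∑ i, c1 i f • Y1 i
def le1 (f : Scal) : Scal := m0 f + m1 f
def ge2 (f : Scal) : Scal := f - le1 f

/-- The part `f^{[2]}`: the projection to the harmonics of degree two, written with its
reproducing kernel `5/(4π) P₂(x · y)`. -/
def m2 (f : Scal) : Scal := fun x =>
  ∫ y, 5 / (4 * Real.pi) * ((3 * (∑ i, x.1 i * y.1 i) ^ 2 - 1) / 2) * f y ∂area

/-- The parts `X^{[1]}` and `X^{[≥2]}` of a covector field. -/
def cm1 (X : Cov) : Cov := ∑ i, (cE i X • E1 i + cH i X • H1 i)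
def cge2 (X : Cov) : Cov := X - cm1 X

/-- Two symmetric tracefree 2-tensors have the same electric part `ψ`: their `L²`-products with all
the electric tensors `D₂* D₁*(f, 0)` coincide. -/
def SameElectric (V W : Ten) : Prop :=
  ∀ f : Scal, SmoothS f →
    ∫ x, ∑ i, ∑ j, V x i j * D2s (D1s f 0) x i j ∂area =
      ∫ x, ∑ i, ∑ j, W x i j * D2s (D1s f 0) x i j ∂area

/-! ## Linearized higher-order sphere data -/

/-- Linearized higher-order sphere data of order `m`.  The linearized induced metric is
`ġ = 2 r φ̇ γ° + r² ġ_c`, with `γ°` the unit round metric.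
* `trX`, `trXb` are the linearizations of `Ω tr χ` and `Ω tr χ̲`.
* `om k = D^k ω` and `omb k = D̲^k ω̲`, for `0 ≤ k ≤ m + 1`.
* `al k = D^k α` and `alb k = D̲^k α̲`, for `0 ≤ k ≤ m`. -/
structure HSD (m : ℕ) where
  Om : Scal
  phi : Scal
  gc : Ten
  trX : Scal
  chih : Ten
  trXb : Scal
  chibh : Ten
  eta : Cov
  om : Fin (m + 2) → Scal
  omb : Fin (m + 2) → Scal
  al : Fin (m + 1) → Ten
  alb : Fin (m + 1) → Ten

namespace HSD

variable {m : ℕ}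

/-- The tuples of tensors as sequences (zero beyond the order of the data). -/
def omN (x : HSD m) (k : ℕ) : Scal := if h : k < m + 2 then x.om ⟨k, h⟩ else 0
def ombN (x : HSD m) (k : ℕ) : Scal := if h : k < m + 2 then x.omb ⟨k, h⟩ else 0
def alN (x : HSD m) (k : ℕ) : Ten := if h : k < m + 1 then x.al ⟨k, h⟩ else 0
def albN (x : HSD m) (k : ℕ) : Ten := if h : k < m + 1 then x.alb ⟨k, h⟩ else 0

/-- `η̲ = - η + 2 dΩ`. -/
def etab (x : HSD m) : Cov := -x.eta + (2 : ℝ) • grad x.Om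

/-- Smooth higher-order sphere data: scalar functions, tangent covector fields and tangent
symmetric tracefree 2-tensors, all smooth. -/
structure Smooth (x : HSD m) : Prop where
  stf_gc : IsSTF x.gc
  stf_chih : IsSTF x.chih
  stf_chibh : IsSTF x.chibh
  stf_al : ∀ k, IsSTF (x.al k)
  stf_alb : ∀ k, IsSTF (x.alb k)
  tan_eta : IsTangent x.eta
  Om : SmoothS x.Om
  phi : SmoothS x.phi
  gc : ∀ i j, SmoothS (fun y => x.gc y i j)
  trX : SmoothS x.trX
  chih : ∀ i j, SmoothS (fun y => x.chih y i j)
  trXb : SmoothS x.trXb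
  chibh : ∀ i j, SmoothS (fun y => x.chibh y i j)
  eta : ∀ i, SmoothS (fun y => x.eta y i)
  om : ∀ k, SmoothS (x.om k)
  omb : ∀ k, SmoothS (x.omb k)
  al : ∀ k i j, SmoothS (fun y => x.al k y i j)
  alb : ∀ k i j, SmoothS (fun y => x.alb k y i j)

/-! ### Curvature of the sphere data and its transversal derivatives -/

/-- The linearized Gauss curvature `K`. -/
def K (r : ℝ) (x : HSD m) : Scal :=
  (1 / (2 * r ^ 2)) • dv (dvT x.gc) - (1 / r ^ 3) • (lap x.phi + (2 : ℝ) • x.phi)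

/-- The linearized curvature component `ρ`, from the Gauss equation. -/
def rho (r : ℝ) (x : HSD m) : Scal :=
  -(x.K r + (1 / (2 * r)) • x.trXb - (1 / (2 * r)) • x.trX + (2 / r ^ 2) • x.Om)

/-- The linearized curvature component `β̲`, from the Codazzi equation. -/
def betab (r : ℝ) (x : HSD m) : Cov :=
  (1 / r ^ 2) • dvT x.chibh - (1 / 2 : ℝ) • grad x.trXb - (1 / r) • x.eta

/-- The linearized curvature component `β`, from the Codazzi equation. -/
def beta (r : ℝ) (x : HSD m) : Cov :=
  -((1 / r ^ 2) • dvT x.chih) + (1 / 2 : ℝ) • grad x.trX - (1 / r) • x.etab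

end HSD

/-- The `i`-th derivative of `r⁻¹`, along `D̲` (where `D̲ r = -1`) for `s = 1` and
along `D` (where `D r = 1`) for `s = -1`. -/
def dInv (s r : ℝ) (i : ℕ) : ℝ := s ^ i * (i.factorial : ℝ) / r ^ (i + 1)

/-- The `i`-th derivative of `r⁻²`, in the same convention. -/
def dInvSq (s r : ℝ) (i : ℕ) : ℝ := s ^ i * ((i + 1).factorial : ℝ) / r ^ (i + 2)

/-- Derivatives of the curvature components, for given `b`, `ρ` and derivatives `a 0, a 1, …` of the
extreme curvature component.  For `s = 1` and `(b, a) = (β̲, α̲)` the pair at `k` is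
`(D̲^k β̲, D̲^k ρ)`, obtained by applying `D̲^k` to the linearized Bianchi equations
`D̲ β̲ = 3 r⁻¹ β̲ - r⁻² div α̲`, `D̲ ρ = 3 r⁻¹ ρ - r⁻² div β̲`.
For `s = -1` and `(b, a) = (β, α)` it is `(D^k β, D^k ρ)`, from
`D β = - 3 r⁻¹ β + r⁻² div α`, `D ρ = - 3 r⁻¹ ρ + r⁻² div β`. -/
def curvJet (s r : ℝ) (b : Cov) (ρ : Scal) (a : ℕ → Ten) : ℕ → Cov × Scal
  | 0 => (b, ρ)
  | k + 1 =>
    (∑ i : Fin (k + 1), ((k.choose i : ℝ) * s) •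
        ((3 * dInv s r i) • (curvJet s r b ρ a (k - i)).1 - dInvSq s r i • dvT (a (k - i))),
     ∑ i : Fin (k + 1), ((k.choose i : ℝ) * s) •
        ((3 * dInv s r i) • (curvJet s r b ρ a (k - i)).2
          - dInvSq s r i • dv (curvJet s r b ρ a (k - i)).1))
  termination_by k => k
  decreasing_by all_goals omega

/-- `F` is differentiable on `[a, b]`, pointwise on the sphere, with derivative `G`
(one-sided at the ends of the interval). -/
def Evolves {V : Type} [NormedAddCommGroup V] [NormedSpace ℝ V]
    (a b : ℝ) (F G : ℝ → Sph → V) : Prop :=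
  ∀ t ∈ Set.Icc a b, ∀ x : Sph,
    HasDerivWithinAt (fun s => F s x) (G t x) (Set.Icc a b) t

namespace HSD

variable {m : ℕ}

/-- Smooth higher-order null data on a null hypersurface with parameter interval `[a, b]`. -/
structure SmoothOn (a b : ℝ) (z : ℝ → HSD m) : Prop where
  sphere : ∀ t ∈ Set.Icc a b, (z t).Smooth
  Om : SmoothFam a b (fun t => (z t).Om)
  phi : SmoothFam a b (fun t => (z t).phi)
  gc : ∀ i j, SmoothFam a b (fun t y => (z t).gc y i j)
  trX : SmoothFam a b (fun t => (z t).trX)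
  chih : ∀ i j, SmoothFam a b (fun t y => (z t).chih y i j)
  trXb : SmoothFam a b (fun t => (z t).trXb)
  chibh : ∀ i j, SmoothFam a b (fun t y => (z t).chibh y i j)
  eta : ∀ i, SmoothFam a b (fun t y => (z t).eta y i)
  om : ∀ k, SmoothFam a b (fun t => (z t).om k)
  omb : ∀ k, SmoothFam a b (fun t => (z t).omb k)
  al : ∀ k i j, SmoothFam a b (fun t y => (z t).al k y i j)
  alb : ∀ k i j, SmoothFam a b (fun t y => (z t).alb k y i j)

/-! ### Charges

`r` is the radius of the sphere which carries the data. -/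

/-- The combination `(Ω tr χ)˙ - (4/r) Ω`. -/
def X' (r : ℝ) (x : HSD m) : Scal := x.trX - (4 / r) • x.Om

def Q0 (r : ℝ) (x : HSD m) : Cov :=
  r ^ 2 • cm1 x.eta + (r ^ 3 / 2) • grad (m1 x.trX - (4 / r) • m1 x.Om)

def Q1 (r : ℝ) (x : HSD m) : Scal := (r / 2) • x.X' r + (1 / r) • x.phi

def Q2 (r : ℝ) (x : HSD m) : Scal :=
  r ^ 2 • x.trXb - (2 / r) • dv (r ^ 2 • x.eta + (r ^ 3 / 2) • grad (x.X' r))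
    - r ^ 2 • x.X' r + (2 * r ^ 3) • x.K r

def Q3 (r : ℝ) (x : HSD m) : Ten :=
  (1 / r) • x.chibh - (1 / 2 : ℝ) • (D2s (dvT x.gc) + x.gc)
    + D2s (x.eta + (r / 2) • grad (x.X' r)) - r • D2s (grad (x.X' r))

/-- The tensor whose electric part is the charge `Q₄`. -/
def Q4pre (r : ℝ) (x : HSD m) : Ten :=
  (1 / r) • x.alb 0 + (2 : ℝ) • D2s ((1 / r ^ 2) • dvT x.chibh - (1 / r) • x.eta
    - (1 / 2 : ℝ) • grad x.trXb + D1s (x.omb 0) 0)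

def Q5 (r : ℝ) (x : HSD m) : Scal :=
  le1 (x.omb 0) + (1 / (4 * r ^ 2)) • le1 (x.Q2 r) + (1 / (3 * r ^ 3)) • dv (x.Q0 r)

def Q6 (r : ℝ) (x : HSD m) : Scal :=
  le1 (x.omb 1) - (1 / (6 * r ^ 3)) • (lap (le1 (x.Q2 r)) - (3 : ℝ) • le1 (x.Q2 r))
    + (1 / r ^ 4) • dv (x.Q0 r)

def Q7 (r : ℝ) (x : HSD m) : Scal :=
  m2 (x.omb 1) + (3 / (2 * r ^ 3)) • m2 (x.Q2 r)
    + (1 / (2 * r ^ 2)) • m2 (dv (dvT (x.Q3 r))) - (12 / r ^ 2) • m2 (x.Q1 r)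
    + (3 / (2 * r ^ 2)) • m2 (dv (x.eta + (r / 2) • grad (x.X' r)))
    - (3 / (4 * r ^ 2)) • m2 (dv (dvT x.gc))

/-- The higher-order charges in the modes `l ≤ 1`: the conserved quantities of the null transport
equations for `D̲^k ω̲`, `0 ≤ k ≤ m + 1`.  They are obtained by applying `D̲^k` to `Q₅`, with
`D̲ Q₂^{[≤1]} = 0` and `D̲ div Q₀ = Q₂^{[1]}`, so that `Qhigh 0 = Q₅` and `Qhigh 1 = Q₆`. -/
def Qhigh (r : ℝ) (x : HSD m) (k : Fin (m + 2)) : Scal :=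
  le1 (x.omb k) + (((k : ℕ) + 1).factorial / (4 * r ^ ((k : ℕ) + 2))) • le1 (x.Q2 r)
    + (((k : ℕ) + 2).factorial / (6 * r ^ ((k : ℕ) + 3))) • dv (x.Q0 r)
    + ((k : ℕ) * ((k : ℕ) + 1).factorial / (6 * r ^ ((k : ℕ) + 2))) • m1 (x.Q2 r)

/-- The linearized matching map. -/
def Match (r : ℝ) (x : HSD m) :=
  (x.Om, x.phi, x.gc, x.trX, x.chih, ge2 x.trXb, x.chibh, cge2 x.eta, x.om 0, x.om 1,
    ge2 (x.omb 0), ge2 (x.omb 1), x.Q5 r, x.Q6 r, x.al 0, x.alb 0)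

/-- The linearizations of the charges `E, P, L, G` (local energy, linear momentum, angular momentum,
center of mass). -/
def Edot (r : ℝ) (x : HSD m) : ℝ :=
  -(√(4 * Real.pi) / (8 * Real.pi)) *
    (2 * c0 x.phi - 2 * r * c0 x.Om + r ^ 2 / 2 * c0 x.trX - r ^ 2 / 2 * c0 x.trXb)

def Pdot (r : ℝ) (x : HSD m) (i : Fin 3) : ℝ :=
  -(√(4 * Real.pi / 3) / (8 * Real.pi)) *
    (2 * r * c1 i x.Om - r ^ 2 / 2 * c1 i x.trX - r ^ 2 / 2 * c1 i x.trXb + r * c1 i (dv x.eta))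

def Ldot (r : ℝ) (x : HSD m) (i : Fin 3) : ℝ :=
  √(8 * Real.pi / 3) / (16 * Real.pi) * (2 * r ^ 2 * cH i x.eta)

def Gdot (r : ℝ) (x : HSD m) (i : Fin 3) : ℝ :=
  √(8 * Real.pi / 3) / (16 * Real.pi) *
    (r ^ 3 * cE i (grad x.trX) + 2 * r ^ 2 * cE i x.eta - 4 * r ^ 2 * cE i (grad x.Om))

end HSD

open HSD

/-! ## Linearized higher-order null structure equations -/

/-- `z` is a smooth solution, on the outgoing null hypersurface `H_{u₀,[a,b]}` of Minkowski spacetime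
(parameter `v`, radius `r = v - u₀`, `D = ∂_v`), to the homogeneous linearized null structure
equations, their `D`-derivatives, and the transport equations for the transversal derivatives. -/
structure OutgoingSolution {m : ℕ} (u₀ a b : ℝ) (z : ℝ → HSD m) : Prop where
  smooth : SmoothOn a b z
  /-- `D (φ/r) = (Ω tr χ)˙ / 2` -/
  eq_phi : Evolves a b (fun v => (1 / (v - u₀)) • (z v).phi) (fun v => (1 / 2 : ℝ) • (z v).trX)
  /-- `D² φ = 2 ω`, the linearized Raychaudhuri equation -/
  eq_ray : Evolves a b (fun v x => derivWithin (fun s => (z s).phi x) (Set.Icc a b) v)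
    (fun v => (2 : ℝ) • (z v).om 0)
  eq_gc : Evolves a b (fun v => (z v).gc) (fun v => (2 / (v - u₀) ^ 2) • (z v).chih)
  eq_eta : Evolves a b (fun v => (v - u₀) ^ 2 • (z v).eta)
    (fun v => (4 * (v - u₀)) • grad (z v).Om + dvT (z v).chih
      - ((v - u₀) ^ 2 / 2) • grad (z v).trX)
  eq_trXb : Evolves a b (fun v => (v - u₀) ^ 2 • (z v).trXb)
    (fun v => (2 * (v - u₀)) • (z v).trX - (2 : ℝ) • dv ((z v).eta - (2 : ℝ) • grad (z v).Om)
      - (2 * (v - u₀) ^ 2) • (z v).K (v - u₀) - (4 : ℝ) • (z v).Om)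
  eq_chibh : Evolves a b (fun v => (1 / (v - u₀)) • (z v).chibh)
    (fun v => (2 / (v - u₀)) • D2s ((z v).eta - (2 : ℝ) • grad (z v).Om)
      + (1 / (v - u₀) ^ 2) • (z v).chih)
  eq_chih : Evolves a b (fun v => (z v).chih) (fun v => -(z v).al 0)
  eq_Om : Evolves a b (fun v => (z v).Om) (fun v => (z v).om 0)
  eq_om : ∀ k, k ≤ m → Evolves a b (fun v => (z v).omN k) (fun v => (z v).omN (k + 1))
  eq_al : ∀ k, k < m → Evolves a b (fun v => (z v).alN k) (fun v => (z v).alN (k + 1))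
  /-- `D D̲^k ω̲ = - D̲^k ρ` -/
  eq_omb : ∀ k, k ≤ m + 1 → Evolves a b (fun v => (z v).ombN k)
    (fun v => -(curvJet 1 (v - u₀) ((z v).betab (v - u₀)) ((z v).rho (v - u₀)) (z v).albN k).2)
  /-- `D D̲^k α̲ = D̲^k (α̲ / r + 2 D₂* β̲)` -/
  eq_alb : ∀ k, k ≤ m → Evolves a b (fun v => (z v).albN k)
    (fun v => (∑ i : Fin (k + 1),
        ((k.choose i : ℝ) * dInv 1 (v - u₀) i) • (z v).albN (k - i))
      + (2 : ℝ) • D2s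
        (curvJet 1 (v - u₀) ((z v).betab (v - u₀)) ((z v).rho (v - u₀)) (z v).albN k).1)

/-- `z` is a smooth solution, on the ingoing null hypersurface `H̲_{[a,b],v₀}` of Minkowski spacetime
(parameter `u`, radius `r = v₀ - u`, `D̲ = ∂_u`), to the homogeneous linearized null structure
equations, their `D̲`-derivatives, and the transport equations for the transversal derivatives. -/
structure IngoingSolution {m : ℕ} (v₀ a b : ℝ) (z : ℝ → HSD m) : Prop where
  smooth : SmoothOn a b z
  /-- `D̲ (φ/r) = (Ω tr χ̲)˙ / 2` -/
  eq_phi : Evolves a b (fun u => (1 / (v₀ - u)) • (z u).phi) (fun u => (1 / 2 : ℝ) • (z u).trXb)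
  /-- `D̲² φ = - 2 ω̲`, the linearized Raychaudhuri equation -/
  eq_ray : Evolves a b (fun u x => derivWithin (fun s => (z s).phi x) (Set.Icc a b) u)
    (fun u => (-2 : ℝ) • (z u).omb 0)
  eq_gc : Evolves a b (fun u => (z u).gc) (fun u => (2 / (v₀ - u) ^ 2) • (z u).chibh)
  eq_etab : Evolves a b (fun u => (v₀ - u) ^ 2 • (z u).etab)
    (fun u => dvT (z u).chibh - ((v₀ - u) ^ 2 / 2) • grad (z u).trXb
      - (4 * (v₀ - u)) • grad (z u).Om)
  eq_trX : Evolves a b (fun u => (v₀ - u) ^ 2 • (z u).trX)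
    (fun u => -((2 * (v₀ - u)) • (z u).trXb)
      - (2 : ℝ) • dv ((z u).etab - (2 : ℝ) • grad (z u).Om)
      - (2 * (v₀ - u) ^ 2) • (z u).K (v₀ - u) - (4 : ℝ) • (z u).Om)
  eq_chih : Evolves a b (fun u => (1 / (v₀ - u)) • (z u).chih)
    (fun u => (2 / (v₀ - u)) • D2s ((z u).etab - (2 : ℝ) • grad (z u).Om)
      - (1 / (v₀ - u) ^ 2) • (z u).chibh)
  eq_chibh : Evolves a b (fun u => (z u).chibh) (fun u => -(z u).alb 0)
  eq_Om : Evolves a b (fun u => (z u).Om) (fun u => (z u).omb 0)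
  eq_omb : ∀ k, k ≤ m → Evolves a b (fun u => (z u).ombN k) (fun u => (z u).ombN (k + 1))
  eq_alb : ∀ k, k < m → Evolves a b (fun u => (z u).albN k) (fun u => (z u).albN (k + 1))
  /-- `D̲ D^k ω = - D^k ρ` -/
  eq_om : ∀ k, k ≤ m + 1 → Evolves a b (fun u => (z u).omN k)
    (fun u => -(curvJet (-1) (v₀ - u) ((z u).beta (v₀ - u)) ((z u).rho (v₀ - u)) (z u).alN k).2)
  /-- `D̲ D^k α = D^k (- α / r - 2 D₂* β)` -/
  eq_al : ∀ k, k ≤ m → Evolves a b (fun u => (z u).alN k)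
    (fun u => -(∑ i : Fin (k + 1),
        ((k.choose i : ℝ) * dInv (-1) (v₀ - u) i) • (z u).alN (k - i))
      - (2 : ℝ) • D2s
        (curvJet (-1) (v₀ - u) ((z u).beta (v₀ - u)) ((z u).rho (v₀ - u)) (z u).alN k).1)

/-! ## Matching up to the charges `Q₀` and `Q₂^{[≤1]}` -/

/-- Higher-order matching, up to `Q₀` and `Q₂^{[≤1]}`, of two higher-order sphere data on the sphere
of radius `r`: agreement of the matching map, of `D^{L,m}`, of the charges
`Q₁, Q₂^{[≥2]}, Q₃, …, Q₇` and of the higher-order charges.  In the modes `l ≤ 1` the higher-order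
charges are `Qhigh`.  In the modes `l ≥ 2` they are combinations of the entries of `D^{L̲,m}` with
quantities that agree already; their agreement is expressed in the strongest form, as agreement
of the entries of `D^{L̲,m}` themselves in these modes. -/
structure MatchUpTo {m : ℕ} (r : ℝ) (x y : HSD m) : Prop where
  map : x.Match r = y.Match r
  DL_om : ∀ k, x.om k = y.om k
  DL_al : ∀ k, x.al k = y.al k
  q1 : x.Q1 r = y.Q1 r
  q2 : ge2 (x.Q2 r) = ge2 (y.Q2 r)
  q3 : x.Q3 r = y.Q3 r
  q4 : SameElectric (x.Q4pre r) (y.Q4pre r)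
  q5 : x.Q5 r = y.Q5 r
  q6 : x.Q6 r = y.Q6 r
  q7 : x.Q7 r = y.Q7 r
  qhigh : ∀ k, x.Qhigh r k = y.Qhigh r k
  DLb_omb : ∀ k, ge2 (x.omb k) = ge2 (y.omb k)
  DLb_alb : ∀ k, x.alb k = y.alb k
  /-- If, moreover, the remaining charges agree, then so do the full data. -/
  full : x.Q0 r = y.Q0 r → le1 (x.Q2 r) = le1 (y.Q2 r) → x = y

end LinGlue

end

open LinGlue

open MeasureTheory

noncomputable section

namespace LinGlue

/-! ## Smooth functions on the sphere -/

/-! Once `Ω` and `χ̂` are regarded as free data, the outgoing equations integrate completely. `Q₁`,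
`Q₂`, `Q₃` are constant along the cone in all modes. With `q₀ = r²η + (r³/2) dX'` one has `Dφ = 2Ω +
Q₁`, `D g_c = 2r⁻²χ̂`, `D q₀ = div χ̂`, and the remaining basic fields are algebraic in `Ω, φ, g_c,
q₀` and the charges (`recon`, `Fl`). The derivatives of `α̲` and `ω̲` follow by a triangular
sequence of quadratures. The divergence of tracefree tensors reaches exactly the fields without
degree-one part (`exists_dvTB_eq`), so `Q₀`, the degree-one part of `q₀`, is the only part of `q₀`
that `χ̂` cannot move. Two spheres with equal `Q₀, Q₁, Q₂, Q₃` are therefore joined by choosing `Ω`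
and `χ̂` with prescribed jets and adding bumps that fix the integrals of `Ω`, `χ̂` and `r⁻²χ̂`
(`exists_base_integral`, `exists_base_integrals`).

Both cones are traversed towards the middle sphere, where the transversal derivatives are left free;
hence no higher-order charge enters there. But the transversal derivatives of one cone are the
tangential ones of the other, so the two constructions seem to depend on each other. `exists_glue`
breaks the circle: the transversal derivatives produced at the far end do not depend on the
tangential jets prescribed there. Indeed all fields are finite sums of scalar coefficients times
fixed vectors, and the coefficients depend linearly on the parameter curves and are bounded by their
sup norm. A Taylor polynomial cut off at a small scale is small in sup norm while its jet is
unchanged, so a finite-dimensional closedness argument (`exists_parameters`) yields curves with the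
given jet on which all relevant functionals vanish.

Ingoing solutions are reflections of outgoing ones (`BD.mirror`, `BOut.ingoingSolution`). On the
middle sphere both sets of charges must be realised by one set of data; `exists_middle` does this by
solving scalar equations for `Δ + 2` and `Δ`. The reflection ties `Q₀` and `Q₂^{[≤1]}` of the two
directions together, so these cannot be prescribed on both sides. They are corrected on the outer
sphere by `BD.shift`, with compensating changes of `D̲^k ω̲` in the modes `l ≤ 1`, which keeps
everything else that has to match (`BD.matchUpTo_shift`). The laws for `E, P, L, G` combine
conservation along each cone with the behaviour of the charges under reflection.

The analytic input on the sphere is self-contained: the divergence theorem comes from rotation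
invariance of the area, and the equations for `Δ` and `Δ + 2` are solved by convolution with the
explicit zonal kernels `gG` and `gH`, which also gives the Hodge decomposition. -/

lemma rext_apply (f : Scal) {y : E3} (hy : y ≠ 0) (h : ‖y‖⁻¹ • y ∈ Metric.sphere (0 : E3) 1) :
    rext f y = f ⟨‖y‖⁻¹ • y, h⟩ := by
  simp [rext, hy]

lemma normalize_mem {y : E3} (hy : y ≠ 0) : ‖y‖⁻¹ • y ∈ Metric.sphere (0 : E3) 1 := by
  rw [mem_sphere_zero_iff_norm, norm_smul, norm_inv, norm_norm]
  exact inv_mul_cancel₀ (norm_ne_zero_iff.mpr hy)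

lemma norm_val (x : Sph) : ‖x.1‖ = 1 := mem_sphere_zero_iff_norm.mp x.2

lemma val_ne_zero (x : Sph) : x.1 ≠ 0 := by
  rw [← norm_ne_zero_iff, norm_val]; exact one_ne_zero

lemma val_mem (x : Sph) : x.1 ∈ ({0}ᶜ : Set E3) := val_ne_zero x

@[simp] lemma rext_val (f : Scal) (x : Sph) : rext f x.1 = f x := by
  rw [rext_apply f (val_ne_zero x) (normalize_mem (val_ne_zero x))]
  congr 1
  ext1
  simp

lemma rext_smul (f : Scal) {c : ℝ} (hc : 0 < c) (y : E3) : rext f (c • y) = rext f y := by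
  by_cases hy : y = 0
  · simp [hy]
  · have h1 : c • y ≠ 0 := smul_ne_zero hc.ne' hy
    rw [rext_apply f hy (normalize_mem hy), rext_apply f h1 (normalize_mem h1)]
    congr 1
    ext1
    simp only [norm_smul, Real.norm_eq_abs, abs_of_pos hc, smul_smul]
    congr 1
    have := norm_ne_zero_iff.mpr hy
    field_simp

lemma contDiffOn_normalize : ContDiffOn ℝ ∞ (fun y : E3 => ‖y‖⁻¹ • y) {0}ᶜ := by
  intro y hy
  have hy' : y ≠ 0 := hy
  exact (((contDiffAt_norm ℝ hy').inv (norm_ne_zero_iff.mpr hy')).smul contDiffAt_id).contDiffWithinAt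

lemma rext_eq_of_eq {f : Scal} {h : E3 → ℝ} (hf : ∀ x : Sph, f x = h x.1) {y : E3} (hy : y ≠ 0) :
    rext f y = h (‖y‖⁻¹ • y) := by
  rw [rext_apply f hy (normalize_mem hy), hf]

lemma smoothS_of_contDiffOn {f : Scal} {h : E3 → ℝ} (hh : ContDiffOn ℝ ∞ h {0}ᶜ)
    (hf : ∀ x : Sph, f x = h x.1) : SmoothS f := by
  refine (hh.comp contDiffOn_normalize ?_).congr (fun y hy => rext_eq_of_eq hf hy)
  intro y hy
  exact val_ne_zero ⟨_, normalize_mem hy⟩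

lemma rext_add (f g : Scal) (y : E3) : rext (f + g) y = rext f y + rext g y := by
  by_cases hy : y = 0 <;> simp [rext, hy]

lemma rext_mul (f g : Scal) (y : E3) : rext (f * g) y = rext f y * rext g y := by
  by_cases hy : y = 0 <;> simp [rext, hy]

lemma rext_coord (i : Fin 3) {y : E3} (hy : y ≠ 0) :
    rext (fun x => x.1 i) y = ‖y‖⁻¹ * y i := by
  simp [rext, hy]

/-- The algebra of smooth functions on the sphere, as a subalgebra. -/
def SFalg : Subalgebra ℝ Scal where
  carrier := {f | SmoothS f}
  mul_mem' {f g} hf hg := by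
    refine ContDiffOn.congr (ContDiffOn.mul hf hg) (fun y _ => rext_mul f g y)
  add_mem' {f g} hf hg := by
    refine ContDiffOn.congr (ContDiffOn.add hf hg) (fun y _ => rext_add f g y)
  algebraMap_mem' c := smoothS_of_contDiffOn (h := fun _ => c) contDiffOn_const (fun _ => rfl)

/-- The type of smooth functions on the sphere. -/
def SF : Type := SFalg

instance : CommRing SF := inferInstanceAs (CommRing SFalg)
instance : Algebra ℝ SF := inferInstanceAs (Algebra ℝ SFalg)

/-- The underlying function. -/
def SF.val (f : SF) : Sph → ℝ := Subtype.val (p := (· ∈ SFalg)) f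

instance : CoeOut SF Scal := ⟨SF.val⟩

lemma SF.smooth (f : SF) : SmoothS (f : Scal) := Subtype.prop (p := (· ∈ SFalg)) f

/-- A smooth function as an element of `SF`. -/
def SF.mk (f : Scal) (hf : SmoothS f) : SF := (⟨f, hf⟩ : SFalg)

@[simp] lemma SF.coe_mk (f : Scal) (hf : SmoothS f) : (SF.mk f hf : Scal) = f := rfl

lemma SF.ext {f g : SF} (h : ∀ x, (f : Scal) x = (g : Scal) x) : f = g :=
  Subtype.ext (p := (· ∈ SFalg)) (funext h)

@[simp] lemma SF.coe_add (f g : SF) : ((f + g : SF) : Scal) = f + g := rfl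
@[simp] lemma SF.coe_mul (f g : SF) : ((f * g : SF) : Scal) = f * g := rfl
@[simp] lemma SF.coe_sub (f g : SF) : ((f - g : SF) : Scal) = f - g := rfl
@[simp] lemma SF.coe_neg (f : SF) : ((-f : SF) : Scal) = -f := rfl
@[simp] lemma SF.coe_smul (c : ℝ) (f : SF) : ((c • f : SF) : Scal) = c • (f : Scal) := rfl
@[simp] lemma SF.coe_zero : ((0 : SF) : Scal) = 0 := rfl
@[simp] lemma SF.coe_one : ((1 : SF) : Scal) = 1 := rfl

/-- The inclusion of the smooth functions as an algebra homomorphism. -/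
def SF.coeHom : SF →ₐ[ℝ] Scal := SFalg.val

lemma SF.coe_sum {ι : Type*} (s : Finset ι) (F : ι → SF) :
    ((∑ i ∈ s, F i : SF) : Scal) = ∑ i ∈ s, (F i : Scal) := map_sum SF.coeHom F s

lemma SF.coe_sum_apply {ι : Type*} (s : Finset ι) (F : ι → SF) (x : Sph) :
    ((∑ i ∈ s, F i : SF) : Scal) x = ∑ i ∈ s, (F i : Scal) x := by
  rw [SF.coe_sum, Finset.sum_apply]

lemma SF.contDiffOn (f : SF) : ContDiffOn ℝ ∞ (rext (f : Scal)) {0}ᶜ := f.smooth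

lemma isOpen_compl_zero : IsOpen ({0}ᶜ : Set E3) := isOpen_compl_singleton

lemma SF.contDiffAt (f : SF) {y : E3} (hy : y ≠ 0) : ContDiffAt ℝ ∞ (rext (f : Scal)) y :=
  (SF.contDiffOn f).contDiffAt (isOpen_compl_zero.mem_nhds hy)

lemma SF.differentiableAt (f : SF) {y : E3} (hy : y ≠ 0) :
    DifferentiableAt ℝ (rext (f : Scal)) y :=
  (SF.contDiffAt f hy).differentiableAt (by simp)

lemma SF.continuous (f : SF) : Continuous (f : Scal) := by
  have h : ContinuousOn (rext (f : Scal)) {0}ᶜ := (SF.contDiffOn f).continuousOn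
  have h2 := h.comp_continuous continuous_subtype_val val_mem
  refine h2.congr (fun x => rext_val _ x)

lemma smoothS_pd (i : Fin 3) (f : SF) : SmoothS (pd i f) := by
  refine smoothS_of_contDiffOn (h := fun y => fderiv ℝ (rext (f : Scal)) y
    (EuclideanSpace.single i 1)) ?_ (fun _ => rfl)
  exact ((SF.contDiffOn f).fderiv_of_isOpen isOpen_compl_zero (by simp)).clm_apply contDiffOn_const

lemma fderiv_rext_mul (f g : SF) {y : E3} (hy : y ≠ 0) (v : E3) :
    fderiv ℝ (rext (f * g : Scal)) y v =
      rext f y * fderiv ℝ (rext (g : Scal)) y v + rext g y * fderiv ℝ (rext (f : Scal)) y v := by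
  have : rext (f * g : Scal) = fun y => rext (f : Scal) y * rext (g : Scal) y := by
    ext y; exact rext_mul _ _ y
  rw [this, fderiv_fun_mul (SF.differentiableAt f hy) (SF.differentiableAt g hy)]
  simp

/-- The partial derivative `pd i` as a derivation. -/
def pdD (i : Fin 3) : Derivation ℝ SF SF :=
  Derivation.mk'
    { toFun := fun f => SF.mk (pd i f) (smoothS_pd i f)
      map_add' := by
        intro f g
        refine SF.ext fun x => ?_
        have : rext ((f + g : SF) : Scal) = fun y => rext (f : Scal) y + rext (g : Scal) y := by
          ext y; exact rext_add _ _ y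
        simp only [pd, SF.coe_mk]
        rw [this, fderiv_fun_add (SF.differentiableAt f (val_ne_zero x))
          (SF.differentiableAt g (val_ne_zero x))]
        rfl
      map_smul' := by
        intro c f
        refine SF.ext fun x => ?_
        have : rext ((c • f : SF) : Scal) = fun y => c • rext (f : Scal) y := by
          ext y
          by_cases hy : y = 0 <;> simp [rext, hy]
        simp only [pd, SF.coe_mk]
        rw [this, fderiv_fun_const_smul (SF.differentiableAt f (val_ne_zero x))]
        rfl }
    (by
      intro f g
      refine SF.ext fun x => ?_
      have := fderiv_rext_mul f g (val_ne_zero x) (EuclideanSpace.single i 1)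
      simpa [pd] using this)

lemma coe_pdD (i : Fin 3) (f : SF) : (pdD i f : Scal) = pd i f := rfl

/-- The Euclidean coordinates as smooth functions on the sphere. -/
def cx (i : Fin 3) : SF :=
  SF.mk (fun x => x.1 i) (smoothS_of_contDiffOn (h := fun y => y i) (by fun_prop) (fun _ => rfl))

lemma coe_cx (i : Fin 3) (x : Sph) : (cx i : Scal) x = x.1 i := rfl

lemma sum_sq_val (x : Sph) : ∑ i, x.1 i * x.1 i = 1 := by
  have := norm_val x
  rw [EuclideanSpace.norm_eq, Real.sqrt_eq_one] at this
  simpa [sq] using this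

lemma sum_cx_sq : ∑ i, cx i * cx i = 1 := by
  refine SF.ext fun x => ?_
  rw [SF.coe_sum_apply]
  exact sum_sq_val x

instance : Nontrivial SF := by
  refine ⟨0, 1, fun h => ?_⟩
  have h2 := congrFun (congrArg SF.val h) ⟨EuclideanSpace.single 0 1, by simp⟩
  simp at h2

lemma hasFDerivAt_norm_val (x : Sph) :
    HasFDerivAt (fun y : E3 => ‖y‖) (innerSL ℝ x.1) x.1 := by
  have h := (hasStrictFDerivAt_norm_sq x.1).hasFDerivAt.sqrt (by simp)
  have h2 : (fun y : E3 => √(‖y‖ ^ 2)) = fun y => ‖y‖ := by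
    ext y; exact Real.sqrt_sq (norm_nonneg y)
  have h3 : (1 / (2 * √(‖x.1‖ ^ 2))) • (2 : ℕ) • innerSL ℝ x.1 = innerSL ℝ x.1 := by
    rw [norm_val]
    ext v
    simp
  rw [h2, h3] at h
  exact h

lemma fderiv_rext_cx (i : Fin 3) (x : Sph) (v : E3) :
    fderiv ℝ (rext (cx i : Scal)) x.1 v = v i - x.1 i * inner ℝ x.1 v := by
  have hne := val_ne_zero x
  have h1 := hasFDerivAt_norm_val x
  have h3 : HasFDerivAt (fun y : E3 => y i) (EuclideanSpace.proj i : E3 →L[ℝ] ℝ) x.1 :=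
    (EuclideanSpace.proj i : E3 →L[ℝ] ℝ).hasFDerivAt
  have h4 : HasFDerivAt (fun y : E3 => ‖y‖⁻¹ * y i) _ x.1 :=
    ((hasDerivAt_inv (by simp)).comp_hasFDerivAt x.1 h1).fun_mul h3
  have h5 : rext (cx i : Scal) =ᶠ[nhds x.1] fun y : E3 => ‖y‖⁻¹ * y i := by
    filter_upwards [isOpen_compl_zero.mem_nhds hne] with y hy
    exact rext_coord i hy
  rw [h5.fderiv_eq, h4.fderiv]
  simp
  ring

lemma pdD_cx (i j : Fin 3) : pdD i (cx j) = (if i = j then 1 else 0) - cx i * cx j := by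
  refine SF.ext fun x => ?_
  change fderiv ℝ (rext (cx j : Scal)) x.1 (EuclideanSpace.single i 1) = _
  rw [fderiv_rext_cx]
  by_cases h : i = j
  · subst h
    simp [coe_cx, EuclideanSpace.inner_single_right]
  · simp [coe_cx, EuclideanSpace.inner_single_right, h, Ne.symm h, mul_comm]

/-- Euler's relation: the radial extension is constant on rays. -/
lemma fderiv_rext_self (f : SF) {y : E3} (hy : y ≠ 0) : fderiv ℝ (rext (f : Scal)) y y = 0 := by
  have h1 : HasDerivAt (fun t : ℝ => t • y) y 1 := by
    simpa using (hasDerivAt_id (1 : ℝ)).smul_const y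
  have h2 : HasFDerivAt (rext (f : Scal)) (fderiv ℝ (rext (f : Scal)) y) ((1 : ℝ) • y) := by
    simpa using (SF.differentiableAt f hy).hasFDerivAt
  have h3 := h2.comp_hasDerivAt (1 : ℝ) h1
  have h4 : (rext (f : Scal) ∘ fun t : ℝ => t • y) =ᶠ[nhds 1] fun _ => rext (f : Scal) y := by
    filter_upwards [lt_mem_nhds (zero_lt_one' ℝ)] with t ht
    exact rext_smul _ ht y
  have h5 := h4.deriv_eq
  rw [h3.deriv, deriv_const] at h5
  exact h5

lemma sum_single (y : E3) : ∑ i, y i • EuclideanSpace.single i (1 : ℝ) = y := by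
  ext j
  fin_cases j <;> simp [Fin.sum_univ_three]

lemma sum_cx_pdD (f : SF) : ∑ i, cx i * pdD i f = 0 := by
  refine SF.ext fun x => ?_
  have h := fderiv_rext_self f (val_ne_zero x)
  nth_rewrite 2 [← sum_single x.1] at h
  rw [map_sum] at h
  rw [SF.coe_sum_apply]
  simpa [coe_cx, coe_pdD, pd] using h

/-- Partial derivatives of a 0-homogeneous function have degree `-1`; restricting to the sphere and
extending with degree `0` restores a factor `‖y‖`. -/
lemma rext_pd (i : Fin 3) (f : SF) {y : E3} (hy : y ≠ 0) :
    rext (pd i f) y = ‖y‖ * fderiv ℝ (rext (f : Scal)) y (EuclideanSpace.single i 1) := by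
  have hn : 0 < ‖y‖ := norm_pos_iff.mpr hy
  have hpd := rext_eq_of_eq (f := pd i f)
    (h := fun y => fderiv ℝ (rext (f : Scal)) y (EuclideanSpace.single i 1)) (fun _ => rfl) hy
  rw [hpd]
  have h0 : rext (f : Scal) = fun z => rext (f : Scal) (‖y‖⁻¹ • z) := by
    ext z; rw [rext_smul _ (inv_pos.mpr hn)]
  have hz : ‖y‖⁻¹ • y ≠ 0 := val_ne_zero ⟨_, normalize_mem hy⟩
  have h1 : HasFDerivAt (fun z => rext (f : Scal) (‖y‖⁻¹ • z))
      ((fderiv ℝ (rext (f : Scal)) (‖y‖⁻¹ • y)).comp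
        (‖y‖⁻¹ • ContinuousLinearMap.id ℝ E3)) y :=
    (SF.differentiableAt f hz).hasFDerivAt.comp y
      ((ContinuousLinearMap.id ℝ E3).hasFDerivAt.const_smul ‖y‖⁻¹)
  rw [← h0] at h1
  rw [h1.fderiv]
  simp [hn.ne']

/-- The Euclidean Hessian of the radial extension is symmetric; the two correction terms come from
differentiating the factor `‖y‖` in `rext_pd`. -/
lemma pdD_comm (i j : Fin 3) (f : SF) :
    pdD j (pdD i f) - cx j * pdD i f = pdD i (pdD j f) - cx i * pdD j f := by
  have key : ∀ (i j : Fin 3) (x : Sph), (pdD j (pdD i f) : Scal) x - x.1 j * (pdD i f : Scal) x =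
      fderiv ℝ (fderiv ℝ (rext (f : Scal))) x.1 (EuclideanSpace.single j 1)
        (EuclideanSpace.single i 1) := by
    intro i j x
    have hne := val_ne_zero x
    change fderiv ℝ (rext (pd i f)) x.1 _ - x.1 j *
      fderiv ℝ (rext (f : Scal)) x.1 (EuclideanSpace.single i 1) = _
    have h5 : rext (pd i f) =ᶠ[nhds x.1] fun y : E3 => ‖y‖ *
        fderiv ℝ (rext (f : Scal)) y (EuclideanSpace.single i 1) := by
      filter_upwards [isOpen_compl_zero.mem_nhds hne] with y hy
      exact rext_pd i f hy
    have hd : DifferentiableAt ℝ (fderiv ℝ (rext (f : Scal))) x.1 :=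
      ((SF.contDiffAt f hne).fderiv_right (m := 1) (by norm_cast)).differentiableAt (by simp)
    have hd2 : HasFDerivAt (fun y => fderiv ℝ (rext (f : Scal)) y (EuclideanSpace.single i 1)) _
      x.1 := hd.hasFDerivAt.clm_apply (hasFDerivAt_const _ _)
    have hnorm := hasFDerivAt_norm_val x
    rw [h5.fderiv_eq, (hnorm.fun_mul hd2).fderiv]
    simp [EuclideanSpace.inner_single_right]
    ring
  refine SF.ext fun x => ?_
  have h1 := key i j x
  have h2 := key j i x
  have hs : IsSymmSndFDerivAt ℝ (rext (f : Scal)) x.1 :=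
    (SF.contDiffAt f (val_ne_zero x)).isSymmSndFDerivAt (by simp; norm_cast)
  change (pdD j (pdD i f) : Scal) x - x.1 j * (pdD i f : Scal) x =
    (pdD i (pdD j f) : Scal) x - x.1 i * (pdD j f : Scal) x
  rw [h1, h2]
  exact hs _ _

/-! ## Smooth tensor fields and the operators on them -/

/-- The components of the round metric. -/
def prB (i j : Fin 3) : SF := (if i = j then 1 else 0) - cx i * cx j

lemma prB_comm (i j : Fin 3) : prB i j = prB j i := by
  simp only [prB, eq_comm, mul_comm]

lemma coe_prB (i j : Fin 3) (x : Sph) : (prB i j : Scal) x = proj x i j := by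
  by_cases h : i = j <;> simp [prB, proj, h, coe_cx]

lemma pdD_cx' (i j : Fin 3) : pdD i (cx j) = prB i j := pdD_cx i j

lemma sum_prB_mul (i : Fin 3) (G : Fin 3 → SF) :
    ∑ k, prB i k * G k = G i - cx i * ∑ k, cx k * G k := by
  simp only [prB, sub_mul, Finset.sum_sub_distrib, Finset.mul_sum, ite_mul, one_mul, zero_mul,
    Finset.sum_ite_eq, Finset.mem_univ, if_true, mul_assoc]

lemma sum_prB_self : ∑ i, prB i i = 2 := by
  have h := sum_cx_sq
  rw [Fin.sum_univ_three] at h ⊢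
  simp only [prB, if_true]
  linear_combination -h

lemma sum_cx_prB (i : Fin 3) : ∑ k, cx k * prB k i = 0 := by
  have h := sum_prB_mul i cx
  rw [sum_cx_sq, mul_one, sub_self] at h
  rw [← h]
  exact Finset.sum_congr rfl fun k _ => by rw [prB_comm, mul_comm]

/-- Smooth tangent covector fields, as a subspace. -/
def VFsub : Submodule ℝ (Fin 3 → SF) where
  carrier := {X | ∑ i, cx i * X i = 0}
  add_mem' {X Y} hX hY := by
    simp only [Set.mem_ofPred_eq, Pi.add_apply, mul_add, Finset.sum_add_distrib] at *
    rw [hX, hY, add_zero]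
  zero_mem' := by simp
  smul_mem' c X hX := by
    simp only [Set.mem_ofPred_eq, Pi.smul_apply, mul_smul_comm, ← Finset.smul_sum] at *
    rw [hX, smul_zero]

/-- The type of smooth tangent covector fields. -/
def VF : Type := VFsub

instance : AddCommGroup VF := inferInstanceAs (AddCommGroup VFsub)
instance : Module ℝ VF := inferInstanceAs (Module ℝ VFsub)

/-- The components of a covector field. -/
def VF.c (X : VF) : Fin 3 → SF := Subtype.val (p := (· ∈ VFsub)) X

/-- A covector field with given components. -/
def VF.mk (X : Fin 3 → SF) (hX : ∑ i, cx i * X i = 0) : VF := (⟨X, hX⟩ : VFsub)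

lemma VF.ext {X Y : VF} (h : ∀ i, X.c i = Y.c i) : X = Y :=
  Subtype.ext (p := (· ∈ VFsub)) (funext h)

lemma VF.tan (X : VF) : ∑ i, cx i * X.c i = 0 := Subtype.prop (p := (· ∈ VFsub)) X

@[simp] lemma VF.mk_c (X : Fin 3 → SF) (hX : ∑ i, cx i * X i = 0) (i : Fin 3) :
    (VF.mk X hX).c i = X i := rfl
@[simp] lemma VF.add_c (X Y : VF) (i : Fin 3) : (X + Y).c i = X.c i + Y.c i := rfl
@[simp] lemma VF.sub_c (X Y : VF) (i : Fin 3) : (X - Y).c i = X.c i - Y.c i := rfl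
@[simp] lemma VF.neg_c (X : VF) (i : Fin 3) : (-X).c i = -X.c i := rfl
@[simp] lemma VF.smul_c (a : ℝ) (X : VF) (i : Fin 3) : (a • X).c i = a • X.c i := rfl
@[simp] lemma VF.zero_c (i : Fin 3) : (0 : VF).c i = 0 := rfl

/-- Smooth tangent symmetric tracefree 2-tensor fields, as a subspace. -/
def TFsub : Submodule ℝ (Fin 3 → Fin 3 → SF) where
  carrier := {W | (∀ i j, W i j = W j i) ∧ (∀ j, ∑ i, cx i * W i j = 0) ∧ ∑ i, W i i = 0}
  add_mem' {V W} hV hW := by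
    refine ⟨fun i j => ?_, fun j => ?_, ?_⟩
    · simp only [Pi.add_apply, hV.1 i j, hW.1 i j]
    · simp only [Pi.add_apply, mul_add, Finset.sum_add_distrib, hV.2.1 j, hW.2.1 j, add_zero]
    · simp only [Pi.add_apply, Finset.sum_add_distrib, hV.2.2, hW.2.2, add_zero]
  zero_mem' := by simp
  smul_mem' c W hW := by
    refine ⟨fun i j => ?_, fun j => ?_, ?_⟩
    · simp only [Pi.smul_apply, hW.1 i j]
    · simp only [Pi.smul_apply, mul_smul_comm, ← Finset.smul_sum, hW.2.1 j, smul_zero]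
    · simp only [Pi.smul_apply, ← Finset.smul_sum, hW.2.2, smul_zero]

/-- The type of smooth tangent symmetric tracefree 2-tensor fields. -/
def TF : Type := TFsub

instance : AddCommGroup TF := inferInstanceAs (AddCommGroup TFsub)
instance : Module ℝ TF := inferInstanceAs (Module ℝ TFsub)

/-- The components of a tensor field. -/
def TF.c (W : TF) : Fin 3 → Fin 3 → SF := Subtype.val (p := (· ∈ TFsub)) W

/-- A tensor field with given components. -/
def TF.mk (W : Fin 3 → Fin 3 → SF) (hW : (∀ i j, W i j = W j i) ∧
    (∀ j, ∑ i, cx i * W i j = 0) ∧ ∑ i, W i i = 0) : TF := (⟨W, hW⟩ : TFsub)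

lemma TF.ext {V W : TF} (h : ∀ i j, V.c i j = W.c i j) : V = W :=
  Subtype.ext (p := (· ∈ TFsub)) (funext fun i => funext (h i))

lemma TF.prop (W : TF) : (∀ i j, W.c i j = W.c j i) ∧
    (∀ j, ∑ i, cx i * W.c i j = 0) ∧ ∑ i, W.c i i = 0 := Subtype.prop (p := (· ∈ TFsub)) W
lemma TF.symm (W : TF) (i j : Fin 3) : W.c i j = W.c j i := W.prop.1 i j
lemma TF.tan (W : TF) (j : Fin 3) : ∑ i, cx i * W.c i j = 0 := W.prop.2.1 j
lemma TF.tan' (W : TF) (i : Fin 3) : ∑ j, cx j * W.c i j = 0 := by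
  rw [← TF.tan W i]; exact Finset.sum_congr rfl fun j _ => by rw [TF.symm]
lemma TF.trace (W : TF) : ∑ i, W.c i i = 0 := W.prop.2.2

@[simp] lemma TF.mk_c (W hW) (i j : Fin 3) : (TF.mk W hW).c i j = W i j := rfl
@[simp] lemma TF.add_c (V W : TF) (i j : Fin 3) : (V + W).c i j = V.c i j + W.c i j := rfl
@[simp] lemma TF.smul_c (a : ℝ) (W : TF) (i j : Fin 3) : (a • W).c i j = a • W.c i j := rfl
@[simp] lemma TF.zero_c (i j : Fin 3) : (0 : TF).c i j = 0 := rfl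

lemma leib (i : Fin 3) (f g : SF) : pdD i (f * g) = f * pdD i g + g * pdD i f := by
  rw [Derivation.leibniz, smul_eq_mul, smul_eq_mul]

lemma sum_cx_pdD_VF (X : VF) (k : Fin 3) : ∑ l, cx l * pdD k (X.c l) = -X.c k := by
  have h := congrArg (pdD k) (VF.tan X)
  simp only [map_sum, map_zero, leib, pdD_cx', Finset.sum_add_distrib] at h
  have h2 := sum_prB_mul k X.c
  rw [VF.tan, mul_zero, sub_zero] at h2
  have h3 : ∑ x, X.c x * prB k x = X.c k := by
    rw [← h2]; exact Finset.sum_congr rfl fun _ _ => mul_comm _ _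
  rw [h3] at h
  linear_combination h

/-- The exterior derivative. -/
def gradB : SF →ₗ[ℝ] VF where
  toFun f := VF.mk (fun i => pdD i f) (sum_cx_pdD f)
  map_add' f g := by refine VF.ext fun i => ?_; exact map_add _ _ _
  map_smul' c f := by refine VF.ext fun i => ?_; exact (pdD i).map_smul c f

/-- The divergence of covector fields. -/
def dvB : VF →ₗ[ℝ] SF where
  toFun X := ∑ i, pdD i (X.c i)
  map_add' X Y := by
    rw [← Finset.sum_add_distrib]; exact Finset.sum_congr rfl fun i _ => map_add _ _ _
  map_smul' c X := by
    rw [RingHom.id_apply, Finset.smul_sum]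
    exact Finset.sum_congr rfl fun i _ => (pdD i).map_smul c _

/-- The Laplacian. -/
def lapB : SF →ₗ[ℝ] SF := dvB ∘ₗ gradB

lemma lapB_apply (f : SF) : lapB f = ∑ i, pdD i (pdD i f) := rfl
lemma dvB_apply (X : VF) : dvB X = ∑ i, pdD i (X.c i) := rfl
lemma gradB_apply (f : SF) (i : Fin 3) : (gradB f).c i = pdD i f := rfl
lemma dvB_gradB (f : SF) : dvB (gradB f) = lapB f := rfl

lemma sum_prB_tan (G : Fin 3 → SF) : ∑ j, cx j * ∑ k, prB j k * G k = 0 := by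
  simp only [sum_prB_mul, mul_sub, Finset.sum_sub_distrib, ← mul_assoc, ← Finset.sum_mul,
    sum_cx_sq, one_mul, sub_self]

/-- The divergence of symmetric tracefree 2-tensor fields. -/
def dvTB : TF →ₗ[ℝ] VF where
  toFun W := VF.mk (fun j => ∑ k, prB j k * ∑ i, pdD i (W.c i k)) (sum_prB_tan _)
  map_add' V W := by
    refine VF.ext fun j => ?_
    simp only [VF.mk_c, VF.add_c, TF.add_c, map_add, Finset.sum_add_distrib, mul_add]
  map_smul' c W := by
    refine VF.ext fun j => ?_
    simp only [VF.mk_c, VF.smul_c, TF.smul_c, Derivation.map_smul, ← Finset.smul_sum,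
      mul_smul_comm, RingHom.id_apply]

/-- The covariant derivative, `∇_i X_j`. -/
def nabB (X : VF) (i j : Fin 3) : SF := pdD i (X.c j) + cx j * X.c i

/-- Since `x · X = 0`, the normal part of `∂_i X` in its second slot is `-X_i`, and the derivative
has no radial part in its first slot. The double projection thus reduces to one correction term. -/
lemma nabB_eq (X : VF) (i j : Fin 3) :
    ∑ k, ∑ l, prB i k * prB j l * pdD k (X.c l) = nabB X i j := by
  have h1 : ∀ k, ∑ l, prB i k * prB j l * pdD k (X.c l) = prB i k * nabB X k j := by
    intro k
    simp only [mul_assoc, ← Finset.mul_sum]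
    rw [sum_prB_mul, sum_cx_pdD_VF, nabB]
    ring
  rw [Finset.sum_congr rfl fun k _ => h1 k, sum_prB_mul]
  have h2 : ∑ k, cx k * nabB X k j = 0 := by
    have h3 : ∑ k, cx k * nabB X k j =
        ∑ k, cx k * pdD k (X.c j) + cx j * ∑ k, cx k * X.c k := by
      rw [Finset.mul_sum, ← Finset.sum_add_distrib]
      refine Finset.sum_congr rfl fun k _ => ?_
      rw [nabB]; ring
    rw [h3, sum_cx_pdD, VF.tan]; simp
  rw [h2, mul_zero, sub_zero]

lemma sum_cx_nabB_left (X : VF) (j : Fin 3) : ∑ i, cx i * nabB X i j = 0 := by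
  have h3 : ∑ k, cx k * nabB X k j =
      ∑ k, cx k * pdD k (X.c j) + cx j * ∑ k, cx k * X.c k := by
    rw [Finset.mul_sum, ← Finset.sum_add_distrib]
    refine Finset.sum_congr rfl fun k _ => ?_
    rw [nabB]; ring
  rw [h3, sum_cx_pdD, VF.tan]; simp

lemma sum_cx_nabB_right (X : VF) (i : Fin 3) : ∑ j, cx j * nabB X i j = 0 := by
  simp only [nabB, mul_add, Finset.sum_add_distrib, sum_cx_pdD_VF, ← mul_assoc, ← Finset.sum_mul,
    sum_cx_sq]
  ring

lemma sum_nabB_self (X : VF) : ∑ i, nabB X i i = dvB X := by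
  simp only [nabB, Finset.sum_add_distrib, VF.tan, add_zero, dvB_apply]

/-- The operator `D₂*`. -/
def D2B : VF →ₗ[ℝ] TF where
  toFun X := TF.mk (fun i j => (-(1 / 2) : ℝ) • (nabB X i j + nabB X j i - dvB X * prB i j)) (by
    refine ⟨fun i j => ?_, fun j => ?_, ?_⟩
    · rw [prB_comm, add_comm]
    · simp only [mul_smul_comm, ← Finset.smul_sum, mul_sub, mul_add, Finset.sum_sub_distrib,
        Finset.sum_add_distrib, sum_cx_nabB_left, sum_cx_nabB_right, mul_left_comm _ (dvB X),
        ← Finset.mul_sum, sum_cx_prB]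
      simp
    · simp only [← Finset.smul_sum, Finset.sum_sub_distrib, Finset.sum_add_distrib,
        sum_nabB_self, ← Finset.mul_sum, sum_prB_self]
      rw [show dvB X + dvB X - dvB X * 2 = 0 by ring, smul_zero])
  map_add' X Y := by
    refine TF.ext fun i j => ?_
    simp only [nabB, TF.mk_c, TF.add_c, VF.add_c, map_add, ← smul_add]
    congr 1
    ring
  map_smul' c X := by
    refine TF.ext fun i j => ?_
    simp only [nabB, TF.mk_c, TF.smul_c, VF.smul_c, map_smul, RingHom.id_apply,
      Derivation.map_smul, mul_smul_comm, smul_mul_assoc, ← smul_add, ← smul_sub]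
    rw [smul_comm]

lemma D2B_apply (X : VF) (i j : Fin 3) :
    (D2B X).c i j = (-(1 / 2) : ℝ) • (nabB X i j + nabB X j i - dvB X * prB i j) := rfl

lemma dvTB_apply (W : TF) (j : Fin 3) :
    (dvTB W).c j = ∑ k, prB j k * ∑ i, pdD i (W.c i k) := rfl

/-- The Hodge dual. -/
def hodgeB : VF →ₗ[ℝ] VF where
  toFun X := VF.mk ![X.c 1 * cx 2 - X.c 2 * cx 1, X.c 2 * cx 0 - X.c 0 * cx 2,
    X.c 0 * cx 1 - X.c 1 * cx 0] (by
      simp only [Fin.sum_univ_three, Matrix.cons_val]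
      ring)
  map_add' X Y := by
    refine VF.ext fun i => ?_
    fin_cases i <;> simp [add_mul] <;> ring
  map_smul' c X := by
    refine VF.ext fun i => ?_
    fin_cases i <;> simp [smul_sub]

lemma hodgeB_zero (X : VF) : (hodgeB X).c 0 = X.c 1 * cx 2 - X.c 2 * cx 1 := rfl
lemma hodgeB_one (X : VF) : (hodgeB X).c 1 = X.c 2 * cx 0 - X.c 0 * cx 2 := rfl
lemma hodgeB_two (X : VF) : (hodgeB X).c 2 = X.c 0 * cx 1 - X.c 1 * cx 0 := rfl

/-- The operator `D₁*`. -/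
def D1B (f g : SF) : VF := -gradB f + hodgeB (gradB g)

/-! ### Comparison with the operators on unbundled fields -/

/-- The underlying covector field. -/
def toCov : VF →ₗ[ℝ] Cov where
  toFun X := fun x i => (X.c i : Scal) x
  map_add' _ _ := rfl
  map_smul' _ _ := rfl

/-- The underlying 2-tensor field. -/
def toTen : TF →ₗ[ℝ] Ten where
  toFun W := fun x i j => (W.c i j : Scal) x
  map_add' _ _ := rfl
  map_smul' _ _ := rfl

lemma toCov_injective : Function.Injective toCov := fun _ _ h =>
  VF.ext fun i => SF.ext fun x => congrFun (congrFun h x) i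

lemma toCov_apply (X : VF) (x : Sph) (i : Fin 3) : toCov X x i = (X.c i : Scal) x := rfl
lemma toTen_apply (W : TF) (x : Sph) (i j : Fin 3) : toTen W x i j = (W.c i j : Scal) x := rfl

lemma grad_coe (f : SF) : grad f = toCov (gradB f) := rfl

lemma dv_toCov (X : VF) : dv (toCov X) = dvB X := by
  funext x
  rw [dvB_apply, SF.coe_sum_apply]
  rfl

lemma lap_coe (f : SF) : lap f = lapB f := dv_toCov (gradB f)

lemma dvT_toTen (W : TF) : dvT (toTen W) = toCov (dvTB W) := by
  funext x j
  rw [toCov_apply, dvTB_apply, SF.coe_sum_apply]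
  simp only [SF.coe_mul, Pi.mul_apply, SF.coe_sum_apply, coe_prB]
  rfl

lemma nab_toCov (X : VF) (x : Sph) (i j : Fin 3) :
    nab (toCov X) x i j = (nabB X i j : Scal) x := by
  rw [← nabB_eq, SF.coe_sum_apply]
  simp only [SF.coe_mul, Pi.mul_apply, SF.coe_sum_apply, coe_prB]
  rfl

lemma D2s_toCov (X : VF) : D2s (toCov X) = toTen (D2B X) := by
  funext x i j
  rw [toTen_apply, D2B_apply, D2s, nab_toCov, nab_toCov, dv_toCov, ← coe_prB]
  rfl

lemma hodge_toCov (X : VF) : hodge (toCov X) = toCov (hodgeB X) := by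
  funext x i
  fin_cases i <;> rfl

lemma D1s_coe (f g : SF) : D1s f g = toCov (D1B f g) := by
  rw [D1s, D1B, grad_coe, grad_coe, hodge_toCov, LinearMap.map_add, map_neg]

lemma exists_VF {X : Cov} (hX : ∀ i, SmoothS (fun y => X y i)) (ht : IsTangent X) :
    ∃ Y : VF, toCov Y = X := by
  refine ⟨VF.mk (fun i => SF.mk (fun y => X y i) (hX i)) (SF.ext fun x => ?_), rfl⟩
  rw [SF.coe_sum_apply]
  exact ht x

lemma exists_TF {W : Ten} (hW : ∀ i j, SmoothS (fun y => W y i j)) (ht : IsSTF W) :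
    ∃ V : TF, toTen V = W := by
  refine ⟨TF.mk (fun i j => SF.mk (fun y => W y i j) (hW i j))
    ⟨fun i j => SF.ext fun x => (ht x).1 i j, fun j => SF.ext fun x => ?_,
      SF.ext fun x => ?_⟩, rfl⟩
  · rw [SF.coe_sum_apply]
    exact (ht x).2.1 j
  · rw [SF.coe_sum_apply]
    exact (ht x).2.2

lemma isTangent_toCov (X : VF) : IsTangent (toCov X) := by
  intro x
  have h := congrFun (congrArg SF.val (VF.tan X)) x
  rw [SF.coe_sum_apply] at h
  exact h

lemma isSTF_toTen (W : TF) : IsSTF (toTen W) := by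
  intro x
  refine ⟨fun i j => ?_, fun j => ?_, ?_⟩
  · exact congrFun (congrArg SF.val (TF.symm W i j)) x
  · have h := congrFun (congrArg SF.val (TF.tan W j)) x
    rw [SF.coe_sum_apply] at h
    exact h
  · have h := congrFun (congrArg SF.val (TF.trace W)) x
    rw [SF.coe_sum_apply] at h
    exact h

/-! ### Identities -/

lemma sum_prB_pdD (k : Fin 3) (f : SF) : ∑ i, prB i k * pdD i f = pdD k f := by
  have h := sum_prB_mul k fun i => pdD i f
  rw [sum_cx_pdD, mul_zero, sub_zero] at h
  rw [← h]
  exact Finset.sum_congr rfl fun i _ => by rw [prB_comm]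

lemma sum_pdD_cx : ∑ i, pdD i (cx i) = 2 := by
  simp only [pdD_cx', sum_prB_self]

lemma sum_pdD_pdD (f : Fin 3 → SF) (k : Fin 3) : ∑ i, pdD i (pdD k (f i)) =
    pdD k (∑ i, pdD i (f i)) + ∑ i, cx i * pdD k (f i) - cx k * ∑ i, pdD i (f i) := by
  rw [map_sum, Finset.mul_sum, ← Finset.sum_add_distrib, ← Finset.sum_sub_distrib]
  refine Finset.sum_congr rfl fun i _ => ?_
  linear_combination pdD_comm k i (f i)

/-- Commuting derivatives by `pdD_comm` turns the divergence of the symmetrised derivative into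
Laplacians of the Euclidean components. The divergence of `X` then survives only along the normal
`x_k` and is removed by the projection. -/
lemma dvTB_D2B (X : VF) (j : Fin 3) : (dvTB (D2B X)).c j =
    (-(1 / 2) : ℝ) • ∑ k, prB j k * (lapB (X.c k) + 2 * X.c k) := by
  have key : ∀ k, ∑ i, pdD i (nabB X i k + nabB X k i - dvB X * prB i k) =
      lapB (X.c k) + 2 * X.c k + cx k * (2 * dvB X) := by
    intro k
    have h1 : ∀ i, pdD i (nabB X i k + nabB X k i - dvB X * prB i k) =
        pdD i (pdD i (X.c k)) + (cx k * pdD i (X.c i) + prB i k * X.c i)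
        + (pdD i (pdD k (X.c i)) + (cx i * pdD i (X.c k) + X.c k * pdD i (cx i)))
        - prB i k * pdD i (dvB X)
        + dvB X * (cx i * pdD i (cx k) + cx k * pdD i (cx i)) := by
      intro i
      have h2 : pdD i (prB i k) = -(cx i * pdD i (cx k) + cx k * pdD i (cx i)) := by
        rw [prB, map_sub, leib]
        split_ifs <;> simp
      rw [map_sub, map_add, leib i (dvB X), h2]
      simp only [nabB, map_add, leib]
      rw [pdD_cx' i k]
      ring
    rw [Finset.sum_congr rfl fun i _ => h1 i]
    simp only [Finset.sum_add_distrib, Finset.sum_sub_distrib, ← Finset.mul_sum, sum_cx_pdD,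
      sum_pdD_cx, sum_prB_pdD, sum_pdD_pdD, sum_cx_pdD_VF]
    have h3 : ∑ i, prB i k * X.c i = X.c k := by
      have h2 := sum_prB_mul k X.c
      rw [VF.tan, mul_zero, sub_zero] at h2
      rw [← h2]; exact Finset.sum_congr rfl fun _ _ => by rw [prB_comm]
    rw [h3, ← lapB_apply, ← dvB_apply]
    ring
  rw [dvTB_apply]
  simp only [D2B_apply, Derivation.map_smul, ← Finset.smul_sum, key, mul_smul_comm]
  congr 1
  simp only [mul_add, Finset.sum_add_distrib]
  have h4 : ∑ k, prB j k * (cx k * (2 * dvB X)) = 0 := by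
    simp only [← mul_assoc, ← Finset.sum_mul]
    have := sum_cx_prB j
    rw [show ∑ k, prB j k * cx k = 0 by
      rw [← this]; exact Finset.sum_congr rfl fun k _ => by rw [prB_comm, mul_comm]]
    simp
  rw [h4, add_zero]

lemma lapB_pdD (f : SF) (k : Fin 3) : lapB (pdD k f) = pdD k (lapB f) - 2 * cx k * lapB f := by
  have h1 : ∀ i, pdD i (pdD i (pdD k f)) = pdD i (pdD k (pdD i f))
      + (cx i * pdD i (pdD k f) + pdD k f * pdD i (cx i))
      - (cx k * pdD i (pdD i f) + prB i k * pdD i f) := by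
    intro i
    have h := congrArg (pdD i) (pdD_comm k i f)
    simp only [map_sub, leib, pdD_cx' i k] at h
    linear_combination h
  rw [lapB_apply, Finset.sum_congr rfl fun i _ => h1 i]
  simp only [Finset.sum_add_distrib, Finset.sum_sub_distrib, ← Finset.mul_sum, sum_cx_pdD,
      sum_pdD_cx, sum_prB_pdD, sum_pdD_pdD, ← lapB_apply]
  have h2 := sum_cx_pdD_VF (gradB f) k
  simp only [gradB_apply] at h2
  rw [h2]
  ring

lemma lapB_mul (f g : SF) :
    lapB (f * g) = f * lapB g + g * lapB f + 2 * ∑ i, pdD i f * pdD i g := by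
  simp only [lapB_apply, leib, map_add, Finset.mul_sum, ← Finset.sum_add_distrib]
  exact Finset.sum_congr rfl fun i _ => by ring

lemma lapB_cx (k : Fin 3) : lapB (cx k) = -(2 * cx k) := by
  have h2 : ∀ i, pdD i (prB i k) = -(cx i * pdD i (cx k) + cx k * pdD i (cx i)) := by
    intro i
    rw [prB, map_sub, leib]
    split_ifs <;> simp
  simp only [lapB_apply, pdD_cx', h2]
  simp only [Finset.sum_neg_distrib, Finset.sum_add_distrib, ← Finset.mul_sum]
  simp only [← pdD_cx', sum_cx_pdD, sum_pdD_cx]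
  ring

lemma sum_prB_tan_apply (X : VF) (j : Fin 3) : ∑ k, prB j k * X.c k = X.c j := by
  rw [sum_prB_mul, VF.tan, mul_zero, sub_zero]

lemma dvTB_D2B_gradB (f : SF) :
    dvTB (D2B (gradB f)) = (-(1 / 2) : ℝ) • gradB (lapB f + (2 : ℝ) • f) := by
  refine VF.ext fun j => ?_
  rw [dvTB_D2B]
  change _ = (-(1 / 2) : ℝ) • pdD j (lapB f + (2 : ℝ) • f)
  congr 1
  have h : ∀ k, prB j k * (lapB ((gradB f).c k) + 2 * (gradB f).c k) =
      prB j k * (gradB (lapB f + (2 : ℝ) • f)).c k + (prB j k * cx k) * (-2 * lapB f) := by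
    intro k
    rw [gradB_apply, gradB_apply, lapB_pdD, map_add, Derivation.map_smul,
      show (2 : ℝ) • pdD k f = 2 * pdD k f by rw [Algebra.smul_def, map_ofNat]]
    ring
  rw [Finset.sum_congr rfl fun k _ => h k, Finset.sum_add_distrib, sum_prB_tan_apply,
    ← Finset.sum_mul, sum_prB_mul, sum_cx_sq]
  simp [gradB_apply]

lemma lapB_hodge_component (f : SF) (a b : Fin 3) :
    lapB (pdD a f * cx b - pdD b f * cx a) = pdD a (lapB f) * cx b - pdD b (lapB f) * cx a := by
  rw [map_sub, lapB_mul, lapB_mul, lapB_pdD, lapB_pdD, lapB_cx, lapB_cx]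
  simp only [pdD_cx']
  have h : ∀ a b, ∑ i, pdD i (pdD a f) * prB i b = pdD b (pdD a f) := fun a b => by
    rw [← sum_prB_pdD b]
    exact Finset.sum_congr rfl fun i _ => mul_comm _ _
  rw [h, h]
  linear_combination 2 * pdD_comm a b f

lemma dvTB_D2B_hodgeB (f : SF) : dvTB (D2B (hodgeB (gradB f))) =
    (-(1 / 2) : ℝ) • hodgeB (gradB (lapB f + (2 : ℝ) • f)) := by
  refine VF.ext fun j => ?_
  rw [dvTB_D2B, VF.smul_c]
  congr 1
  rw [← sum_prB_tan_apply]
  refine Finset.sum_congr rfl fun k _ => ?_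
  congr 1
  have h2 : ∀ k, pdD k (lapB f + (2 : ℝ) • f) = pdD k (lapB f) + 2 * pdD k f := fun k => by
    rw [map_add, Derivation.map_smul, Algebra.smul_def, map_ofNat]
  fin_cases k
  · simp only [Fin.zero_eta, hodgeB_zero, gradB_apply, lapB_hodge_component, h2]
    ring
  · simp only [Fin.mk_one, hodgeB_one, gradB_apply, lapB_hodge_component, h2]
    ring
  · simp only [Fin.reduceFinMk, hodgeB_two, gradB_apply, lapB_hodge_component, h2]
    ring

/-- This reduces solvability for the tensor divergence to the scalar operator `Δ + 2` acting on the
two potentials, whose kernel is `l = 1`. -/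
lemma dvTB_D2B_D1B (f g : SF) : dvTB (D2B (D1B f g)) =
    (-(1 / 2) : ℝ) • D1B (lapB f + (2 : ℝ) • f) (lapB g + (2 : ℝ) • g) := by
  rw [D1B, LinearMap.map_add, map_neg, LinearMap.map_add, map_neg,
    dvTB_D2B_gradB, dvTB_D2B_hodgeB, D1B, smul_add,
    smul_neg]

lemma dvB_hodgeB (X : VF) : dvB (hodgeB X) = cx 2 * (pdD 0 (X.c 1) - pdD 1 (X.c 0))
    + cx 0 * (pdD 1 (X.c 2) - pdD 2 (X.c 1)) + cx 1 * (pdD 2 (X.c 0) - pdD 0 (X.c 2)) := by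
  rw [dvB_apply, Fin.sum_univ_three, hodgeB_zero, hodgeB_one, hodgeB_two]
  simp only [map_sub, leib, pdD_cx', prB]
  simp only [Fin.isValue, Fin.reduceEq, if_false, zero_ne_one, one_ne_zero]
  ring

lemma dvB_hodgeB_gradB (f : SF) : dvB (hodgeB (gradB f)) = 0 := by
  rw [dvB_hodgeB]
  simp only [gradB_apply]
  linear_combination (cx 2) * pdD_comm 1 0 f + cx 0 * pdD_comm 2 1 f + cx 1 * pdD_comm 0 2 f

lemma hodgeB_hodgeB (X : VF) : hodgeB (hodgeB X) = -X := by
  have h1 := sum_cx_sq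
  have h2 := VF.tan X
  rw [Fin.sum_univ_three] at h1 h2
  refine VF.ext fun i => ?_
  fin_cases i
  · change (hodgeB X).c 1 * cx 2 - (hodgeB X).c 2 * cx 1 = -X.c 0
    rw [hodgeB_one, hodgeB_two]
    linear_combination -X.c 0 * h1 + cx 0 * h2
  · change (hodgeB X).c 2 * cx 0 - (hodgeB X).c 0 * cx 2 = -X.c 1
    rw [hodgeB_two, hodgeB_zero]
    linear_combination -X.c 1 * h1 + cx 1 * h2
  · change (hodgeB X).c 0 * cx 1 - (hodgeB X).c 1 * cx 0 = -X.c 2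
    rw [hodgeB_zero, hodgeB_one]
    linear_combination -X.c 2 * h1 + cx 2 * h2

/-- The components of a tangent field without divergence and curl are harmonic. -/
lemma lapB_eq_zero_of_dvB (N : VF) (h1 : dvB N = 0) (h2 : dvB (hodgeB N) = 0) (k : Fin 3) :
    lapB (N.c k) = 0 := by
  rw [dvB_hodgeB] at h2
  have hs := sum_cx_sq
  have ht := VF.tan N
  have hv := sum_cx_pdD_VF N
  have hx : ∀ j, ∑ i, cx i * pdD i (N.c j) = 0 := fun j => sum_cx_pdD _
  simp only [Fin.sum_univ_three] at hs ht hv hx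
  -- Vanishing curl makes `∇N` symmetric: modulo the tangency relations each antisymmetric component
  -- is a coordinate times the curl.
  have c01 : nabB N 0 1 = nabB N 1 0 := by
    simp only [nabB]
    linear_combination (-(pdD 0 (N.c 1) - pdD 1 (N.c 0))) * hs + cx 2 * h2 - cx 0 * hv 1
      + cx 1 * hv 0 + cx 0 * hx 1 - cx 1 * hx 0
  have c12 : nabB N 1 2 = nabB N 2 1 := by
    simp only [nabB]
    linear_combination (-(pdD 1 (N.c 2) - pdD 2 (N.c 1))) * hs + cx 0 * h2 - cx 1 * hv 2
      + cx 2 * hv 1 + cx 1 * hx 2 - cx 2 * hx 1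
  have c20 : nabB N 2 0 = nabB N 0 2 := by
    simp only [nabB]
    linear_combination (-(pdD 2 (N.c 0) - pdD 0 (N.c 2))) * hs + cx 1 * h2 - cx 2 * hv 0
      + cx 0 * hv 2 + cx 2 * hx 0 - cx 0 * hx 2
  have hc : ∀ i k, nabB N i k = nabB N k i := by
    intro i k
    fin_cases i <;> fin_cases k
    exacts [rfl, c01, c20.symm, c01.symm, rfl, c12, c20, c12.symm, rfl]
  have h3 : ∀ i, pdD i (pdD i (N.c k)) = pdD i (pdD k (N.c i)) +
      (cx i * pdD i (N.c k) + N.c k * pdD i (cx i)) -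
      (cx k * pdD i (N.c i) + prB i k * N.c i) := by
    intro i
    have h := congrArg (pdD i) (hc i k)
    simp only [nabB, map_add, leib, pdD_cx' i k] at h
    linear_combination h
  rw [lapB_apply, Finset.sum_congr rfl fun i _ => h3 i]
  have h5 : ∑ i, prB i k * N.c i = N.c k := by
    rw [← sum_prB_tan_apply N k]; exact Finset.sum_congr rfl fun _ _ => by rw [prB_comm]
  simp only [Finset.sum_add_distrib, Finset.sum_sub_distrib, ← Finset.mul_sum, sum_cx_pdD,
      sum_pdD_cx, sum_pdD_pdD, sum_cx_pdD_VF, h5, ← dvB_apply, h1, map_zero]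
  ring

/-! ### Modes of degree one -/

/-- Gradients of linear functions are conformal Killing, because the Hessian of `x_a` is `-x_a`
times the metric. -/
lemma D2B_gradB_cx (a : Fin 3) : D2B (gradB (cx a)) = 0 := by
  refine TF.ext fun i j => ?_
  rw [D2B_apply, dvB_gradB, lapB_cx]
  have h : ∀ i j, nabB (gradB (cx a)) i j = -(cx a * prB i j) := by
    intro i j
    have h2 : pdD i (prB j a) = -(cx j * pdD i (cx a) + cx a * pdD i (cx j)) := by
      rw [prB, map_sub, leib]
      split_ifs <;> simp
    rw [nabB, gradB_apply, gradB_apply, pdD_cx', h2]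
    simp only [pdD_cx']
    ring
  rw [h, h, prB_comm j i, show -(cx a * prB i j) + -(cx a * prB i j) - -(2 * cx a) * prB i j = 0 by
    ring, smul_zero]
  rfl

lemma exists_antisymm (a : Fin 3) : ∃ A : Fin 3 → Fin 3 → ℝ, (∀ i j, A i j = -A j i) ∧
    ∀ k, (hodgeB (gradB (cx a))).c k = ∑ b, A k b • cx b := by
  refine ⟨![![![0, 0, 0], ![0, 0, -1], ![0, 1, 0]], ![![0, 0, 1], ![0, 0, 0], ![-1, 0, 0]],
    ![![0, -1, 0], ![1, 0, 0], ![0, 0, 0]]] a, fun i j => ?_, fun k => ?_⟩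
  · fin_cases a <;> fin_cases i <;> fin_cases j <;> simp
  · fin_cases a <;> fin_cases k <;>
    simp [Fin.sum_univ_three, hodgeB, gradB_apply, pdD_cx, sub_mul] <;> ring

/-- These are the rotation fields: restrictions of linear fields with antisymmetric matrix, hence
Killing. -/
lemma D2B_hodgeB_gradB_cx (a : Fin 3) : D2B (hodgeB (gradB (cx a))) = 0 := by
  obtain ⟨A, hA, h⟩ := exists_antisymm a
  refine TF.ext fun i j => ?_
  rw [D2B_apply, dvB_hodgeB_gradB]
  have h2 : ∀ i j, pdD i ((hodgeB (gradB (cx a))).c j) =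
      algebraMap ℝ SF (A j i) - cx i * (hodgeB (gradB (cx a))).c j := by
    intro i j
    rw [h]
    simp only [map_sum, Derivation.map_smul, pdD_cx', prB, smul_sub, Finset.sum_sub_distrib, Finset.mul_sum]
    congr 1
    · simp [Algebra.algebraMap_eq_smul_one]
    · refine Finset.sum_congr rfl fun b _ => ?_
      rw [mul_smul_comm]
  rw [nabB, nabB, h2, h2, hA j i, map_neg]
  rw [show (-(algebraMap ℝ SF) (A i j) - cx i * (hodgeB (gradB (cx a))).c j +
    cx j * (hodgeB (gradB (cx a))).c i + ((algebraMap ℝ SF) (A i j) -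
    cx j * (hodgeB (gradB (cx a))).c i + cx i * (hodgeB (gradB (cx a))).c j) - 0 * prB i j) = 0 by
    ring, smul_zero]
  rfl

/-! ### Products -/

/-- The pointwise inner product of covector fields. -/
def dotB (X Y : VF) : SF := ∑ i, X.c i * Y.c i

/-- The pointwise inner product of tensor fields. -/
def ddotB (V W : TF) : SF := ∑ i, ∑ j, V.c i j * W.c i j

/-- The product of a function and a covector field. -/
def smulB (f : SF) (X : VF) : VF := VF.mk (fun i => f * X.c i) (by
  simp only [mul_left_comm _ f, ← Finset.mul_sum, VF.tan, mul_zero])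

/-- The contraction of a 2-tensor field and a covector field. -/
def contrB (W : TF) (X : VF) : VF := VF.mk (fun j => ∑ i, W.c i j * X.c i) (by
  simp only [Finset.mul_sum]
  rw [Finset.sum_comm]
  simp only [← mul_assoc, ← Finset.sum_mul, TF.tan', zero_mul, Finset.sum_const_zero])

lemma dvB_smulB (f : SF) (X : VF) : dvB (smulB f X) = f * dvB X + dotB (gradB f) X := by
  simp only [dvB_apply, smulB, VF.mk_c, leib, dotB, Finset.sum_add_distrib, ← Finset.mul_sum, gradB_apply]
  congr 1
  exact Finset.sum_congr rfl fun i _ => mul_comm _ _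

/-- Pointwise form of the adjointness of `div` and `D₂*`. Against a symmetric tracefree tangent
tensor, only the symmetric tracefree part of the derivative of `X` is seen. -/
lemma dotB_dvTB (W : TF) (X : VF) : dotB (dvTB W) X = dvB (contrB W X) + ddotB W (D2B X) := by
  have h1 : dotB (dvTB W) X = ∑ k, X.c k * ∑ i, pdD i (W.c i k) := by
    simp only [dotB, dvTB_apply, Finset.sum_mul]
    rw [Finset.sum_comm]
    refine Finset.sum_congr rfl fun k _ => ?_
    have h2 := sum_prB_tan_apply X k
    rw [← h2, Finset.sum_mul]
    refine Finset.sum_congr rfl fun j _ => ?_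
    rw [prB_comm]
    ring
  have h2 : ddotB W (D2B X) = -∑ j, ∑ i, W.c i j * pdD j (X.c i) := by
    have h3 : ∀ i j, W.c i j * (D2B X).c i j = (-(1 / 2) : ℝ) • (W.c i j * pdD i (X.c j)
        + (cx j * W.c i j) * X.c i + (W.c j i * pdD j (X.c i) + (cx i * W.c i j) * X.c j)
        - dvB X * ((if i = j then W.c i j else 0) - cx i * (cx j * W.c i j))) := by
      intro i j
      rw [D2B_apply, mul_smul_comm, TF.symm W j i]
      congr 1
      simp only [nabB, prB]
      split_ifs <;> ring
    have e1 : ∑ i, ∑ j, (cx j * W.c i j) * X.c i = 0 := by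
      simp only [← Finset.sum_mul, TF.tan', zero_mul, Finset.sum_const_zero]
    have e2 : ∑ i, ∑ j, (cx i * W.c i j) * X.c j = 0 := by
      rw [Finset.sum_comm]
      simp only [← Finset.sum_mul, TF.tan, zero_mul, Finset.sum_const_zero]
    have e3 : ∑ i, ∑ j, (cx i * (cx j * W.c i j)) = 0 := by
      simp only [← Finset.mul_sum, TF.tan', mul_zero, Finset.sum_const_zero]
    have e4 : ∑ i, ∑ j, (W.c i j * pdD i (X.c j)) = ∑ j, ∑ i, W.c i j * pdD j (X.c i) := by
      refine Finset.sum_congr rfl fun i _ => Finset.sum_congr rfl fun j _ => ?_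
      rw [TF.symm]
    have e5 : ∑ i, ∑ j, (W.c j i * pdD j (X.c i)) = ∑ j, ∑ i, W.c i j * pdD j (X.c i) := by
      rw [← e4, Finset.sum_comm]
    simp only [ddotB, h3, ← Finset.smul_sum, Finset.sum_add_distrib, Finset.sum_sub_distrib,
      ← Finset.mul_sum, e1, e2, e4, e5]
    simp only [TF.tan', Finset.sum_ite_eq, Finset.mem_univ,
      if_true, TF.trace, mul_zero, Finset.sum_const_zero]
    rw [sub_zero, mul_zero, sub_zero, ← two_smul ℝ, smul_smul]
    norm_num
  rw [h1, h2, dvB_apply]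
  simp only [contrB, VF.mk_c, map_sum, leib, Finset.sum_add_distrib]
  have e : ∑ k, X.c k * ∑ i, pdD i (W.c i k) = ∑ j, ∑ i, X.c i * pdD j (W.c i j) := by
    simp only [Finset.mul_sum]
    rw [Finset.sum_comm]
    refine Finset.sum_congr rfl fun i _ => Finset.sum_congr rfl fun j _ => ?_
    rw [TF.symm]
  rw [e]
  ring

/-! ## Integration over the sphere -/

instance : IsFiniteMeasure area := inferInstanceAs (IsFiniteMeasure
  (MeasureTheory.volume : MeasureTheory.Measure E3).toSphere)

instance : area.IsOpenPosMeasure := inferInstanceAs (Measure.IsOpenPosMeasure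
  (MeasureTheory.volume : MeasureTheory.Measure E3).toSphere)

lemma integrable_of_continuous {f : Scal} (hf : Continuous f) : Integrable f area :=
  hf.integrable_of_hasCompactSupport (HasCompactSupport.of_compactSpace f)

lemma SF.integrable (f : SF) : Integrable (f : Scal) area := integrable_of_continuous (SF.continuous f)

/-- The integral over the sphere. -/
def intB : SF →ₗ[ℝ] ℝ where
  toFun f := ∫ x, (f : Scal) x ∂area
  map_add' f g := integral_add (SF.integrable f) (SF.integrable g)
  map_smul' c _ := integral_const_mul c _

lemma intB_apply (f : SF) : intB f = ∫ x, (f : Scal) x ∂area := rfl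

/-- The action of a linear isometry on the sphere. -/
def sphMap (e : E3 ≃ₗᵢ[ℝ] E3) (x : Sph) : Sph := ⟨e x.1, by
  rw [mem_sphere_zero_iff_norm, e.norm_map, norm_val]⟩

lemma continuous_sphMap (e : E3 ≃ₗᵢ[ℝ] E3) : Continuous (sphMap e) :=
  (e.continuous.comp continuous_subtype_val).subtype_mk _

lemma sphMap_symm_apply (e : E3 ≃ₗᵢ[ℝ] E3) (x : Sph) : sphMap e.symm (sphMap e x) = x :=
  Subtype.ext (e.symm_apply_apply _)

/-- The homeomorphism of the sphere defined by a linear isometry. -/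
def sphHomeo (e : E3 ≃ₗᵢ[ℝ] E3) : Sph ≃ₜ Sph where
  toFun := sphMap e
  invFun := sphMap e.symm
  left_inv x := sphMap_symm_apply e x
  right_inv x := sphMap_symm_apply e.symm x
  continuous_toFun := continuous_sphMap e
  continuous_invFun := continuous_sphMap e.symm

/-- The area of a set is a multiple of the volume of the cone over it, and linear isometries
preserve volume. -/
lemma measurePreserving_sphMap (e : E3 ≃ₗᵢ[ℝ] E3) : MeasurePreserving (sphMap e) area area := by
  refine ⟨(continuous_sphMap e).measurable, ?_⟩
  ext s hs
  rw [Measure.map_apply (continuous_sphMap e).measurable hs, area,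
    Measure.toSphere_apply' _ ((continuous_sphMap e).measurable hs),
    Measure.toSphere_apply' _ hs]
  congr 1
  rw [← MeasurePreserving.measure_preimage_equiv (f := e.symm.toMeasurableEquiv)
    e.symm.measurePreserving]
  congr 1
  ext y
  simp only [Set.mem_smul, Set.mem_image, Set.mem_preimage]
  constructor
  · rintro ⟨t, ht, -, ⟨x, hx, rfl⟩, hy⟩
    refine ⟨t, ht, _, ⟨sphMap e x, hx, rfl⟩, ?_⟩
    change t • e x.1 = y
    rw [← map_smul, hy]
    exact e.apply_symm_apply y
  · rintro ⟨t, ht, -, ⟨x, hx, rfl⟩, rfl⟩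
    refine ⟨t, ht, _, ⟨sphMap e.symm x, ?_, rfl⟩, ?_⟩
    · rwa [show sphMap e (sphMap e.symm x) = x from Subtype.ext (e.apply_symm_apply _)]
    · change t • e.symm x.1 = e.symm (t • x.1)
      rw [map_smul]

lemma integral_sphMap (e : E3 ≃ₗᵢ[ℝ] E3) (f : Scal) :
    ∫ x, f (sphMap e x) ∂area = ∫ x, f x ∂area :=
  (measurePreserving_sphMap e).integral_comp (sphHomeo e).measurableEmbedding f

/-- The rotation by the angle `s` in the plane of the coordinates `i` and `j`. -/
def rotFun (i j : Fin 3) (s : ℝ) (y : E3) : E3 :=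
  y + ((Real.cos s - 1) * y i - Real.sin s * y j) • EuclideanSpace.single i (1 : ℝ)
    + (Real.sin s * y i + (Real.cos s - 1) * y j) • EuclideanSpace.single j (1 : ℝ)

lemma norm_rotFun {i j : Fin 3} (h : i ≠ j) (s : ℝ) (y : E3) : ‖rotFun i j s y‖ = ‖y‖ := by
  rw [EuclideanSpace.norm_eq, EuclideanSpace.norm_eq]
  congr 1
  have hs := Real.sin_sq_add_cos_sq s
  fin_cases i <;> fin_cases j <;>
  first
  | exact absurd rfl h
  | (simp only [rotFun, Fin.sum_univ_three, Real.norm_eq_abs, sq_abs]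
     simp
     first
     | linear_combination (y 0 ^ 2 + y 1 ^ 2) * hs
     | linear_combination (y 0 ^ 2 + y 2 ^ 2) * hs
     | linear_combination (y 1 ^ 2 + y 2 ^ 2) * hs)

/-- The rotation in a coordinate plane as a linear isometry. -/
def rot {i j : Fin 3} (h : i ≠ j) (s : ℝ) : E3 ≃ₗᵢ[ℝ] E3 :=
  LinearIsometry.toLinearIsometryEquiv
    { toFun := rotFun i j s
      map_add' := fun y z => by
        ext k; simp [rotFun]; split_ifs <;> ring
      map_smul' := fun c y => by
        ext k; simp [rotFun]; split_ifs <;> ring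
      norm_map' := norm_rotFun h s } rfl

lemma hasDerivAt_rotFun {i j : Fin 3} (h : i ≠ j) (s : ℝ) (y : E3) :
    HasDerivAt (fun s => rotFun i j s y) (rotFun i j s y i • EuclideanSpace.single j (1 : ℝ) -
      rotFun i j s y j • EuclideanSpace.single i (1 : ℝ)) s := by
  have h1 : HasDerivAt (fun s => rotFun i j s y)
      (((-Real.sin s) * y i - Real.cos s * y j) • EuclideanSpace.single i (1 : ℝ)
        + (Real.cos s * y i + (-Real.sin s) * y j) • EuclideanSpace.single j (1 : ℝ)) s := by
    refine HasDerivAt.add (HasDerivAt.const_add _ (HasDerivAt.smul_const ?_ _))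
      (HasDerivAt.smul_const ?_ _)
    · exact (((Real.hasDerivAt_cos s).sub_const 1).mul_const _).sub
        ((Real.hasDerivAt_sin s).mul_const _)
    · exact ((Real.hasDerivAt_sin s).mul_const _).add
        (((Real.hasDerivAt_cos s).sub_const 1).mul_const _)
  convert h1 using 1
  have e1 : rotFun i j s y i = Real.cos s * y i - Real.sin s * y j := by
    simp [rotFun, h]; ring
  have e2 : rotFun i j s y j = Real.sin s * y i + Real.cos s * y j := by
    simp [rotFun, Ne.symm h]; ring
  rw [e1, e2]
  module

/-- Infinitesimal rotation invariance of the area measure. -/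
lemma intB_rot (f : SF) {i j : Fin 3} (h : i ≠ j) :
    intB (cx i * pdD j f) = intB (cx j * pdD i f) := by
  set g : SF := cx i * pdD j f - cx j * pdD i f with hg
  obtain ⟨C, hC⟩ := (isCompact_univ (X := Sph)).exists_bound_of_continuousOn
    (SF.continuous g).continuousOn
  have hcont : ∀ s, Continuous (fun x => (f : Scal) (sphMap (rot h s) x)) := fun s =>
    (SF.continuous f).comp (continuous_sphMap _)
  -- The integral of `f` composed with the rotation by `s` does not depend on `s`; it is
  -- differentiated under the integral sign at `s = 0`.
  have key := hasDerivAt_integral_of_dominated_loc_of_deriv_le (μ := area) (s := Set.univ)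
    (F := fun s x => (f : Scal) (sphMap (rot h s) x))
    (F' := fun s x => (g : Scal) (sphMap (rot h s) x)) (x₀ := (0 : ℝ)) (bound := fun _ => C)
    Filter.univ_mem (Filter.Eventually.of_forall fun s =>
      (integrable_of_continuous (hcont s)).aestronglyMeasurable)
    (integrable_of_continuous (hcont 0))
    (integrable_of_continuous ((SF.continuous g).comp (continuous_sphMap _))).aestronglyMeasurable
    (Filter.Eventually.of_forall fun x s _ => hC _ (Set.mem_univ _)) (integrable_const C)
    (Filter.Eventually.of_forall fun x s _ => by
      have h1 := ((SF.differentiableAt f) (val_ne_zero (sphMap (rot h s) x))).hasFDerivAt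
      have h2 : HasDerivAt (fun s => rotFun i j s x.1) _ s := hasDerivAt_rotFun h s x.1
      have h3 := h1.comp_hasDerivAt s h2
      have h4 : (rext (f : Scal) ∘ fun s => rotFun i j s x.1) =
          fun s => (f : Scal) (sphMap (rot h s) x) := by
        funext t
        exact rext_val (f : Scal) (sphMap (rot h t) x)
      rw [h4] at h3
      convert h3 using 1
      rw [map_sub, map_smul, map_smul]
      rfl)
  have h5 : (fun s => ∫ x, (f : Scal) (sphMap (rot h s) x) ∂area) = fun _ => intB f := by
    funext s
    exact integral_sphMap _ _
  have h6 := key.2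
  rw [h5] at h6
  have h7 := h6.unique (hasDerivAt_const _ _)
  rw [integral_sphMap (rot h 0) (g : Scal), ← intB_apply, hg, map_sub] at h7
  exact sub_eq_zero.mp h7

/-- The divergence of a Hodge dual is a sum of infinitesimal rotations applied to components, and
each of these integrates to zero. -/
lemma intB_dvB_hodgeB (X : VF) : intB (dvB (hodgeB X)) = 0 := by
  rw [dvB_hodgeB]
  simp only [mul_sub, map_add, map_sub]
  have h1 := intB_rot (X.c 1) (show (2 : Fin 3) ≠ 0 by decide)
  have h2 := intB_rot (X.c 0) (show (2 : Fin 3) ≠ 1 by decide)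
  have h3 := intB_rot (X.c 2) (show (0 : Fin 3) ≠ 1 by decide)
  linarith

/-- The divergence theorem. -/
lemma intB_dvB (X : VF) : intB (dvB X) = 0 := by
  -- Every tangent field is a Hodge dual, namely that of its own negative dual.
  have h := hodgeB_hodgeB (-X)
  rw [neg_neg] at h
  rw [← h]
  exact intB_dvB_hodgeB _

lemma intB_lapB (f : SF) : intB (lapB f) = 0 := intB_dvB _

lemma intB_dotB_gradB (f : SF) (X : VF) : intB (dotB (gradB f) X) = -intB (f * dvB X) := by
  have h := intB_dvB (smulB f X)
  rw [dvB_smulB, map_add] at h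
  linarith

lemma intB_mul_lapB (f g : SF) : intB (f * lapB g) = intB (g * lapB f) := by
  have h1 := intB_dotB_gradB f (gradB g)
  have h2 := intB_dotB_gradB g (gradB f)
  have h3 : dotB (gradB f) (gradB g) = dotB (gradB g) (gradB f) :=
    Finset.sum_congr rfl fun i _ => mul_comm _ _
  rw [h3, h2] at h1
  simpa [dvB_gradB] using h1.symm

lemma intB_dotB_dvTB (W : TF) (X : VF) : intB (dotB (dvTB W) X) = intB (ddotB W (D2B X)) := by
  rw [dotB_dvTB, map_add, intB_dvB, zero_add]

lemma eq_zero_of_intB_sq (f : SF) (h : intB (f * f) = 0) : f = 0 := by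
  have hc : Continuous fun x => (f : Scal) x * (f : Scal) x := (SF.continuous f).mul (SF.continuous f)
  have h0 := (integral_eq_zero_iff_of_nonneg (μ := area)
    (fun x => mul_self_nonneg ((f : Scal) x)) (integrable_of_continuous hc)).mp h
  have h1 := (hc.ae_eq_iff_eq area continuous_zero).mp h0
  refine SF.ext fun x => ?_
  have := congrFun h1 x
  simpa using this

/-! ### Moments -/

lemma intB_one : intB 1 = 4 * Real.pi := by
  rw [intB_apply]
  simp only [SF.coe_one, Pi.one_apply, integral_const, smul_eq_mul, mul_one]
  rw [area, Measure.toSphere_real_apply_univ]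
  rw [measureReal_def, EuclideanSpace.volume_ball_fin_three]
  simp
  rw [ENNReal.toReal_ofReal (by positivity)]
  ring

lemma intB_cx (i : Fin 3) : intB (cx i) = 0 := by
  have h := intB_lapB (cx i)
  rw [lapB_cx, map_neg, neg_eq_zero, ← map_ofNat (algebraMap ℝ SF), ← Algebra.smul_def,
    map_smul] at h
  simpa using h

lemma sum_pdD_cx_mul (i j : Fin 3) : ∑ k, pdD k (cx i) * pdD k (cx j) = prB i j := by
  have h := sum_prB_mul i fun k => prB k j
  rw [sum_cx_prB, mul_zero, sub_zero] at h
  rw [← h]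
  exact Finset.sum_congr rfl fun k _ => by rw [pdD_cx', pdD_cx', prB_comm]

lemma lapB_cx_mul_cx (i j : Fin 3) :
    lapB (cx i * cx j) = 2 * (if i = j then 1 else 0) - 6 * (cx i * cx j) := by
  rw [lapB_mul, lapB_cx, lapB_cx, sum_pdD_cx_mul, prB]
  ring

lemma intB_ofNat_mul (n : ℕ) [n.AtLeastTwo] (f : SF) :
    intB (OfNat.ofNat n * f) = OfNat.ofNat n * intB f := by
  rw [← map_ofNat (algebraMap ℝ SF), ← Algebra.smul_def, map_smul, smul_eq_mul]

/-- Integrate `Δ(x_i x_j) = 2δ_ij - 6 x_i x_j`. -/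
lemma intB_cx_mul_cx (i j : Fin 3) :
    intB (cx i * cx j) = if i = j then 4 * Real.pi / 3 else 0 := by
  have h := intB_lapB (cx i * cx j)
  rw [lapB_cx_mul_cx, map_sub, intB_ofNat_mul, intB_ofNat_mul] at h
  split_ifs with hij
  · rw [if_pos hij, intB_one] at h
    linarith
  · rw [if_neg hij, map_zero] at h
    linarith

/-- Self-adjointness of `Δ` on `x_i x_j` and `x_k`: up to a first moment, which vanishes, the
factors would be `-6` and `-2`. -/
lemma intB_cx_mul_cx_mul_cx (i j k : Fin 3) : intB (cx i * cx j * cx k) = 0 := by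
  have h := intB_mul_lapB (cx i * cx j) (cx k)
  rw [lapB_cx, lapB_cx_mul_cx] at h
  have e1 : cx i * cx j * -(2 * cx k) = -(2 * (cx i * cx j * cx k)) := by ring
  have e2 : cx k * (2 * (if i = j then 1 else 0) - 6 * (cx i * cx j)) =
      2 * ((if i = j then 1 else 0) * cx k) - 6 * (cx i * cx j * cx k) := by ring
  have e3 : intB ((if i = j then 1 else 0) * cx k) = 0 := by
    split_ifs
    · rw [one_mul, intB_cx]
    · rw [zero_mul, map_zero]
  rw [e1, e2, map_neg, map_sub, intB_ofNat_mul, intB_ofNat_mul, intB_ofNat_mul, e3] at h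
  linarith

/-! ## Zonal functions -/

/-- The Euclidean inner product of two points of the sphere. -/
def ip (x y : Sph) : ℝ := ∑ i, x.1 i * y.1 i

lemma ip_eq_inner (x y : Sph) : ip x y = inner ℝ x.1 y.1 := by
  simp [ip, PiLp.inner_apply, mul_comm]

lemma ip_comm (x y : Sph) : ip x y = ip y x := Finset.sum_congr rfl fun _ _ => mul_comm _ _

lemma ip_le_one (x y : Sph) : ip x y ≤ 1 := by
  rw [ip_eq_inner]
  simpa [norm_val] using real_inner_le_norm x.1 y.1

lemma neg_one_le_ip (x y : Sph) : -1 ≤ ip x y := by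
  rw [ip_eq_inner]
  have := neg_le_of_abs_le (abs_real_inner_le_norm x.1 y.1)
  simpa [norm_val] using this

lemma ip_self (x : Sph) : ip x x = 1 := sum_sq_val x

lemma eq_of_ip_eq_one {x y : Sph} (h : ip x y = 1) : x = y := by
  rw [ip_eq_inner] at h
  exact Subtype.ext ((inner_eq_one_iff_of_norm_eq_one (norm_val x) (norm_val y)).mp h)

lemma continuous_ip : Continuous fun p : Sph × Sph => ip p.1 p.2 := by
  simp only [ip_eq_inner]
  fun_prop

lemma continuous_ip_left (y : Sph) : Continuous fun x : Sph => ip x y :=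
  continuous_ip.comp (Continuous.prodMk continuous_id continuous_const)

/-- The linear function `x ↦ x · y`. -/
def tB (y : Sph) : SF := ∑ i, y.1 i • cx i

lemma tB_apply (y x : Sph) : (tB y : Scal) x = ip x y := by
  rw [tB, SF.coe_sum_apply]
  exact Finset.sum_congr rfl fun i _ => mul_comm _ _

/-- The composition of a smooth function on the sphere and a function on an open set of reals. -/
def compB (φ : ℝ → ℝ) (f : SF) (U : Set ℝ) (hφ : ContDiffOn ℝ ∞ φ U)
    (hf : ∀ x, (f : Scal) x ∈ U) : SF :=
  SF.mk (fun x => φ ((f : Scal) x)) <| by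
    have h : ∀ y ≠ (0 : E3), rext (f : Scal) y ∈ U := fun y hy => by
      rw [rext_apply _ hy (normalize_mem hy)]; exact hf _
    refine (hφ.comp (SF.contDiffOn f) fun y hy => h y hy).congr fun y hy => ?_
    have hy' : y ≠ 0 := hy
    simp [rext, hy']

lemma pdD_compB (φ φ' : ℝ → ℝ) (f : SF) (U : Set ℝ) (hφ : ContDiffOn ℝ ∞ φ U)
    (hf : ∀ x, (f : Scal) x ∈ U) (h : ∀ t ∈ U, HasDerivAt φ (φ' t) t) (i : Fin 3) (x : Sph) :
    (pdD i (compB φ f U hφ hf) : Scal) x = φ' ((f : Scal) x) * (pdD i f : Scal) x := by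
  have h1 : HasFDerivAt (φ ∘ rext (f : Scal)) _ x.1 :=
    (h _ (by rw [rext_val]; exact hf x)).comp_hasFDerivAt x.1
      (SF.differentiableAt f (val_ne_zero x)).hasFDerivAt
  have h2 : rext (compB φ f U hφ hf : Scal) =ᶠ[nhds x.1] φ ∘ rext (f : Scal) := by
    filter_upwards [isOpen_compl_zero.mem_nhds (val_ne_zero x)] with y hy
    have hy' : y ≠ 0 := hy
    simp only [rext, hy', compB, Function.comp, dif_neg, not_false_eq_true]
    rfl
  change fderiv ℝ (rext (compB φ f U hφ hf : Scal)) x.1 _ = _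
  rw [h2.fderiv_eq, h1.fderiv]
  simp [coe_pdD, pd]

lemma lapB_tB (y : Sph) : lapB (tB y) = -(2 * tB y) := by
  simp only [tB, map_sum, map_smul, lapB_cx, Finset.mul_sum, ← Finset.sum_neg_distrib,
    mul_smul_comm, smul_neg]

lemma sum_pdD_tB_sq (y : Sph) : ∑ i, pdD i (tB y) * pdD i (tB y) = 1 - tB y * tB y := by
  have h : ∀ i, pdD i (tB y) = algebraMap ℝ SF (y.1 i) - cx i * tB y := by
    intro i
    simp only [tB, map_sum, Derivation.map_smul, pdD_cx, smul_sub, Finset.sum_sub_distrib,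
      Finset.mul_sum, mul_smul_comm]
    congr 1
    simp [Algebra.algebraMap_eq_smul_one]
  have e1 : ∑ i, algebraMap ℝ SF (y.1 i) * cx i = tB y := by
    simp only [tB, Algebra.smul_def]
  have e2 : ∑ i, algebraMap ℝ SF (y.1 i) * algebraMap ℝ SF (y.1 i) = 1 := by
    simp only [← map_mul, ← map_sum, sum_sq_val, map_one]
  have e3 : ∀ i, pdD i (tB y) * pdD i (tB y) = algebraMap ℝ SF (y.1 i) * algebraMap ℝ SF (y.1 i)
    - 2 * tB y * (algebraMap ℝ SF (y.1 i) * cx i) + tB y * tB y * (cx i * cx i) := by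
    intro i; rw [h]; ring
  simp only [e3, Finset.sum_add_distrib, Finset.sum_sub_distrib, ← Finset.mul_sum, e1, e2,
    sum_cx_sq]
  ring

/-- A smooth function of `x · y`. -/
def zonal (y : Sph) (ε : ℝ) (hε : 0 < ε) (φ : ℝ → ℝ) (hφ : ContDiffOn ℝ ∞ φ (Set.Iio (1 + ε))) :
    SF := compB φ (tB y) (Set.Iio (1 + ε)) hφ fun x => by
      rw [tB_apply]; exact (ip_le_one x y).trans_lt (by linarith)

lemma zonal_apply (y : Sph) (ε : ℝ) (hε : 0 < ε) (φ : ℝ → ℝ)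
    (hφ : ContDiffOn ℝ ∞ φ (Set.Iio (1 + ε))) (x : Sph) :
    (zonal y ε hε φ hφ : Scal) x = φ (ip x y) := by
  rw [← tB_apply]; rfl

/-- With `|∇(x·y)|² = 1 - (x·y)²` and `Δ(x·y) = -2 x·y`, the Laplacian acts on zonal functions as
the Legendre operator. The margin `ε` keeps all values of `x·y` inside an open set on which the
profile is smooth. -/
lemma lapB_zonal (y : Sph) (ε : ℝ) (hε : 0 < ε) (φ φ1 φ2 : ℝ → ℝ)
    (hφ : ContDiffOn ℝ ∞ φ (Set.Iio (1 + ε)))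
    (h1 : ∀ t < 1 + ε, HasDerivAt φ (φ1 t) t) (h2 : ∀ t < 1 + ε, HasDerivAt φ1 (φ2 t) t)
    (x : Sph) : (lapB (zonal y ε hε φ hφ) : Scal) x =
      (1 - ip x y ^ 2) * φ2 (ip x y) - 2 * ip x y * φ1 (ip x y) := by
  have hφ1 : ContDiffOn ℝ ∞ φ1 (Set.Iio (1 + ε)) := by
    have h := ((contDiffOn_infty_iff_deriv_of_isOpen isOpen_Iio).mp hφ).2
    exact h.congr fun t ht => (h1 t ht).deriv.symm
  have e1 : ∀ i, pdD i (zonal y ε hε φ hφ) = zonal y ε hε φ1 hφ1 * pdD i (tB y) := fun i =>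
    SF.ext fun x => by
      rw [zonal, pdD_compB φ φ1 _ _ hφ _ h1]
      rfl
  have e2 : lapB (zonal y ε hε φ hφ) = zonal y ε hε φ1 hφ1 * lapB (tB y) +
      ∑ i, pdD i (tB y) * pdD i (zonal y ε hε φ1 hφ1) := by
    simp only [lapB_apply, e1, leib, Finset.sum_add_distrib, Finset.mul_sum]
  rw [e2, SF.coe_add, Pi.add_apply, SF.coe_sum_apply]
  have e3 : ∀ i, (pdD i (tB y) * pdD i (zonal y ε hε φ1 hφ1) : SF).val x =
      φ2 (ip x y) * (pdD i (tB y) * pdD i (tB y) : SF).val x := by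
    intro i
    rw [SF.coe_mul, Pi.mul_apply, zonal, pdD_compB φ1 φ2 _ _ hφ1 _ h2, tB_apply,
      SF.coe_mul, Pi.mul_apply]
    ring
  rw [Finset.sum_congr rfl fun i _ => e3 i, ← Finset.mul_sum, ← SF.coe_sum_apply, sum_pdD_tB_sq,
    lapB_tB]
  have e4 : (2 * tB y : SF).val x = 2 * ip x y := by
    rw [two_mul, SF.coe_add, Pi.add_apply, tB_apply]; ring
  simp only [SF.coe_mul, Pi.mul_apply, SF.coe_neg, Pi.neg_apply, SF.coe_sub, Pi.sub_apply,
    SF.coe_one, Pi.one_apply, tB_apply, zonal_apply] at e4 ⊢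
  rw [e4]
  ring

lemma s_pos {ε : ℝ} (hε : 0 < ε) (x y : Sph) : 0 < 1 + ε - ip x y := by
  linarith [ip_le_one x y]

lemma intB_lapB_zonal (y : Sph) (ε : ℝ) (hε : 0 < ε) (φ φ1 φ2 : ℝ → ℝ)
    (hφ : ContDiffOn ℝ ∞ φ (Set.Iio (1 + ε)))
    (h1 : ∀ t < 1 + ε, HasDerivAt φ (φ1 t) t) (h2 : ∀ t < 1 + ε, HasDerivAt φ1 (φ2 t) t) (F : SF) :
    ∫ x, φ (ip x y) * (lapB F : Scal) x ∂area =
      ∫ x, ((1 - ip x y ^ 2) * φ2 (ip x y) - 2 * ip x y * φ1 (ip x y)) * (F : Scal) x ∂area := by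
  have h := intB_mul_lapB (zonal y ε hε φ hφ) F
  rw [intB_apply, intB_apply] at h
  simp only [SF.coe_mul, Pi.mul_apply, zonal_apply, lapB_zonal y ε hε φ φ1 φ2 hφ h1 h2] at h
  rw [h]
  exact integral_congr_ae (Filter.Eventually.of_forall fun x => mul_comm _ _)

/-- A uniform bound for the integral of `(1 + ε - x · y)^(-1/2)`. -/
lemma integral_inv_sqrt_le (y : Sph) {ε : ℝ} (hε : 0 < ε) (hε1 : ε ≤ 1) :
    ∫ x, (√(1 + ε - ip x y))⁻¹ ∂area ≤ 12 * Real.pi := by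
  have hd : ∀ t < 1 + ε, HasDerivAt (fun t => 1 + ε - t) (-1) t := fun t _ => by
    simpa using (hasDerivAt_id t).const_sub (1 + ε)
  have h1 : ∀ t < 1 + ε, HasDerivAt (fun t => √(1 + ε - t)) (-(1 / 2) * (√(1 + ε - t))⁻¹) t := by
    intro t ht
    have hp : (1 + ε - t) ≠ 0 := by linarith
    convert (hd t ht).sqrt hp using 1
    rw [div_eq_mul_inv (-1 : ℝ), mul_inv]
    ring
  have h2 : ∀ t < 1 + ε, HasDerivAt (fun t => -(1 / 2) * (√(1 + ε - t))⁻¹)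
      (-(1 / 4) * ((√(1 + ε - t))⁻¹ ^ 3)) t := by
    intro t ht
    have hp : √(1 + ε - t) ≠ 0 := (Real.sqrt_pos.mpr (by linarith)).ne'
    have h := ((h1 t ht).fun_inv hp).const_mul (-(1 / 2))
    have e : -(1 / 2) * (-(-(1 / 2) * (√(1 + ε - t))⁻¹) / √(1 + ε - t) ^ 2) =
        -(1 / 4) * ((√(1 + ε - t))⁻¹ ^ 3) := by
      simp only [div_eq_mul_inv, inv_pow]
      ring
    rwa [e] at h
  have hsm : ContDiffOn ℝ ∞ (fun t => √(1 + ε - t)) (Set.Iio (1 + ε)) := by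
    intro t ht
    have ht' : t < 1 + ε := ht
    exact ((contDiff_const.sub contDiff_id).contDiffAt.sqrt
      (by simp; linarith)).contDiffWithinAt
  -- The Laplacian of `√(1 + ε - x·y)` has zero integral but is pointwise at least `½ (1 + ε -
  -- x·y)^(-1/2) - 3/2`. This gives a bound uniform in `ε`.
  have key := intB_lapB (zonal y ε hε _ hsm)
  rw [intB_apply] at key
  simp only [lapB_zonal y ε hε _ _ _ hsm h1 h2] at key
  have hc : Continuous fun x => √(1 + ε - ip x y) :=
    (continuous_const.sub (continuous_ip_left y)).sqrt
  have hne : ∀ x, √(1 + ε - ip x y) ≠ 0 := fun x => (Real.sqrt_pos.mpr (s_pos hε x y)).ne'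
  have hci : Continuous fun x => (√(1 + ε - ip x y))⁻¹ := hc.inv₀ hne
  have hct := continuous_ip_left y
  -- pointwise inequality
  have hpt : ∀ x, (1 / 2) * (√(1 + ε - ip x y))⁻¹ - 3 / 4 * 2 ≤
      (1 - ip x y ^ 2) * (-(1 / 4) * (√(1 + ε - ip x y))⁻¹ ^ 3) -
        2 * ip x y * (-(1 / 2) * (√(1 + ε - ip x y))⁻¹) := by
    intro x
    set q := √(1 + ε - ip x y) with hq
    have hq0 : 0 < q := Real.sqrt_pos.mpr (s_pos hε x y)
    have hq2 : q ^ 2 = 1 + ε - ip x y := Real.sq_sqrt (s_pos hε x y).le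
    have hqle : q ≤ 2 := by
      rw [hq]; refine Real.sqrt_le_iff.mpr ⟨by norm_num, ?_⟩
      linarith [neg_one_le_ip x y]
    set t := ip x y
    have ht1 : t ≤ 1 := ip_le_one x y
    have ht2 : -1 ≤ t := neg_one_le_ip x y
    have e1 : (1 - t ^ 2) * (-(1 / 4) * q⁻¹ ^ 3) - 2 * t * (-(1 / 2) * q⁻¹) -
        ((1 / 2) * q⁻¹ - 3 / 4 * 2) =
        (-(1 / 4) * (1 - t ^ 2) + (t - 1 / 2) * q ^ 2 + 3 / 2 * q ^ 3) / q ^ 3 := by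
      field_simp
      ring
    have e2 : 0 ≤ -(1 / 4) * (1 - t ^ 2) + (t - 1 / 2) * q ^ 2 + 3 / 2 * q ^ 3 := by
      have a1 : (1 - t) * (1 + t) ≤ q ^ 2 * (1 + t) :=
        mul_le_mul_of_nonneg_right (by linarith) (by linarith)
      have a2 : 0 ≤ q ^ 2 * (3 / 4 * (t - 1) + 3 / 2 * q) :=
        mul_nonneg (sq_nonneg q) (by nlinarith)
      nlinarith
    have := div_nonneg e2 (pow_pos hq0 3).le
    linarith
  have hI := integral_mono (μ := area) (integrable_of_continuous ((continuous_const.mul hci).sub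
    continuous_const)) (integrable_of_continuous (by fun_prop)) hpt
  have hs : ∫ x, ((1 / 2) * (√(1 + ε - ip x y))⁻¹ - 3 / 4 * 2) ∂area =
      1 / 2 * ∫ x, (√(1 + ε - ip x y))⁻¹ ∂area - ∫ _x : Sph, (3 / 4 * 2 : ℝ) ∂area := by
    rw [integral_sub (integrable_of_continuous (by fun_prop))
      (integrable_of_continuous continuous_const), integral_const_mul]
  have hI' := hs.symm.trans_le (hI.trans_eq key)
  have h4 : ∫ _x : Sph, (3 / 4 * 2 : ℝ) ∂area = 3 / 4 * 2 * (4 * Real.pi) := by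
    rw [← intB_one, intB_apply, ← integral_const_mul]
    simp
  rw [h4] at hI'
  linarith

/-! ## Singular zonal kernels -/

/-- The weakly singular kernel `(1 - x · y)^(-1/2)`, set to zero on the diagonal. -/
def kD (y x : Sph) : ℝ := (√(1 - ip x y))⁻¹

lemma kD_nonneg (y x : Sph) : 0 ≤ kD y x := inv_nonneg.mpr (Real.sqrt_nonneg _)

lemma ip_lt_one {x y : Sph} (h : x ≠ y) : ip x y < 1 :=
  lt_of_le_of_ne (ip_le_one x y) fun h' => h (eq_of_ip_eq_one h')

lemma measurable_kD : Measurable fun p : Sph × Sph => kD p.2 p.1 :=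
  ((measurable_const.sub continuous_ip.measurable).sqrt).inv

lemma measurable_kD_left (y : Sph) : Measurable fun x : Sph => kD y x :=
  ((measurable_const.sub (continuous_ip_left y).measurable).sqrt).inv

/-- A sequence of positive numbers tending to zero. -/
def eps (n : ℕ) : ℝ := 1 / ((n : ℝ) + 1)

lemma eps_pos (n : ℕ) : 0 < eps n := Nat.one_div_pos_of_nat

lemma eps_le_one (n : ℕ) : eps n ≤ 1 := by
  rw [eps, div_le_one (by positivity)]
  simp

lemma tendsto_eps : Filter.Tendsto eps Filter.atTop (nhds 0) :=
  tendsto_one_div_add_atTop_nhds_zero_nat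

lemma continuous_inv_sqrt_ip (y : Sph) {ε : ℝ} (hε : 0 < ε) :
    Continuous fun x => (√(1 + ε - ip x y))⁻¹ :=
  ((continuous_const.sub (continuous_ip_left y)).sqrt).inv₀
    fun x => (Real.sqrt_pos.mpr (s_pos hε x y)).ne'

/-- Fatou's lemma for `ε → 0`. On the diagonal the convention `0⁻¹ = 0` makes the inequality
trivial. -/
lemma lintegral_kD_le (y : Sph) :
    ∫⁻ x, ENNReal.ofReal (kD y x) ∂area ≤ ENNReal.ofReal (12 * Real.pi) := by
  have h1 : ∀ x, ENNReal.ofReal (kD y x) ≤ Filter.liminf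
      (fun n => ENNReal.ofReal ((√(1 + eps n - ip x y))⁻¹)) Filter.atTop := by
    intro x
    rcases eq_or_ne x y with h | h
    · simp [kD, h, ip_self]
    · have ht := ip_lt_one h
      have hl : Filter.Tendsto (fun n => ENNReal.ofReal ((√(1 + eps n - ip x y))⁻¹))
          Filter.atTop (nhds (ENNReal.ofReal (kD y x))) := by
        refine ENNReal.tendsto_ofReal (Filter.Tendsto.inv₀ (Filter.Tendsto.sqrt ?_)
          (Real.sqrt_pos.mpr (by linarith)).ne')
        simpa using (tendsto_eps.const_add 1).sub_const (ip x y)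
      exact hl.liminf_eq.ge
  refine (lintegral_mono h1).trans ((lintegral_liminf_le fun n => ?_).trans ?_)
  · exact ((continuous_inv_sqrt_ip y (eps_pos n)).measurable).ennreal_ofReal
  · refine Filter.liminf_le_of_frequently_le' (Filter.Eventually.frequently
      (Filter.Eventually.of_forall fun n => ?_))
    rw [← ofReal_integral_eq_lintegral_ofReal
      (integrable_of_continuous (continuous_inv_sqrt_ip y (eps_pos n)))
      (Filter.Eventually.of_forall fun x => inv_nonneg.mpr (Real.sqrt_nonneg _))]
    exact ENNReal.ofReal_le_ofReal (integral_inv_sqrt_le y (eps_pos n) (eps_le_one n))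

lemma integrable_kD (y : Sph) : Integrable (kD y) area :=
  ⟨(measurable_kD_left y).aestronglyMeasurable,
    (hasFiniteIntegral_iff_ofReal (Filter.Eventually.of_forall (kD_nonneg y))).mpr
      ((lintegral_kD_le y).trans_lt ENNReal.ofReal_lt_top)⟩

lemma integral_kD_le (y : Sph) : ∫ x, kD y x ∂area ≤ 12 * Real.pi := by
  rw [integral_eq_lintegral_of_nonneg_ae (Filter.Eventually.of_forall (kD_nonneg y))
    (measurable_kD_left y).aestronglyMeasurable]
  exact ENNReal.toReal_le_of_le_ofReal (by positivity) (lintegral_kD_le y)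

/-- An atom at `y` would make the uniformly bounded integrals of `(1 + ε - x·y)^(-1/2)` grow like
`ε^(-1/2)`. -/
lemma area_singleton (y : Sph) : area {y} = 0 := by
  have h : ∀ n : ℕ, area.real {y} * √((n : ℝ) + 1) ≤ 12 * Real.pi := by
    intro n
    have h1 := setIntegral_le_integral (s := {y})
      (integrable_of_continuous (continuous_inv_sqrt_ip y (eps_pos n)))
      (Filter.Eventually.of_forall fun x => inv_nonneg.mpr (Real.sqrt_nonneg _))
    rw [integral_singleton, ip_self, smul_eq_mul] at h1
    have h2 : (√(1 + eps n - 1))⁻¹ = √((n : ℝ) + 1) := by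
      rw [← Real.sqrt_inv]
      congr 1
      simp [eps]
    rw [h2] at h1
    exact h1.trans (integral_inv_sqrt_le y (eps_pos n) (eps_le_one n))
  by_contra hne
  have hpos : 0 < area.real {y} := (ENNReal.toReal_pos hne (measure_ne_top _ _))
  obtain ⟨n, hn⟩ := exists_nat_gt ((12 * Real.pi / area.real {y}) ^ 2)
  have h3 : 12 * Real.pi / area.real {y} < √((n : ℝ) + 1) :=
    Real.lt_sqrt_of_sq_lt (by linarith)
  have h4 := h n
  rw [div_lt_iff₀ hpos] at h3
  linarith

lemma ae_ne (y : Sph) : ∀ᵐ x ∂area, x ≠ y := by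
  rw [ae_iff]
  simpa using area_singleton y

/-- Dominated convergence in the form used for all limits `ε → 0` below; the pole `y` is a null set.
-/
lemma tendsto_integral_of_kD_bound (y : Sph) (g : ℕ → Scal) (g0 : Scal) (C : ℝ)
    (hc : ∀ n, Continuous (g n)) (hb : ∀ n x, x ≠ y → |g n x| ≤ C * (1 + kD y x))
    (hl : ∀ x, x ≠ y → Filter.Tendsto (fun n => g n x) Filter.atTop (nhds (g0 x))) :
    Filter.Tendsto (fun n => ∫ x, g n x ∂area) Filter.atTop (nhds (∫ x, g0 x ∂area)) := by
  refine tendsto_integral_of_dominated_convergence (fun x => C * (1 + kD y x))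
    (fun n => (hc n).aestronglyMeasurable) (((integrable_const 1).add (integrable_kD y)).const_mul C)
    (fun n => ?_) ?_
  · filter_upwards [ae_ne y] with x hx using hb n x hx
  · filter_upwards [ae_ne y] with x hx using hl x hx

lemma dist_sq_eq (x y : Sph) : ‖x.1 - y.1‖ ^ 2 = 2 * (1 - ip x y) := by
  rw [norm_sub_sq_real, norm_val, norm_val, ip_eq_inner]
  ring

/-- `√(1 - x·y)` is the chordal distance up to the factor `√2`: the smooth radial extension is
Lipschitz near `y`, and boundedness suffices elsewhere. -/
lemma exists_sqrt_bound (F : SF) (y : Sph) : ∃ K : ℝ, 0 ≤ K ∧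
    ∀ x, |(F : Scal) x - (F : Scal) y| ≤ K * √(1 - ip x y) := by
  obtain ⟨M, hM⟩ := (isCompact_univ (X := Sph)).exists_bound_of_continuousOn
    (SF.continuous F).continuousOn
  obtain ⟨K, t, ht, hK⟩ := ((SF.contDiffAt F (val_ne_zero y)).of_le
    (m := 1) (by exact_mod_cast le_top)).exists_lipschitzOnWith
  obtain ⟨δ, hδ, hδt⟩ := Metric.mem_nhds_iff.mp ht
  have hM0 : 0 ≤ M := (norm_nonneg _).trans (hM y trivial)
  have hd : ∀ x : Sph, ‖x.1 - y.1‖ = √2 * √(1 - ip x y) := fun x => by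
    rw [← Real.sqrt_mul (by norm_num), ← dist_sq_eq, Real.sqrt_sq (norm_nonneg _)]
  refine ⟨(K + 2 * M / δ) * √2, by positivity, fun x => ?_⟩
  rw [mul_assoc, ← hd, add_mul]
  by_cases hx : ‖x.1 - y.1‖ < δ
  · have h := hK.dist_le_mul x.1 (hδt (by rwa [Metric.mem_ball, dist_eq_norm])) y.1
      (mem_of_mem_nhds ht)
    rw [rext_val, rext_val, Real.dist_eq, dist_eq_norm] at h
    have : 0 ≤ 2 * M / δ * ‖x.1 - y.1‖ := by positivity
    linarith
  · have h1 := hM x trivial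
    have h2 := hM y trivial
    rw [Real.norm_eq_abs] at h1 h2
    have h3 : 2 * M ≤ 2 * M / δ * ‖x.1 - y.1‖ := by
      rw [div_mul_eq_mul_div, le_div_iff₀ hδ]
      exact mul_le_mul_of_nonneg_left (not_lt.mp hx) (by positivity)
    have h4 : 0 ≤ (K : ℝ) * ‖x.1 - y.1‖ := by positivity
    linarith [abs_sub (F.val x) (F.val y)]

lemma inv_sqrt_le_kD {x y : Sph} (h : x ≠ y) {ε : ℝ} (hε : 0 < ε) :
    (√(1 + ε - ip x y))⁻¹ ≤ kD y x :=
  inv_anti₀ (Real.sqrt_pos.mpr (by linarith [ip_lt_one h])) (Real.sqrt_le_sqrt (by linarith))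

/-- An approximate identity. -/
def kE (ε : ℝ) (y x : Sph) : ℝ := 1 / 2 * ε * (2 + ε) / (1 + ε - ip x y) ^ 2

lemma continuous_kE (y : Sph) {ε : ℝ} (hε : 0 < ε) : Continuous (kE ε y) :=
  continuous_const.div ((continuous_const.sub (continuous_ip_left y)).pow 2)
    fun x => (pow_pos (s_pos hε x y) 2).ne'

lemma abs_log_le {s : ℝ} (h0 : 0 < s) (h3 : s ≤ 3) : |Real.log s| ≤ 6 * (√s)⁻¹ := by
  have hq : 0 < √s := Real.sqrt_pos.mpr h0
  have hs : √s ^ 2 = s := Real.sq_sqrt h0.le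
  have e : Real.log s = 2 * Real.log √s := by rw [Real.log_sqrt h0.le]; ring
  have hi : 0 < (√s)⁻¹ := inv_pos.mpr hq
  have h1 : Real.log √s ≤ 3 * (√s)⁻¹ := by
    have h := Real.log_le_sub_one_of_pos hq
    have h2 : √s ≤ 3 * (√s)⁻¹ := by
      rw [← div_eq_mul_inv, le_div_iff₀ hq]
      nlinarith
    linarith
  have h2 : -Real.log √s ≤ 3 * (√s)⁻¹ := by
    have h := Real.log_le_sub_one_of_pos hi
    rw [Real.log_inv] at h
    linarith
  rw [e, abs_mul, abs_two]
  have := abs_le.mpr ⟨by linarith, h1⟩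
  linarith

lemma abs_log_ip_le (x y : Sph) : |Real.log (1 - ip x y)| ≤ 6 * kD y x := by
  rcases eq_or_ne x y with h | h
  · simp [kD, h, ip_self]
  · exact abs_log_le (by linarith [ip_lt_one h]) (by linarith [neg_one_le_ip x y])

lemma abs_log_eps_le {x y : Sph} (h : x ≠ y) {ε : ℝ} (hε : 0 < ε) (hε1 : ε ≤ 1) :
    |Real.log (1 + ε - ip x y)| ≤ 6 * kD y x :=
  (abs_log_le (s_pos hε x y) (by linarith [neg_one_le_ip x y])).trans
    (mul_le_mul_of_nonneg_left (inv_sqrt_le_kD h hε) (by norm_num))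

lemma contDiffOn_log_sub (ε : ℝ) :
    ContDiffOn ℝ ∞ (fun t : ℝ => Real.log (1 + ε - t)) (Set.Iio (1 + ε)) := by
  intro t ht
  have ht' : t < 1 + ε := ht
  exact ((contDiff_const.sub contDiff_id).contDiffAt.log (by simp; linarith)).contDiffWithinAt

lemma hasDerivAt_log_sub {ε t : ℝ} (ht : t < 1 + ε) :
    HasDerivAt (fun t : ℝ => Real.log (1 + ε - t)) (-(1 + ε - t)⁻¹) t := by
  have h := ((hasDerivAt_id t).const_sub (1 + ε)).log (by simp; linarith)
  simpa [neg_div] using h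

lemma hasDerivAt_inv_sub {ε t : ℝ} (ht : t < 1 + ε) :
    HasDerivAt (fun t : ℝ => (1 + ε - t)⁻¹) ((1 + ε - t)⁻¹ ^ 2) t := by
  have h := ((hasDerivAt_id t).const_sub (1 + ε)).fun_inv (by simp; linarith)
  simpa [neg_div] using h

/-- Green's identity for the regularised logarithmic kernel. -/
lemma green_log_eps (y : Sph) {ε : ℝ} (hε : 0 < ε) (F : SF) :
    ∫ x, 1 / 2 * Real.log (1 + ε - ip x y) * (lapB F : Scal) x ∂area =
      ∫ x, (-(1 / 2) + kE ε y x) * (F : Scal) x ∂area := by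
  rw [intB_lapB_zonal y ε hε (fun t => 1 / 2 * Real.log (1 + ε - t))
    (fun t => 1 / 2 * -(1 + ε - t)⁻¹) (fun t => 1 / 2 * -(1 + ε - t)⁻¹ ^ 2)
    (contDiffOn_const.mul (contDiffOn_log_sub ε))
    (fun t ht => (hasDerivAt_log_sub ht).const_mul _)
    (fun t ht => (hasDerivAt_inv_sub ht).fun_neg.const_mul _)]
  refine integral_congr_ae (Filter.Eventually.of_forall fun x => ?_)
  have hs := (s_pos hε x y).ne'
  simp only [kE]
  congr 1
  field_simp
  ring

/-- Green's identity for the regularised kernel of `Δ + 2`. -/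
lemma green_mul_log_eps (y : Sph) {ε : ℝ} (hε : 0 < ε) (F : SF) :
    ∫ x, 1 / 2 * (ip x y * Real.log (1 + ε - ip x y) + 1) * (lapB F + 2 * F : SF).val x ∂area =
      ∫ x, (ip x y * (-(1 / 2) + kE ε y x) - (1 - ip x y ^ 2) * (1 + ε - ip x y)⁻¹ + 1) *
        (F : Scal) x ∂area := by
  have hsm : ContDiffOn ℝ ∞ (fun t => 1 / 2 * (t * Real.log (1 + ε - t) + 1)) (Set.Iio (1 + ε)) :=
    contDiffOn_const.mul ((contDiffOn_id.mul (contDiffOn_log_sub ε)).add contDiffOn_const)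
  have h := intB_lapB_zonal y ε hε (fun t => 1 / 2 * (t * Real.log (1 + ε - t) + 1))
    (fun t => 1 / 2 * (1 * Real.log (1 + ε - t) + t * -(1 + ε - t)⁻¹))
    (fun t => 1 / 2 * (-(1 + ε - t)⁻¹ + (1 * -(1 + ε - t)⁻¹ + t * -(1 + ε - t)⁻¹ ^ 2))) hsm
    (fun t ht => (((hasDerivAt_id' t).fun_mul (hasDerivAt_log_sub ht)).add_const 1).const_mul _)
    (fun t ht => (((hasDerivAt_log_sub ht).const_mul 1 |>.congr_deriv (one_mul _)).fun_add
      ((hasDerivAt_id' t).fun_mul (hasDerivAt_inv_sub ht).fun_neg)).const_mul _) F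
  have hc : Continuous fun x => Real.log (1 + ε - ip x y) :=
    (continuous_const.sub (continuous_ip_left y)).log fun x => (s_pos hε x y).ne'
  have hci : Continuous fun x => (1 + ε - ip x y)⁻¹ :=
    (continuous_const.sub (continuous_ip_left y)).inv₀ fun x => (s_pos hε x y).ne'
  have ht := continuous_ip_left y
  have hF := SF.continuous F
  have hlF := SF.continuous (lapB F)
  have e1 : ∀ x, 1 / 2 * (ip x y * Real.log (1 + ε - ip x y) + 1) * (lapB F + 2 * F : SF).val x =
      1 / 2 * (ip x y * Real.log (1 + ε - ip x y) + 1) * (lapB F).val x +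
      (ip x y * Real.log (1 + ε - ip x y) + 1) * F.val x := fun x => by
    rw [two_mul]
    simp only [SF.coe_add, Pi.add_apply]
    ring
  simp only [e1]
  rw [integral_add (integrable_of_continuous (by fun_prop))
    (integrable_of_continuous (by fun_prop)), h, ← integral_add
    (integrable_of_continuous (by fun_prop)) (integrable_of_continuous (by fun_prop))]
  refine integral_congr_ae (Filter.Eventually.of_forall fun x => ?_)
  have hs := (s_pos hε x y).ne'
  simp only [kE]
  field_simp
  ring

/-- The regularised Green identity applied to the constant function `1`. -/
lemma integral_kE (y : Sph) {ε : ℝ} (hε : 0 < ε) : ∫ x, kE ε y x ∂area = 2 * Real.pi := by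
  have h := green_log_eps y hε 1
  have h1 : lapB (1 : SF) = 0 := by simp [lapB_apply]
  have hi : ∫ _x : Sph, (-(1 / 2) : ℝ) ∂area = -(1 / 2) * (4 * Real.pi) := by
    rw [← intB_one, intB_apply, ← integral_const_mul]
    simp
  simp only [h1, SF.coe_zero, Pi.zero_apply, mul_zero, integral_zero, SF.coe_one, Pi.one_apply,
    mul_one] at h
  rw [integral_add (integrable_const _) (integrable_of_continuous (continuous_kE y hε)), hi] at h
  linarith

/-- After subtraction of `F(y)`, the gain `√(1 - x·y)` against `kE ≤ (3/2)(1 + ε - x·y)⁻¹` leaves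
the integrable majorant `kD`. Away from `y` the kernel tends to zero pointwise. -/
lemma tendsto_integral_kE (y : Sph) (F : SF) :
    Filter.Tendsto (fun n => ∫ x, kE (eps n) y x * (F : Scal) x ∂area) Filter.atTop
      (nhds (2 * Real.pi * (F : Scal) y)) := by
  obtain ⟨K, hK0, hK⟩ := exists_sqrt_bound F y
  have h1 : Filter.Tendsto (fun n => ∫ x, kE (eps n) y x * ((F : Scal) x - (F : Scal) y) ∂area)
      Filter.atTop (nhds (∫ _x : Sph, (0 : ℝ) ∂area)) := by
    refine tendsto_integral_of_kD_bound y _ _ (3 / 2 * K) (fun n =>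
      (continuous_kE y (eps_pos n)).mul ((SF.continuous F).sub continuous_const)) ?_ ?_
    · intro n x hx
      have hε := eps_pos n
      have hε1 := eps_le_one n
      set ε := eps n
      have hs := s_pos hε x y
      have ht := ip_lt_one hx
      have hq : 0 < √(1 + ε - ip x y) := Real.sqrt_pos.mpr hs
      have hq2 : √(1 + ε - ip x y) ^ 2 = 1 + ε - ip x y := Real.sq_sqrt hs.le
      have hle : √(1 - ip x y) ≤ √(1 + ε - ip x y) := Real.sqrt_le_sqrt (by linarith)
      have hkE : kE ε y x ≤ 3 / 2 / (1 + ε - ip x y) := by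
        rw [kE, div_le_div_iff₀ (by positivity) hs, pow_two, ← mul_assoc]
        refine mul_le_mul_of_nonneg_right ?_ hs.le
        nlinarith
      have hkE0 : 0 ≤ kE ε y x := by unfold kE; positivity
      rw [abs_mul, abs_of_nonneg hkE0]
      calc kE ε y x * |(F : Scal) x - (F : Scal) y|
          ≤ 3 / 2 / (1 + ε - ip x y) * (K * √(1 + ε - ip x y)) :=
            mul_le_mul hkE ((hK x).trans (mul_le_mul_of_nonneg_left hle hK0)) (abs_nonneg _)
              (by positivity)
        _ = 3 / 2 * K * (√(1 + ε - ip x y))⁻¹ := by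
            rw [← hq2, Real.sqrt_sq hq.le]
            field_simp
        _ ≤ 3 / 2 * K * (1 + kD y x) := by
            refine mul_le_mul_of_nonneg_left ?_ (by positivity)
            linarith [inv_sqrt_le_kD hx hε]
    · intro x hx
      have ht := ip_lt_one hx
      have hk : Filter.Tendsto (fun n => kE (eps n) y x) Filter.atTop
          (nhds (1 / 2 * 0 * (2 + 0) / (1 + 0 - ip x y) ^ 2)) :=
        ((tendsto_eps.const_mul _).mul (tendsto_eps.const_add 2)).div
          (((tendsto_eps.const_add 1).sub_const _).pow 2) (pow_ne_zero 2 (by linarith))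
      simpa using hk.mul_const ((F : Scal) x - (F : Scal) y)
  have h2 : ∀ n, ∫ x, kE (eps n) y x * (F : Scal) x ∂area =
      ∫ x, kE (eps n) y x * ((F : Scal) x - (F : Scal) y) ∂area + 2 * Real.pi * (F : Scal) y := by
    intro n
    have hc := continuous_kE y (eps_pos n)
    have hF := SF.continuous F
    rw [← integral_kE y (eps_pos n), ← integral_mul_const, ← integral_add
      (integrable_of_continuous (by fun_prop)) (integrable_of_continuous (by fun_prop))]
    exact integral_congr_ae (Filter.Eventually.of_forall fun x => by ring)
  simp only [h2]
  simpa using h1.add_const (2 * Real.pi * (F : Scal) y)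

lemma tendsto_log_eps {x y : Sph} (h : x ≠ y) :
    Filter.Tendsto (fun n => Real.log (1 + eps n - ip x y)) Filter.atTop
      (nhds (Real.log (1 - ip x y))) := by
  refine Filter.Tendsto.log ?_ (by linarith [ip_lt_one h])
  simpa using (tendsto_eps.const_add 1).sub_const (ip x y)

lemma continuous_log_eps (y : Sph) (n : ℕ) : Continuous fun x => Real.log (1 + eps n - ip x y) :=
  (continuous_const.sub (continuous_ip_left y)).log fun x => (s_pos (eps_pos n) x y).ne'

/-- The kernels of the Green operators of `Δ` and of `Δ + 2` (times `2π`). -/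
def gG (t : ℝ) : ℝ := 1 / 2 * Real.log (1 - t)
def gH (t : ℝ) : ℝ := 1 / 2 * (t * Real.log (1 - t) + 1)

lemma exists_abs_le (F : SF) : ∃ M : ℝ, 0 ≤ M ∧ ∀ x, |(F : Scal) x| ≤ M := by
  obtain ⟨M, hM⟩ := (isCompact_univ (X := Sph)).exists_bound_of_continuousOn
    (SF.continuous F).continuousOn
  exact ⟨M, (norm_nonneg _).trans (hM ⟨EuclideanSpace.single 0 1, by simp⟩ trivial), fun x => hM x trivial⟩

/-- In distributional terms, `Δ` of the kernel is `2π δ_y - 1/2`; the constant accounts for the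
cokernel of `Δ`. -/
lemma green_gG (y : Sph) (F : SF) : ∫ x, gG (ip x y) * (lapB F : Scal) x ∂area =
    2 * Real.pi * (F : Scal) y - 1 / 2 * intB F := by
  obtain ⟨M, hM0, hM⟩ := exists_abs_le (lapB F)
  have h1 : Filter.Tendsto
      (fun n => ∫ x, 1 / 2 * Real.log (1 + eps n - ip x y) * (lapB F : Scal) x ∂area)
      Filter.atTop (nhds (∫ x, gG (ip x y) * (lapB F : Scal) x ∂area)) := by
    refine tendsto_integral_of_kD_bound y _ _ (3 * M) (fun n =>
      ((continuous_log_eps y n).const_mul _).mul (SF.continuous _)) ?_ ?_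
    · intro n x hx
      rw [abs_mul, abs_mul, mul_comm (3 * M)]
      have h := abs_log_eps_le hx (eps_pos n) (eps_le_one n)
      have hk := kD_nonneg y x
      have h2 : |(1 / 2 : ℝ)| = 1 / 2 := abs_of_pos (by norm_num)
      have h3 := mul_le_mul h (hM x) (abs_nonneg _) (by positivity)
      rw [h2]
      nlinarith
    · intro x hx
      exact ((tendsto_log_eps hx).const_mul _).mul_const _
  have h2 : ∀ n, ∫ x, 1 / 2 * Real.log (1 + eps n - ip x y) * (lapB F : Scal) x ∂area =
      -(1 / 2) * intB F + ∫ x, kE (eps n) y x * (F : Scal) x ∂area := by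
    intro n
    have hc := continuous_kE y (eps_pos n)
    have hF := SF.continuous F
    rw [green_log_eps y (eps_pos n), intB_apply, ← integral_const_mul, ← integral_add
      (integrable_of_continuous (by fun_prop)) (integrable_of_continuous (by fun_prop))]
    exact integral_congr_ae (Filter.Eventually.of_forall fun x => by ring)
  simp only [h2] at h1
  have h3 := tendsto_nhds_unique h1 ((tendsto_integral_kE y F).const_add (-(1 / 2) * intB F))
  rw [h3]
  ring

/-- In distributional terms, `Δ + 2` of the kernel is `2π δ_y - (3/2) x·y`, and the last term
projects to `l = 1`. The summand `1` in `gH` cancels the constant that `t log(1 - t)` alone would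
leave. -/
lemma green_gH (y : Sph) (F : SF) :
    ∫ x, gH (ip x y) * (lapB F + 2 * F : SF).val x ∂area =
      2 * Real.pi * (F : Scal) y - 3 / 2 * intB (tB y * F) := by
  obtain ⟨M, hM0, hM⟩ := exists_abs_le (lapB F + 2 * F)
  obtain ⟨N, hN0, hN⟩ := exists_abs_le F
  have h1 : Filter.Tendsto (fun n => ∫ x, 1 / 2 * (ip x y * Real.log (1 + eps n - ip x y) + 1) *
      (lapB F + 2 * F : SF).val x ∂area)
      Filter.atTop (nhds (∫ x, gH (ip x y) * (lapB F + 2 * F : SF).val x ∂area)) := by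
    refine tendsto_integral_of_kD_bound y _ _ (4 * M) (fun n => ?_) ?_ ?_
    · have := continuous_log_eps y n
      have := continuous_ip_left y
      have := SF.continuous (lapB F + 2 * F)
      fun_prop
    · intro n x hx
      have h := abs_log_eps_le hx (eps_pos n) (eps_le_one n)
      have hk := kD_nonneg y x
      have ht : |ip x y| ≤ 1 := abs_le.mpr ⟨neg_one_le_ip x y, ip_le_one x y⟩
      have h4 : |ip x y * Real.log (1 + eps n - ip x y) + 1| ≤ 6 * kD y x + 1 := by
        refine (abs_add_le _ _).trans ?_
        rw [abs_mul, abs_one]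
        have := mul_le_mul ht h (abs_nonneg _) zero_le_one
        linarith
      have h2 : |(1 / 2 : ℝ)| = 1 / 2 := abs_of_pos (by norm_num)
      have h3 := mul_le_mul h4 (hM x) (abs_nonneg _) (by positivity)
      rw [abs_mul, abs_mul, h2]
      nlinarith [mul_nonneg hM0 hk]
    · intro x hx
      exact ((((tendsto_log_eps hx).const_mul _).add_const 1).const_mul _).mul_const _
  have h5 : Filter.Tendsto (fun n => ∫ x, (1 - ip x y ^ 2) * (1 + eps n - ip x y)⁻¹ * F.val x ∂area)
      Filter.atTop (nhds (∫ x, (1 + ip x y) * F.val x ∂area)) := by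
    refine tendsto_integral_of_kD_bound y _ _ (2 * N) (fun n => ?_) ?_ ?_
    · have : Continuous fun x => (1 + eps n - ip x y)⁻¹ :=
        (continuous_const.sub (continuous_ip_left y)).inv₀ fun x => (s_pos (eps_pos n) x y).ne'
      have := continuous_ip_left y
      have := SF.continuous F
      fun_prop
    · intro n x hx
      have hs := s_pos (eps_pos n) x y
      have ht1 := ip_lt_one hx
      have ht2 := neg_one_le_ip x y
      have h6 : |(1 - ip x y ^ 2) * (1 + eps n - ip x y)⁻¹| ≤ 2 := by
        rw [abs_of_nonneg (mul_nonneg (by nlinarith) (inv_pos.mpr hs).le), ← div_eq_mul_inv,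
          div_le_iff₀ hs]
        nlinarith [eps_pos n]
      rw [abs_mul]
      have h7 := mul_le_mul h6 (hN x) (abs_nonneg _) (by norm_num)
      nlinarith [mul_nonneg hN0 (kD_nonneg y x)]
    · intro x hx
      have ht1 := ip_lt_one hx
      have hl : Filter.Tendsto (fun n => (1 + eps n - ip x y)⁻¹) Filter.atTop
          (nhds (1 - ip x y)⁻¹) := by
        refine Filter.Tendsto.inv₀ ?_ (by linarith)
        simpa using (tendsto_eps.const_add 1).sub_const (ip x y)
      have := (hl.const_mul (1 - ip x y ^ 2)).mul_const (F.val x)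
      have e : (1 - ip x y ^ 2) * (1 - ip x y)⁻¹ = 1 + ip x y := by
        have : 1 - ip x y ≠ 0 := by linarith
        field_simp
        ring
      rwa [e] at this
  have h2 : ∀ n, ∫ x, 1 / 2 * (ip x y * Real.log (1 + eps n - ip x y) + 1) *
      (lapB F + 2 * F : SF).val x ∂area =
      ((-(1 / 2) * intB (tB y * F) + intB F) + ∫ x, kE (eps n) y x * (tB y * F : SF).val x ∂area)
      - ∫ x, (1 - ip x y ^ 2) * (1 + eps n - ip x y)⁻¹ * F.val x ∂area := by
    intro n
    have hc := continuous_kE y (eps_pos n)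
    have hF := SF.continuous F
    have htF := SF.continuous (tB y * F)
    have hci : Continuous fun x => (1 + eps n - ip x y)⁻¹ :=
      (continuous_const.sub (continuous_ip_left y)).inv₀ fun x => (s_pos (eps_pos n) x y).ne'
    have ht := continuous_ip_left y
    rw [green_mul_log_eps y (eps_pos n), intB_apply, intB_apply, ← integral_const_mul,
      ← integral_add (integrable_of_continuous (by fun_prop))
      (integrable_of_continuous (by fun_prop)), ← integral_add
      (integrable_of_continuous (by fun_prop)) (integrable_of_continuous (by fun_prop)),
      ← integral_sub
      (integrable_of_continuous (by fun_prop)) (integrable_of_continuous (by fun_prop))]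
    refine integral_congr_ae (Filter.Eventually.of_forall fun x => ?_)
    simp only [SF.coe_mul, Pi.mul_apply, tB_apply]
    ring
  simp only [h2] at h1
  have h3 := tendsto_nhds_unique h1 (((tendsto_integral_kE y (tB y * F)).const_add
    (-(1 / 2) * intB (tB y * F) + intB F)).sub h5)
  have h8 : ∫ x, (1 + ip x y) * F.val x ∂area = intB F + intB (tB y * F) := by
    have hF := SF.continuous F
    have htF := SF.continuous (tB y * F)
    rw [intB_apply, intB_apply, ← integral_add (integrable_of_continuous (by fun_prop))
      (integrable_of_continuous (by fun_prop))]
    refine integral_congr_ae (Filter.Eventually.of_forall fun x => ?_)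
    simp only [SF.coe_mul, Pi.mul_apply, tB_apply]
    ring
  rw [h3, h8]
  simp only [SF.coe_mul, Pi.mul_apply, tB_apply, ip_self]
  ring

/-! ## Zonal convolution -/

/-- A kernel with a singularity not worse than `(1 - t)^(-1/2)`. -/
structure ZKer (k : ℝ → ℝ) : Prop where
  meas : Measurable k
  bound : ∃ C : ℝ, 0 ≤ C ∧ ∀ x y : Sph, |k (ip x y)| ≤ C * (1 + kD y x)

lemma zker_gG : ZKer gG where
  meas := by unfold gG; fun_prop
  bound := by
    refine ⟨3, by norm_num, fun x y => ?_⟩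
    have h := abs_log_ip_le x y
    rw [gG, abs_mul, abs_of_pos (by norm_num : (0 : ℝ) < 1 / 2)]
    linarith [kD_nonneg y x]

lemma zker_gH : ZKer gH where
  meas := by unfold gH; fun_prop
  bound := by
    refine ⟨3, by norm_num, fun x y => ?_⟩
    have h := abs_log_ip_le x y
    have ht : |ip x y| ≤ 1 := abs_le.mpr ⟨neg_one_le_ip x y, ip_le_one x y⟩
    have h2 := mul_le_mul ht h (abs_nonneg _) zero_le_one
    have h3 := abs_add_le (ip x y * Real.log (1 - ip x y)) 1
    rw [abs_mul, abs_one] at h3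
    rw [gH, abs_mul, abs_of_pos (by norm_num : (0 : ℝ) < 1 / 2)]
    linarith [kD_nonneg y x]

namespace ZKer
variable {k : ℝ → ℝ} (hk : ZKer k)
include hk

lemma integrable (x : Sph) : Integrable (fun y => k (ip x y)) area := by
  obtain ⟨C, -, hC⟩ := hk.bound
  refine (((integrable_const 1).add (integrable_kD x)).const_mul C).mono'
    ((hk.meas.comp (continuous_ip.comp (by fun_prop : Continuous fun y : Sph => (x, y))).measurable)
      ).aestronglyMeasurable (Filter.Eventually.of_forall fun y => ?_)
  have h := hC x y
  rwa [show kD y x = kD x y from by unfold kD; rw [ip_comm]] at h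

end ZKer

lemma integrable_prod_kD : Integrable (fun p : Sph × Sph => 1 + kD p.2 p.1) (area.prod area) := by
  refine (integrable_const 1).add ?_
  have hm : AEStronglyMeasurable (fun p : Sph × Sph => kD p.2 p.1) (area.prod area) :=
    measurable_kD.aestronglyMeasurable
  refine (integrable_prod_iff' hm).mpr ⟨Filter.Eventually.of_forall fun y => integrable_kD y, ?_⟩
  refine (integrable_const (12 * Real.pi)).mono' hm.norm.prod_swap.integral_prod_right'
    (Filter.Eventually.of_forall fun y => ?_)
  simp only [Real.norm_eq_abs, abs_of_nonneg (kD_nonneg _ _)]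
  rw [abs_of_nonneg (integral_nonneg fun x => kD_nonneg y x)]
  exact integral_kD_le y

/-! ### Smoothness of convolutions with singular zonal kernels -/

/-- A globally smooth, compactly supported extension of a smooth function on the sphere. -/
lemma exists_extension (F : SF) : ∃ E : E3 → ℝ, ContDiff ℝ ∞ E ∧ (∀ z, 2 < ‖z‖ → E z = 0) ∧
    ∀ x : Sph, E x.1 = (F : Scal) x := by
  let χ : ContDiffBump (1 : ℝ) := ⟨1 / 4, 1 / 2, by norm_num, by norm_num⟩
  have h0 : ∀ z : E3, 1 / 2 ≤ |‖z‖ ^ 2 - 1| → χ (‖z‖ ^ 2) = 0 := fun z hz =>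
    χ.zero_of_le_dist (by rw [Real.dist_eq]; exact hz)
  have hχ : ContDiff ℝ ∞ fun z : E3 => χ (‖z‖ ^ 2) := χ.contDiff.comp (contDiff_norm_sq ℝ)
  refine ⟨fun z => χ (‖z‖ ^ 2) * rext F z, contDiff_iff_contDiffAt.mpr fun z => ?_,
    fun z hz => ?_, fun x => ?_⟩
  · by_cases hz : z = 0
    · have : (fun z : E3 => χ (‖z‖ ^ 2) * rext F z) =ᶠ[nhds z] fun _ => 0 := by
        have hU : {z : E3 | ‖z‖ ^ 2 < 1 / 2} ∈ nhds z :=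
          (isOpen_lt (by fun_prop) continuous_const).mem_nhds (by simp [hz])
        filter_upwards [hU] with w hw
        have hw' : ‖w‖ ^ 2 < 1 / 2 := hw
        rw [h0 w (by rw [abs_of_neg (by linarith)]; linarith), zero_mul]
      exact contDiffAt_const.congr_of_eventuallyEq this
    · exact hχ.contDiffAt.mul (SF.contDiffAt F hz)
  · change χ (‖z‖ ^ 2) * rext F z = 0
    rw [h0 z (by rw [abs_of_pos (by nlinarith)]; nlinarith), zero_mul]
  · change χ (‖x.1‖ ^ 2) * rext F x.1 = _
    rw [norm_val, rext_val, χ.one_of_mem_closedBall (by simp [χ.rIn_pos.le]), one_mul]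

/-- The rotation by `π` about the direction of `w`. -/
def flip (w : E3) : E3 ≃ₗᵢ[ℝ] E3 := Submodule.reflection (Submodule.span ℝ {w})

lemma flip_apply (w z : E3) : flip w z = (2 * (inner ℝ w z / ‖w‖ ^ 2)) • w - z := by
  rw [flip, Submodule.reflection_singleton_apply]
  simp [two_smul, two_mul, add_smul]

lemma inner_flip (w a b : E3) : inner ℝ a (flip w b) = inner ℝ (flip w a) b := by
  simp only [flip_apply, inner_sub_right, inner_sub_left, inner_smul_right, inner_smul_left,
    real_inner_comm w a]
  simp
  ring

lemma flip_add (x y : Sph) (h : x.1 + y.1 ≠ 0) : flip (x.1 + y.1) y.1 = x.1 := by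
  have h2 : ‖x.1 + y.1‖ ^ 2 = 2 * inner ℝ (x.1 + y.1) y.1 := by
    rw [norm_add_sq_real, norm_val, norm_val, inner_add_left, real_inner_self_eq_norm_sq, norm_val]
    ring
  have h3 : ‖x.1 + y.1‖ ^ 2 ≠ 0 := pow_ne_zero 2 (norm_ne_zero_iff.mpr h)
  rw [flip_apply, ← mul_div_assoc, ← h2, div_self h3, one_smul, add_sub_cancel_right]

/-- Near a fixed point `x0`, the half-turn about `x0 + x` interchanges `x0` and `x`. Substituting it
under the integral freezes the singular kernel at `x0` and moves the whole dependence on `x` into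
the smooth function `F`. -/
lemma ZKer.smooth {k : ℝ → ℝ} (hk : ZKer k) (F : SF) :
    SmoothS fun x => ∫ y, k (ip x y) * (F : Scal) y ∂area := by
  intro p0 hp0
  have hp0' : p0 ≠ 0 := hp0
  refine ContDiffAt.contDiffWithinAt ?_
  obtain ⟨E, hE, hE0, hEF⟩ := exists_extension F
  let x0 : Sph := ⟨‖p0‖⁻¹ • p0, normalize_mem hp0'⟩
  let w : E3 → E3 := fun p => x0.1 + ‖p‖⁻¹ • p
  let s : Set E3 := {0}ᶜ ∩ w ⁻¹' {0}ᶜ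
  have hw : ContDiffOn ℝ ∞ w {0}ᶜ := contDiffOn_const.add contDiffOn_normalize
  have hs : IsOpen s := hw.continuousOn.isOpen_inter_preimage isOpen_compl_zero isOpen_compl_zero
  have hp0s : p0 ∈ s := ⟨hp0, by
    change x0.1 + x0.1 ≠ 0
    rw [← two_smul ℝ]
    exact smul_ne_zero two_ne_zero (val_ne_zero x0)⟩
  let g : E3 → E3 → ℝ := fun p z => E (flip (w p) (-z))
  let μ : Measure E3 := area.map Subtype.val
  have hemb : MeasurableEmbedding (Subtype.val : Sph → E3) :=
    MeasurableEmbedding.subtype_coe Metric.isClosed_sphere.measurableSet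
  have hf : LocallyIntegrable (fun z : E3 => k (inner ℝ x0.1 z)) μ := by
    refine Integrable.locallyIntegrable ((hemb.integrable_map_iff).mpr ?_)
    refine (hk.integrable x0).congr (Filter.Eventually.of_forall fun y => ?_)
    simp [ip_eq_inner]
  have hg : ContDiffOn ℝ ∞ (Function.uncurry g) (s ×ˢ Set.univ) := by
    refine hE.comp_contDiffOn ?_
    simp only [flip_apply]
    have hw1 : ContDiffOn ℝ ∞ (fun q : E3 × E3 => w q.1) (s ×ˢ Set.univ) :=
      hw.comp contDiffOn_fst fun q hq => hq.1.1
    have hn : ∀ q ∈ s ×ˢ (Set.univ : Set E3), ‖w q.1‖ ^ 2 ≠ 0 := fun q hq =>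
      pow_ne_zero 2 (norm_ne_zero_iff.mpr hq.1.2)
    have hz : ContDiffOn ℝ ∞ (fun q : E3 × E3 => -q.2) (s ×ˢ Set.univ) := contDiffOn_snd.neg
    exact ((contDiffOn_const.mul ((hw1.inner ℝ hz).div (hw1.norm_sq ℝ) hn)).smul hw1).sub hz
  have hg0 : ∀ p z, p ∈ s → z ∉ Metric.closedBall (0 : E3) 2 → g p z = 0 := fun p z _ hz =>
    hE0 _ (by
      rw [LinearIsometryEquiv.norm_map, norm_neg]
      simpa using hz)
  -- A convolution for the push-forward of the area to `ℝ³`, evaluated only at the origin: it serves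
  -- as a theorem on differentiation of an integral in its parameter.
  have hc := contDiffOn_convolution_right_with_param_comp (n := ⊤) (ContinuousLinearMap.mul ℝ ℝ)
    (contDiffOn_const (c := (0 : E3))) hs (isCompact_closedBall (0 : E3) 2) hg0 hf hg
  have hcat := hc.contDiffAt (hs.mem_nhds hp0s)
  refine hcat.congr_of_eventuallyEq ?_
  filter_upwards [hs.mem_nhds hp0s] with p hp
  have hp' : p ≠ 0 := hp.1
  rw [rext_apply _ hp' (normalize_mem hp')]
  set x : Sph := ⟨‖p‖⁻¹ • p, normalize_mem hp'⟩
  have hwp : x0.1 + x.1 ≠ 0 := hp.2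
  have e := integral_sphMap (flip (w p)) (fun y => k (ip x y) * (F : Scal) y)
  rw [← e, convolution, hemb.integral_map]
  refine integral_congr_ae (Filter.Eventually.of_forall fun z => ?_)
  have e1 : ip x (sphMap (flip (w p)) z) = inner ℝ x0.1 z.1 := by
    rw [ip_eq_inner]
    change inner ℝ x.1 (flip (w p) z.1) = _
    rw [inner_flip, show flip (w p) x.1 = x0.1 from flip_add x0 x hwp]
  have e2 : g p (0 - z.1) = (F : Scal) (sphMap (flip (w p)) z) := by
    simp only [g, zero_sub, neg_neg, ← hEF]
    rfl
  simp only [e1, e2, ContinuousLinearMap.mul_apply']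

/-- The convolution of a smooth function on the sphere with a zonal kernel. -/
def convB {k : ℝ → ℝ} (hk : ZKer k) (F : SF) : SF := SF.mk _ (hk.smooth F)

lemma convB_apply {k : ℝ → ℝ} (hk : ZKer k) (F : SF) (x : Sph) :
    (convB hk F : Scal) x = ∫ y, k (ip x y) * (F : Scal) y ∂area := rfl

/-- Fubini, justified by the integrable majorant on the product. It puts the kernel on the test
function, where `green_gG` and `green_gH` apply. -/
lemma intB_convB_mul {k : ℝ → ℝ} (hk : ZKer k) (F h : SF) :
    intB (convB hk F * h) = ∫ y, (F : Scal) y * ∫ x, k (ip x y) * (h : Scal) x ∂area ∂area := by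
  obtain ⟨C, hC0, hC⟩ := hk.bound
  obtain ⟨M, hM0, hM⟩ := exists_abs_le F
  obtain ⟨N, hN0, hN⟩ := exists_abs_le h
  have hF := SF.continuous F
  have hh := SF.continuous h
  have hint : Integrable (fun p : Sph × Sph => k (ip p.1 p.2) * (F : Scal) p.2 * (h : Scal) p.1)
      (area.prod area) := by
    refine (integrable_prod_kD.const_mul (C * M * N)).mono' ?_
      (Filter.Eventually.of_forall fun p => ?_)
    · exact (((hk.meas.comp continuous_ip.measurable).mul
        (hF.comp continuous_snd).measurable).mul (hh.comp continuous_fst).measurable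
          ).aestronglyMeasurable
    · rw [norm_mul, norm_mul]
      have hk0 := kD_nonneg p.2 p.1
      calc ‖k (ip p.1 p.2)‖ * ‖(F : Scal) p.2‖ * ‖(h : Scal) p.1‖
          ≤ C * (1 + kD p.2 p.1) * M * N :=
            mul_le_mul (mul_le_mul (hC _ _) (hM _) (norm_nonneg _) (by positivity)) (hN _)
              (norm_nonneg _) (by positivity)
        _ = C * M * N * (1 + kD p.2 p.1) := by ring
  have e1 : intB (convB hk F * h) =
      ∫ x, ∫ y, k (ip x y) * (F : Scal) y * (h : Scal) x ∂area ∂area := by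
    rw [intB_apply]
    refine integral_congr_ae (Filter.Eventually.of_forall fun x => ?_)
    simp only [SF.coe_mul, Pi.mul_apply, convB_apply, integral_mul_const]
  rw [e1, integral_integral_swap hint]
  refine integral_congr_ae (Filter.Eventually.of_forall fun y => ?_)
  simp only [← integral_const_mul]
  exact integral_congr_ae (Filter.Eventually.of_forall fun x => by ring)

/-! ### Solvability for the operators `Δ`, `Δ + 2` and the divergence; Hodge decomposition -/

lemma eq_of_intB_mul {f g : SF} (h : ∀ u, intB (f * u) = intB (g * u)) : f = g := by
  refine sub_eq_zero.mp (eq_zero_of_intB_sq (f - g) ?_)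
  have := h (f - g)
  rw [sub_mul, map_sub, this, sub_self]

/-- The projections of a function to the spherical harmonics of degree zero and one. -/
def m0B : SF →ₗ[ℝ] SF := ((1 / (4 * Real.pi)) • intB).smulRight 1
def m1B : SF →ₗ[ℝ] SF :=
  ∑ i, ((3 / (4 * Real.pi)) • intB ∘ₗ LinearMap.mulLeft ℝ (cx i)).smulRight (cx i)

lemma m0B_apply (F : SF) : m0B F = (intB F / (4 * Real.pi)) • (1 : SF) := by
  simp [m0B, div_eq_inv_mul]

lemma m1B_apply (F : SF) : m1B F = ∑ i, (3 * intB (cx i * F) / (4 * Real.pi)) • cx i := by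
  simp only [m1B, LinearMap.sum_apply, LinearMap.smulRight_apply, LinearMap.smul_apply,
    LinearMap.comp_apply, LinearMap.mulLeft_apply, smul_eq_mul]
  exact Finset.sum_congr rfl fun i _ => by congr 1; ring

/-- Solvability of the Poisson equation. -/
theorem exists_lapB_eq (F : SF) :
    ∃ f : SF, lapB f = F - m0B F := by
  rw [m0B_apply]
  have hpi := Real.pi_ne_zero
  -- The convolution is already known to be smooth, so the equation may be tested weakly: `Δ` is
  -- moved to the test function `u` and Green's identity gives the rest.
  refine ⟨(1 / (2 * Real.pi)) • convB zker_gG F, eq_of_intB_mul fun u => ?_⟩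
  have key : intB (convB zker_gG F * lapB u) =
      2 * Real.pi * intB (F * u) - 1 / 2 * intB u * intB F := by
    rw [intB_convB_mul]
    simp only [green_gG, mul_sub]
    rw [integral_sub, intB_apply (F * u), intB_apply F, ← integral_const_mul, ← integral_const_mul]
    · congr 1 <;> refine integral_congr_ae (Filter.Eventually.of_forall fun y => ?_)
      · simp only [SF.coe_mul, Pi.mul_apply]
        ring
      · exact mul_comm _ _
    · exact ((SF.integrable (F * u)).const_mul (2 * Real.pi)).congr
        (Filter.Eventually.of_forall fun y => by simp only [SF.coe_mul, Pi.mul_apply]; ring)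
    · exact (SF.integrable F).mul_const _
  rw [mul_comm, intB_mul_lapB, smul_mul_assoc, map_smul, key, sub_mul, map_sub, smul_mul_assoc,
    one_mul, map_smul, smul_eq_mul, smul_eq_mul]
  field_simp
  ring

lemma tB_eq (y : Sph) : tB y = ∑ i, y.1 i • cx i := rfl

/-- The same weak argument with `gH`. The operator annihilates `l = 1`, so by self-adjointness that
part of the right-hand side has to be removed. -/
theorem exists_lapB_add_two_eq (F : SF) :
    ∃ f : SF, lapB f + 2 * f = F - m1B F := by
  rw [m1B_apply]
  have hpi := Real.pi_ne_zero
  refine ⟨(1 / (2 * Real.pi)) • convB zker_gH F, eq_of_intB_mul fun u => ?_⟩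
  have key : intB (convB zker_gH F * (lapB u + 2 * u)) =
      2 * Real.pi * intB (F * u) - 3 / 2 * ∑ i, intB (cx i * u) * intB (cx i * F) := by
    rw [intB_convB_mul]
    have e : ∀ y : Sph, intB (tB y * u) = (∑ i, intB (cx i * u) • cx i : SF).val y := by
      intro y
      rw [tB_eq, Finset.sum_mul, map_sum, SF.coe_sum_apply]
      refine Finset.sum_congr rfl fun i _ => ?_
      rw [smul_mul_assoc, map_smul]
      exact mul_comm _ _
    simp only [green_gH, mul_sub, e]
    have e2 : ∑ i, intB (cx i * u) * intB (cx i * F) =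
        intB (F * ∑ i, intB (cx i * u) • cx i) := by
      rw [Finset.mul_sum, map_sum]
      refine Finset.sum_congr rfl fun i _ => ?_
      rw [mul_smul_comm, map_smul, mul_comm F]
      rfl
    rw [integral_sub, e2, intB_apply, intB_apply, ← integral_const_mul, ← integral_const_mul]
    · congr 1 <;> refine integral_congr_ae (Filter.Eventually.of_forall fun y => ?_) <;>
      · simp only [SF.coe_mul, Pi.mul_apply]
        ring
    · exact ((SF.integrable (F * u)).const_mul (2 * Real.pi)).congr
        (Filter.Eventually.of_forall fun y => by simp only [SF.coe_mul, Pi.mul_apply]; ring)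
    · exact ((SF.integrable (F * ∑ i, intB (cx i * u) • cx i)).const_mul (3 / 2)).congr
        (Filter.Eventually.of_forall fun y => by simp only [SF.coe_mul, Pi.mul_apply]; ring)
  have h1 : ∀ f : SF, intB ((lapB f + 2 * f) * u) = intB (f * (lapB u + 2 * u)) := by
    intro f
    rw [add_mul, mul_add, map_add, map_add, mul_comm, intB_mul_lapB]
    congr 2
    ring
  rw [h1, smul_mul_assoc, map_smul, key, sub_mul, map_sub, Finset.sum_mul, map_sum, smul_eq_mul]
  have h2 : ∀ i, intB ((3 * intB (cx i * F) / (4 * Real.pi)) • cx i * u) =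
      3 / (4 * Real.pi) * (intB (cx i * u) * intB (cx i * F)) := by
    intro i
    rw [smul_mul_assoc, map_smul, smul_eq_mul]
    ring
  rw [Finset.sum_congr rfl fun i _ => h2 i, ← Finset.mul_sum]
  field_simp
  ring

/-- In Green's representation only the mean value survives. -/
theorem eq_const_of_lapB_eq_zero (f : SF) (h : lapB f = 0) :
    f = m0B f := by
  rw [m0B_apply]
  have hpi := Real.pi_ne_zero
  refine SF.ext fun y => ?_
  have h1 := green_gG y f
  simp only [h, SF.coe_zero, Pi.zero_apply, mul_zero, integral_zero] at h1
  simp only [SF.coe_smul, SF.coe_one, Pi.smul_apply, Pi.one_apply, smul_eq_mul, mul_one]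
  field_simp
  linarith

/-- A tangent field without divergence and curl vanishes. -/
theorem eq_zero_of_dvB_eq_zero (N : VF) (h1 : dvB N = 0) (h2 : dvB (hodgeB N) = 0) : N = 0 := by
  -- The harmonic Euclidean components are constants `b_k`. Tangency says that `b · x` vanishes on
  -- the sphere, and pairing with `x_j` gives `b_j = 0`.
  have hc : ∀ k, N.c k = (intB (N.c k) / (4 * Real.pi)) • (1 : SF) := fun k =>
    (eq_const_of_lapB_eq_zero _ (lapB_eq_zero_of_dvB N h1 h2 k)).trans (m0B_apply _)
  set b : Fin 3 → ℝ := fun k => intB (N.c k) / (4 * Real.pi)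
  have ht := N.tan
  have hb : ∑ k, b k • cx k = 0 := by
    rw [← ht]
    refine Finset.sum_congr rfl fun k _ => ?_
    rw [hc k, mul_smul_comm, mul_one]
  refine VF.ext fun j => ?_
  have hj : intB (cx j * ∑ k, b k • cx k) = b j * (4 * Real.pi / 3) := by
    rw [Finset.mul_sum, map_sum]
    simp only [mul_smul_comm, map_smul, intB_cx_mul_cx, smul_eq_mul, mul_ite, mul_zero,
      Finset.sum_ite_eq, Finset.mem_univ, if_true]
  rw [hb, mul_zero, map_zero] at hj
  have : b j = 0 := by
    rcases mul_eq_zero.mp hj.symm with h | h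
    · exact h
    · exact absurd h (by positivity)
  rw [hc j, show intB (N.c j) / (4 * Real.pi) = 0 from this, zero_smul]
  rfl

lemma dvB_D1B (f g : SF) : dvB (D1B f g) = -lapB f := by
  rw [D1B, map_add, map_neg, dvB_gradB, dvB_hodgeB_gradB, add_zero]

lemma dvB_hodgeB_D1B (f g : SF) : dvB (hodgeB (D1B f g)) = -lapB g := by
  rw [D1B, map_add, map_neg, hodgeB_hodgeB, map_add, map_neg, map_neg, dvB_hodgeB_gradB, dvB_gradB,
    neg_zero, zero_add]

/-- The Hodge decomposition. -/
theorem exists_D1B_eq (X : VF) : ∃ f g : SF, X = D1B f g := by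
  obtain ⟨f, hf⟩ := exists_lapB_eq (-dvB X)
  obtain ⟨g, hg⟩ := exists_lapB_eq (-dvB (hodgeB X))
  refine ⟨f, g, sub_eq_zero.mp (eq_zero_of_dvB_eq_zero _ ?_ ?_)⟩
  · rw [map_sub, dvB_D1B, hf, m0B_apply, map_neg, intB_dvB]
    simp
  · rw [map_sub, map_sub, dvB_hodgeB_D1B, hg, m0B_apply, map_neg, intB_dvB]
    simp

/-- The divergence on symmetric tracefree tensors is onto the fields without degree one part. -/
theorem exists_dvTB_eq (f g : SF) : ∃ W : TF, dvTB W = D1B (f - m1B f) (g - m1B g) := by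
  obtain ⟨f1, hf⟩ := exists_lapB_add_two_eq ((-2 : ℝ) • f)
  obtain ⟨g1, hg⟩ := exists_lapB_add_two_eq ((-2 : ℝ) • g)
  refine ⟨D2B (D1B f1 g1), ?_⟩
  have e : ∀ u : SF, (2 : ℝ) • u = 2 * u := fun u => by
    rw [two_smul, two_mul]
  rw [dvTB_D2B_D1B, e, e, hf, hg, map_smul, map_smul, ← smul_sub, ← smul_sub]
  simp only [D1B, map_smul, smul_add, smul_neg, smul_smul]
  norm_num

/-! ## The modes `l ≤ 1` -/

/-- Normalization of the spherical harmonics of degree one. -/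
def n1 : ℝ := √(3 / (4 * Real.pi))

lemma n1_sq : n1 * n1 = 3 / (4 * Real.pi) := Real.mul_self_sqrt (by positivity)

def Y1B (i : Fin 3) : SF := n1 • cx i

lemma coe_Y1B (i : Fin 3) : (Y1B i : Scal) = Y1 i := by
  funext x
  rfl

/-- The coefficients of degree one. -/
def c1B (i : Fin 3) : SF →ₗ[ℝ] ℝ := intB ∘ₗ LinearMap.mulRight ℝ (Y1B i)

lemma c1_coe (i : Fin 3) (f : SF) : c1 i f = c1B i f := by
  simp [c1, c1B, intB_apply, coe_Y1B]

lemma c0_coe (f : SF) : c0 f = 1 / √(4 * Real.pi) * intB f := by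
  simp only [c0, Y0, intB_apply, ← integral_const_mul]
  exact integral_congr_ae (Filter.Eventually.of_forall fun x => mul_comm _ _)

lemma m0_coe (f : SF) : m0 f = m0B f := by
  funext x
  have h : √(4 * Real.pi) * √(4 * Real.pi) = 4 * Real.pi := Real.mul_self_sqrt (by positivity)
  have h0 : √(4 * Real.pi) ≠ 0 := (Real.sqrt_pos.mpr (by positivity)).ne'
  simp only [m0, m0B_apply, c0_coe, Y0, SF.coe_smul, SF.coe_one, Pi.smul_apply, Pi.one_apply,
    smul_eq_mul, mul_one]
  generalize √(4 * Real.pi) = q at h h0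
  rw [← h]
  field_simp

lemma c1B_eq (i : Fin 3) (f : SF) : c1B i f = n1 * intB (cx i * f) := by
  simp [c1B, Y1B, mul_comm f]

lemma m1B_eq (f : SF) : m1B f = ∑ i, c1B i f • Y1B i := by
  rw [m1B_apply]
  refine Finset.sum_congr rfl fun i _ => ?_
  rw [c1B_eq, Y1B, smul_smul, mul_right_comm, n1_sq]
  congr 1
  ring

lemma m1_coe (f : SF) : m1 f = m1B f := by
  rw [m1B_eq, SF.coe_sum]
  refine Finset.sum_congr rfl fun i _ => ?_
  rw [SF.coe_smul, coe_Y1B, c1_coe]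

def le1B : SF →ₗ[ℝ] SF := m0B + m1B

lemma le1B_apply (f : SF) : le1B f = m0B f + m1B f := rfl

lemma le1_coe (f : SF) : le1 f = le1B f := by
  rw [le1, m0_coe, m1_coe, le1B_apply, SF.coe_add]

lemma ge2_coe (f : SF) : ge2 f = (f - le1B f : SF) := by
  rw [ge2, le1_coe, SF.coe_sub]

lemma m0B_one : m0B 1 = 1 := by
  rw [m0B_apply, intB_one, div_self (by positivity), one_smul]

lemma m0B_cx (i : Fin 3) : m0B (cx i) = 0 := by
  rw [m0B_apply, intB_cx, zero_div, zero_smul]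

lemma m1B_one : m1B 1 = 0 := by
  simp [m1B_apply, intB_cx]

lemma m1B_cx (i : Fin 3) : m1B (cx i) = cx i := by
  have h : ∀ j, (3 * intB (cx j * cx i) / (4 * Real.pi)) • cx j = if j = i then cx i else 0 := by
    intro j
    rw [intB_cx_mul_cx]
    split_ifs with h
    · have : (3 * (4 * Real.pi / 3) / (4 * Real.pi)) = 1 := by
        have := Real.pi_ne_zero
        field_simp
      rw [this, one_smul, h]
    · simp
  rw [m1B_apply, Finset.sum_congr rfl fun j _ => h j]
  simp

lemma m0B_m0B (f : SF) : m0B (m0B f) = m0B f := by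
  rw [m0B_apply f, map_smul, m0B_one]

lemma m1B_m0B (f : SF) : m1B (m0B f) = 0 := by
  rw [m0B_apply f, map_smul, m1B_one, smul_zero]

lemma m0B_m1B (f : SF) : m0B (m1B f) = 0 := by
  simp only [m1B_apply f, map_sum, map_smul, m0B_cx, smul_zero, Finset.sum_const_zero]

lemma m1B_m1B (f : SF) : m1B (m1B f) = m1B f := by
  simp only [m1B_apply f, map_sum, map_smul, m1B_cx]

lemma le1B_le1B (f : SF) : le1B (le1B f) = le1B f := by
  simp only [le1B_apply, map_add, m0B_m0B, m0B_m1B, m1B_m0B, m1B_m1B, add_zero, zero_add]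

lemma le1B_m1B (f : SF) : le1B (m1B f) = m1B f := by
  rw [le1B_apply, m0B_m1B, m1B_m1B, zero_add]

lemma le1B_m0B (f : SF) : le1B (m0B f) = m0B f := by
  rw [le1B_apply, m0B_m0B, m1B_m0B, add_zero]

lemma m1B_le1B (f : SF) : m1B (le1B f) = m1B f := by
  rw [le1B_apply, map_add, m1B_m0B, m1B_m1B, zero_add]

lemma m0B_le1B (f : SF) : m0B (le1B f) = m0B f := by
  rw [le1B_apply, map_add, m0B_m0B, m0B_m1B, add_zero]

lemma lapB_m0B (f : SF) : lapB (m0B f) = 0 := by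
  rw [m0B_apply, map_smul, show lapB (1 : SF) = 0 by simp [lapB_apply], smul_zero]

lemma gradB_m0B (f : SF) : gradB (m0B f) = 0 := by
  rw [m0B_apply, map_smul, show gradB (1 : SF) = 0 from VF.ext fun i => by
    rw [gradB_apply, VF.zero_c]; simp, smul_zero]

lemma lapB_m1B (f : SF) : lapB (m1B f) = (-2 : ℝ) • m1B f := by
  simp only [m1B_apply, map_sum, map_smul, lapB_cx, Finset.smul_sum]
  refine Finset.sum_congr rfl fun i _ => ?_
  rw [smul_comm, neg_smul, two_smul, two_mul]

lemma m0B_dvB (X : VF) : m0B (dvB X) = 0 := by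
  rw [m0B_apply, intB_dvB, zero_div, zero_smul]

lemma m0B_lapB (f : SF) : m0B (lapB f) = 0 := m0B_dvB _

lemma c1B_lapB (i : Fin 3) (f : SF) : c1B i (lapB f) = -2 * c1B i f := by
  rw [c1B_eq, c1B_eq, intB_mul_lapB, lapB_cx, mul_neg, map_neg, mul_left_comm, intB_ofNat_mul,
    mul_comm f]
  ring

lemma m1B_lapB (f : SF) : m1B (lapB f) = (-2 : ℝ) • m1B f := by
  simp only [m1B_eq, c1B_lapB, Finset.smul_sum, smul_smul]

lemma D1B_add (f g f' g' : SF) : D1B (f + f') (g + g') = D1B f g + D1B f' g' := by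
  simp only [D1B, map_add]
  abel

lemma D1B_sub (f g f' g' : SF) : D1B (f - f') (g - g') = D1B f g - D1B f' g' := by
  simp only [D1B, map_sub]
  abel

lemma D1B_smul (c : ℝ) (f g : SF) : D1B (c • f) (c • g) = c • D1B f g := by
  simp only [D1B, map_smul, smul_add, smul_neg]

lemma dotB_hodgeB (X Z : VF) : dotB X (hodgeB Z) = -dotB (hodgeB X) Z := by
  simp only [dotB, Fin.sum_univ_three, hodgeB_zero, hodgeB_one, hodgeB_two]
  ring

lemma dotB_comm (X Z : VF) : dotB X Z = dotB Z X :=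
  Finset.sum_congr rfl fun _ _ => mul_comm _ _

lemma dotB_smul (c : ℝ) (X Z : VF) : dotB X (c • Z) = c • dotB X Z := by
  simp only [dotB, VF.smul_c, mul_smul_comm, Finset.smul_sum]

lemma dotB_neg (X Z : VF) : dotB X (-Z) = -dotB X Z := by
  simp only [dotB, VF.neg_c, mul_neg, Finset.sum_neg_distrib]

def E1B (i : Fin 3) : VF := (1 / √2) • D1B (Y1B i) 0
def H1B (i : Fin 3) : VF := (1 / √2) • D1B 0 (Y1B i)

lemma coe_E1B (i : Fin 3) : E1 i = toCov (E1B i) := by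
  rw [E1, ← coe_Y1B, E1B, map_smul, ← D1s_coe, SF.coe_zero]

lemma coe_H1B (i : Fin 3) : H1 i = toCov (H1B i) := by
  rw [H1, ← coe_Y1B, H1B, map_smul, ← D1s_coe, SF.coe_zero]

lemma intB_dotB (X Z : VF) : ∫ x, ∑ j, toCov X x j * toCov Z x j ∂area = intB (dotB X Z) := by
  rw [intB_apply]
  refine integral_congr_ae (Filter.Eventually.of_forall fun x => ?_)
  simp only [dotB, SF.coe_sum_apply, SF.coe_mul, Pi.mul_apply, toCov_apply]

lemma cE_toCov (i : Fin 3) (X : VF) : cE i (toCov X) = 1 / √2 * c1B i (dvB X) := by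
  rw [cE, coe_E1B, intB_dotB, E1B, D1B, map_zero, map_zero, add_zero, dotB_smul, dotB_neg, dotB_comm,
    map_smul, map_neg, intB_dotB_gradB, neg_neg, smul_eq_mul, mul_comm (Y1B i)]
  rfl

lemma cH_toCov (i : Fin 3) (X : VF) : cH i (toCov X) = 1 / √2 * c1B i (dvB (hodgeB X)) := by
  rw [cH, coe_H1B, intB_dotB, H1B, D1B, map_zero, neg_zero, zero_add, dotB_smul, dotB_hodgeB,
    dotB_comm, map_smul, map_neg, intB_dotB_gradB, neg_neg, smul_eq_mul, mul_comm (Y1B i)]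
  rfl

/-- Through the Hodge potentials the covector projection becomes the scalar one. The eigenvalue `-2`
of `Δ` and the factors `1/√2` in `E1`, `H1` combine to the normalisation `1`. -/
lemma cm1_D1B (f g : SF) : cm1 (toCov (D1B f g)) = toCov (D1B (m1B f) (m1B g)) := by
  have h2 : √2 * √2 = 2 := Real.mul_self_sqrt (by norm_num)
  have h0 : √2 ≠ 0 := by positivity
  have h : ∀ a : ℝ, 1 / √2 * -(-2 * a) = √2 * a := by
    intro a
    rw [div_mul_eq_mul_div, div_eq_iff h0, mul_right_comm, h2]
    ring
  have e : D1B (m1B f) (m1B g) = ∑ i, ((√2 * c1B i f) • E1B i + (√2 * c1B i g) • H1B i) := by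
    have h3 : ∀ a : ℝ, √2 * a * (1 / √2) = a := fun a => by field_simp
    simp only [m1B_eq, E1B, H1B, smul_smul, h3]
    rw [D1B, map_sum, map_sum, map_sum, ← Finset.sum_neg_distrib, ← Finset.sum_add_distrib]
    refine Finset.sum_congr rfl fun i _ => ?_
    simp only [D1B, map_smul, map_zero, neg_zero, add_zero, zero_add, smul_neg]
  rw [cm1, e, map_sum]
  refine Finset.sum_congr rfl fun i _ => ?_
  rw [cE_toCov, cH_toCov, dvB_D1B, dvB_hodgeB_D1B, map_neg, map_neg, c1B_lapB, c1B_lapB, h, h,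
    coe_E1B, coe_H1B, map_add, map_smul, map_smul]

/-- By adjointness this pairs `W` with `D₂*` of a conformal Killing field. It is the reason why the
degree-one part of `q₀` is conserved. -/
lemma c1B_dvB_dvTB (i : Fin 3) (W : TF) : c1B i (dvB (dvTB W)) = 0 := by
  have h := intB_dotB_dvTB W (gradB (cx i))
  rw [D2B_gradB_cx, dotB_comm, intB_dotB_gradB] at h
  have h0 : ddotB W 0 = 0 := by simp [ddotB]
  rw [h0, map_zero, neg_eq_zero] at h
  rw [c1B_eq, h, mul_zero]

lemma D2B_gradB_m1B (f : SF) : D2B (gradB (m1B f)) = 0 := by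
  simp only [m1B_apply, map_sum, map_smul, D2B_gradB_cx, smul_zero, Finset.sum_const_zero]

lemma D2B_gradB_le1B (f : SF) : D2B (gradB (le1B f)) = 0 := by
  rw [le1B_apply, map_add, gradB_m0B, zero_add, D2B_gradB_m1B]

lemma D2B_D1B_m1B (f g : SF) : D2B (D1B (m1B f) (m1B g)) = 0 := by
  rw [D1B, map_add, map_neg, D2B_gradB_m1B]
  simp only [m1B_apply, map_sum, map_smul, D2B_hodgeB_gradB_cx, smul_zero, Finset.sum_const_zero,
    neg_zero, add_zero]

lemma m2_coe (f : SF) (x : Sph) :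
    m2 f x = 5 / (8 * Real.pi) * (3 * intB (tB x * tB x * f) - intB f) := by
  rw [m2, intB_apply, intB_apply, ← integral_const_mul, ← integral_sub
    ((SF.integrable _).const_mul 3) (SF.integrable f), ← integral_const_mul]
  refine integral_congr_ae (Filter.Eventually.of_forall fun y => ?_)
  simp only [SF.coe_mul, Pi.mul_apply, tB_apply]
  have : ∑ i, x.1 i * y.1 i = ip y x := (ip_comm x y)
  rw [this]
  have := Real.pi_ne_zero
  field_simp
  ring

lemma m2_add (f g : SF) : m2 (f + g : SF) = m2 f + m2 g := by
  funext x
  simp only [Pi.add_apply, m2_coe, mul_add, map_add]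
  ring

lemma m2_smul (c : ℝ) (f : SF) : m2 (c • f : SF) = c • m2 f := by
  funext x
  simp only [Pi.smul_apply, m2_coe, mul_smul_comm, map_smul, smul_eq_mul]
  ring

lemma intB_tB_sq (x : Sph) : intB (tB x * tB x) = 4 * Real.pi / 3 := by
  have h : ∀ i, intB (tB x * cx i) = x.1 i * (4 * Real.pi / 3) := fun i => by
    rw [tB_eq, Finset.sum_mul, map_sum]
    simp only [smul_mul_assoc, map_smul, intB_cx_mul_cx, smul_eq_mul, mul_ite, mul_zero,
      Finset.sum_ite_eq', Finset.mem_univ, if_true]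
  have h2 : intB (tB x * ∑ i, x.1 i • cx i) = 4 * Real.pi / 3 := by
    rw [Finset.mul_sum, map_sum]
    simp only [mul_smul_comm, map_smul, h, smul_eq_mul, ← mul_assoc]
    rw [← Finset.sum_mul, sum_sq_val, one_mul]
  exact h2

lemma m2_le1B (f : SF) : m2 (le1B f) = 0 := by
  have h1 : m2 (1 : SF) = 0 := by
    funext x
    rw [m2_coe, mul_one, intB_tB_sq, intB_one, Pi.zero_apply]
    ring
  have h2 : ∀ k, m2 (cx k) = 0 := fun k => by
    funext x
    have : intB (tB x * tB x * cx k) = 0 := by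
      simp only [tB_eq, Finset.sum_mul, Finset.mul_sum, map_sum, smul_mul_assoc, mul_smul_comm,
        map_smul, intB_cx_mul_cx_mul_cx, smul_zero, Finset.sum_const_zero]
    rw [m2_coe, this, intB_cx, Pi.zero_apply]
    ring
  rw [le1B_apply, m2_add, m0B_apply, m2_smul, h1, smul_zero, zero_add, m1B_apply,
    Fin.sum_univ_three, m2_add, m2_add, m2_smul, m2_smul, m2_smul, h2, h2, h2]
  simp

lemma m2_eq_of_sub_le1B {f g h : SF} (e : f = g + le1B h) : m2 f = m2 g := by
  rw [e, m2_add, m2_le1B, add_zero]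

/-! ## Smooth sphere data -/

/-- Smooth sphere data of infinite order. -/
structure BD where
  Om : SF
  phi : SF
  gc : TF
  trX : SF
  chih : TF
  trXb : SF
  chibh : TF
  eta : VF
  om : ℕ → SF
  omb : ℕ → SF
  al : ℕ → TF
  alb : ℕ → TF

namespace BD

/-- Truncation to sphere data of order `m`. -/
def toHSD (m : ℕ) (x : BD) : HSD m where
  Om := x.Om
  phi := x.phi
  gc := toTen x.gc
  trX := x.trX
  chih := toTen x.chih
  trXb := x.trXb
  chibh := toTen x.chibh
  eta := toCov x.eta
  om k := x.om k
  omb k := x.omb k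
  al k := toTen (x.al k)
  alb k := toTen (x.alb k)

lemma smooth_toHSD (m : ℕ) (x : BD) : (x.toHSD m).Smooth where
  stf_gc := isSTF_toTen _
  stf_chih := isSTF_toTen _
  stf_chibh := isSTF_toTen _
  stf_al _ := isSTF_toTen _
  stf_alb _ := isSTF_toTen _
  tan_eta := isTangent_toCov _
  Om := SF.smooth _
  phi := SF.smooth _
  gc i j := SF.smooth (x.gc.c i j)
  trX := SF.smooth _
  chih i j := SF.smooth (x.chih.c i j)
  trXb := SF.smooth _
  chibh i j := SF.smooth (x.chibh.c i j)
  eta i := SF.smooth (x.eta.c i)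
  om _ := SF.smooth _
  omb _ := SF.smooth _
  al k i j := SF.smooth ((x.al k).c i j)
  alb k i j := SF.smooth ((x.alb k).c i j)

lemma exists_toHSD {m : ℕ} {x : HSD m} (hx : x.Smooth) : ∃ b : BD, b.toHSD m = x := by
  obtain ⟨gc, hgc⟩ := exists_TF hx.gc hx.stf_gc
  obtain ⟨chih, hchih⟩ := exists_TF hx.chih hx.stf_chih
  obtain ⟨chibh, hchibh⟩ := exists_TF hx.chibh hx.stf_chibh
  obtain ⟨eta, heta⟩ := exists_VF hx.eta hx.tan_eta
  choose al hal using fun k => exists_TF (hx.al k) (hx.stf_al k)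
  choose alb halb using fun k => exists_TF (hx.alb k) (hx.stf_alb k)
  refine ⟨⟨SF.mk _ hx.Om, SF.mk _ hx.phi, gc, SF.mk _ hx.trX, chih, SF.mk _ hx.trXb, chibh, eta,
    fun k => if h : k < m + 2 then SF.mk _ (hx.om ⟨k, h⟩) else 0,
    fun k => if h : k < m + 2 then SF.mk _ (hx.omb ⟨k, h⟩) else 0,
    fun k => if h : k < m + 1 then al ⟨k, h⟩ else 0,
    fun k => if h : k < m + 1 then alb ⟨k, h⟩ else 0⟩, ?_⟩
  obtain ⟨_, _, _, _, _, _, _, _, _, _, _, _⟩ := x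
  simp only [toHSD, hgc, hchih, hchibh, heta, Fin.is_lt, dite_true, Fin.eta, hal, halb]
  rfl

variable (r : ℝ) (x : BD)

def etab : VF := -x.eta + (2 : ℝ) • gradB x.Om

def K : SF := (1 / (2 * r ^ 2)) • dvB (dvTB x.gc) - (1 / r ^ 3) • (lapB x.phi + (2 : ℝ) • x.phi)

def rho : SF :=
  -(x.K r + (1 / (2 * r)) • x.trXb - (1 / (2 * r)) • x.trX + (2 / r ^ 2) • x.Om)

def betab : VF :=
  (1 / r ^ 2) • dvTB x.chibh - (1 / 2 : ℝ) • gradB x.trXb - (1 / r) • x.eta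

def beta : VF :=
  -((1 / r ^ 2) • dvTB x.chih) + (1 / 2 : ℝ) • gradB x.trX - (1 / r) • x.etab

def X' : SF := x.trX - (4 / r) • x.Om

/-- The field whose degree one part is the charge `Q₀`. -/
def q0 : VF := r ^ 2 • x.eta + (r ^ 3 / 2) • gradB (x.X' r)

def Q1 : SF := (r / 2) • x.X' r + (1 / r) • x.phi

def Q2 : SF :=
  r ^ 2 • x.trXb - (2 / r) • dvB (r ^ 2 • x.eta + (r ^ 3 / 2) • gradB (x.X' r))
    - r ^ 2 • x.X' r + (2 * r ^ 3) • x.K r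

def Q3 : TF :=
  (1 / r) • x.chibh - (1 / 2 : ℝ) • (D2B (dvTB x.gc) + x.gc)
    + D2B (x.eta + (r / 2) • gradB (x.X' r)) - r • D2B (gradB (x.X' r))

variable (m : ℕ)

lemma etab_toHSD : (x.toHSD m).etab = toCov x.etab := by
  simp only [HSD.etab, toHSD, etab, map_add, map_neg, map_smul, grad_coe]

lemma dv_dvT (W : TF) : dv (dvT (toTen W)) = dvB (dvTB W) := by rw [dvT_toTen, dv_toCov]

lemma K_toHSD : (x.toHSD m).K r = x.K r := by
  simp only [HSD.K, toHSD, K, dv_dvT, lap_coe, SF.coe_sub, SF.coe_smul, SF.coe_add]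

lemma rho_toHSD : (x.toHSD m).rho r = x.rho r := by
  simp only [HSD.rho, K_toHSD, rho, SF.coe_sub, SF.coe_smul, SF.coe_add, SF.coe_neg]
  rfl

lemma betab_toHSD : (x.toHSD m).betab r = toCov (x.betab r) := by
  simp only [HSD.betab, toHSD, betab, dvT_toTen, grad_coe, map_sub, map_smul]

lemma beta_toHSD : (x.toHSD m).beta r = toCov (x.beta r) := by
  simp only [HSD.beta, etab_toHSD, beta, map_sub, map_smul, map_add, map_neg]
  simp only [toHSD, dvT_toTen, grad_coe]

lemma X'_toHSD : (x.toHSD m).X' r = x.X' r := by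
  simp only [HSD.X', toHSD, X', SF.coe_sub, SF.coe_smul]

lemma Q1_toHSD : (x.toHSD m).Q1 r = x.Q1 r := by
  simp only [HSD.Q1, X'_toHSD, Q1, SF.coe_add, SF.coe_smul]
  rfl

lemma Q2_toHSD : (x.toHSD m).Q2 r = x.Q2 r := by
  simp only [HSD.Q2, X'_toHSD, K_toHSD, Q2, SF.coe_add, SF.coe_smul, SF.coe_sub]
  rw [← dv_toCov, map_add, map_smul, map_smul, grad_coe]
  rfl

lemma Q3_toHSD : (x.toHSD m).Q3 r = toTen (x.Q3 r) := by
  simp only [HSD.Q3, X'_toHSD, Q3, grad_coe, D2s_toCov]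
  simp only [toHSD, dvT_toTen, D2s_toCov, ← map_smul, ← map_add, ← map_sub]

lemma omN_toHSD {k : ℕ} (h : k ≤ m + 1) : (x.toHSD m).omN k = x.om k := by
  simp [HSD.omN, show k < m + 2 by omega, toHSD]

lemma ombN_toHSD {k : ℕ} (h : k ≤ m + 1) : (x.toHSD m).ombN k = x.omb k := by
  simp [HSD.ombN, show k < m + 2 by omega, toHSD]

lemma alN_toHSD {k : ℕ} (h : k ≤ m) : (x.toHSD m).alN k = toTen (x.al k) := by
  simp [HSD.alN, show k < m + 1 by omega, toHSD]

lemma albN_toHSD {k : ℕ} (h : k ≤ m) : (x.toHSD m).albN k = toTen (x.alb k) := by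
  simp [HSD.albN, show k < m + 1 by omega, toHSD]

end BD

/-! ### Curvature jets and recovery of the fields from the charges -/

/-- Derivatives of the curvature components, for smooth fields. -/
def curvJetB (s r : ℝ) (b : VF) (ρ : SF) (a : ℕ → TF) : ℕ → VF × SF
  | 0 => (b, ρ)
  | k + 1 =>
    (∑ i : Fin (k + 1), ((k.choose i : ℝ) * s) •
        ((3 * dInv s r i) • (curvJetB s r b ρ a (k - i)).1 - dInvSq s r i • dvTB (a (k - i))),
     ∑ i : Fin (k + 1), ((k.choose i : ℝ) * s) •
        ((3 * dInv s r i) • (curvJetB s r b ρ a (k - i)).2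
          - dInvSq s r i • dvB (curvJetB s r b ρ a (k - i)).1))
  termination_by k => k
  decreasing_by all_goals omega

/-- The jet of order `k` involves the extreme component only up to order `k - 1`. This is what makes
order `m + 1` accessible from data that contain `α̲` only to order `m`. -/
lemma curvJet_coe (s r : ℝ) (b : VF) (ρ : SF) (a : ℕ → TF) (a' : ℕ → Ten) (k : ℕ)
    (h : ∀ j < k, a' j = toTen (a j)) :
    curvJet s r (toCov b) ρ a' k =
      (toCov (curvJetB s r b ρ a k).1, ((curvJetB s r b ρ a k).2 : Scal)) := by
  induction k using Nat.strong_induction_on with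
  | _ k ih =>
    cases k with
    | zero => rw [curvJet, curvJetB]
    | succ k =>
      have hi : ∀ i : Fin (k + 1), curvJet s r (toCov b) ρ a' (k - i) =
          (toCov (curvJetB s r b ρ a (k - i)).1, ((curvJetB s r b ρ a (k - i)).2 : Scal)) :=
        fun i => ih _ (by omega) fun j hj => h j (by omega)
      have hj : ∀ i : Fin (k + 1), a' (k - i) = toTen (a (k - i)) := fun i => h _ (by omega)
      rw [curvJet, curvJetB]
      simp only [hi, hj, dvT_toTen, dv_toCov, map_sum, map_smul, map_sub, SF.coe_sum, SF.coe_smul,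
        SF.coe_sub]

lemma curvJetB_congr {s r : ℝ} {b : VF} {ρ : SF} {a a' : ℕ → TF} {k : ℕ}
    (h : ∀ j < k, a j = a' j) : curvJetB s r b ρ a k = curvJetB s r b ρ a' k := by
  induction k using Nat.strong_induction_on with
  | _ k ih =>
    cases k with
    | zero => rw [curvJetB, curvJetB]
    | succ k =>
      have hi : ∀ i : Fin (k + 1), curvJetB s r b ρ a (k - i) = curvJetB s r b ρ a' (k - i) :=
        fun i => ih _ (by omega) fun j hj => h j (by omega)
      have hj : ∀ i : Fin (k + 1), a (k - i) = a' (k - i) := fun i => h _ (by omega)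
      rw [curvJetB, curvJetB]
      simp only [hi, hj]

namespace BD

variable {r : ℝ} {x y : BD}

lemma trX_eq (hr : r ≠ 0) :
    x.trX = (4 / r) • x.Om + (2 / r) • x.Q1 r - (2 / r ^ 2) • x.phi := by
  rw [Q1, X']
  match_scalars <;> field_simp <;> ring

lemma eta_eq (hr : r ≠ 0) : x.eta = (1 / r ^ 2) • x.q0 r - (r / 2) • gradB (x.X' r) := by
  rw [q0]
  match_scalars <;> field_simp
  ring

lemma trXb_eq (hr : r ≠ 0) : x.trXb = (1 / r ^ 2) • x.Q2 r + (2 / r ^ 3) • dvB (x.q0 r)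
    + x.X' r - (2 * r) • x.K r := by
  rw [Q2, ← q0]
  match_scalars <;> field_simp <;> ring

lemma chibh_eq (hr : r ≠ 0) : x.chibh = r • x.Q3 r + (r / 2) • (D2B (dvTB x.gc) + x.gc)
    - (1 / r) • D2B (x.q0 r) + r ^ 2 • D2B (gradB (x.X' r)) := by
  rw [Q3, q0]
  simp only [map_add, map_smul]
  match_scalars <;> field_simp <;> ring

/-- The basic fields are determined by `Ω, φ, g_c` and the charges. -/
lemma eq_of_charges (hr : r ≠ 0) (hOm : x.Om = y.Om) (hphi : x.phi = y.phi) (hgc : x.gc = y.gc)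
    (h0 : x.q0 r = y.q0 r) (h1 : x.Q1 r = y.Q1 r) (h2 : x.Q2 r = y.Q2 r) (h3 : x.Q3 r = y.Q3 r) :
    x.trX = y.trX ∧ x.eta = y.eta ∧ x.trXb = y.trXb ∧ x.chibh = y.chibh := by
  have e1 : x.trX = y.trX := by rw [trX_eq hr, trX_eq (x := y) hr, hOm, h1, hphi]
  have eX : x.X' r = y.X' r := by rw [X', X', e1, hOm]
  have eK : x.K r = y.K r := by rw [K, K, hgc, hphi]
  exact ⟨e1, by rw [eta_eq hr, eta_eq (x := y) hr, h0, eX],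
    by rw [trXb_eq hr, trXb_eq (x := y) hr, h2, h0, eX, eK],
    by rw [chibh_eq hr, chibh_eq (x := y) hr, h3, hgc, h0, eX]⟩

end BD

/-! ## Differentiation of curves in vector spaces without topology -/

section Curves

variable {W W' : Type} [AddCommGroup W] [Module ℝ W] [AddCommGroup W'] [Module ℝ W']

/-- `G` is the derivative of `F` on the positive half-line, tested with all linear functionals. -/
def HD (F G : ℝ → W) : Prop :=
  ∀ t, 0 < t → ∀ l : W →ₗ[ℝ] ℝ, HasDerivAt (fun s => l (F s)) (l (G t)) t

namespace HD

variable {F G F' G' : ℝ → W}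

lemma add (h : HD F G) (h' : HD F' G') : HD (fun t => F t + F' t) (fun t => G t + G' t) :=
  fun t ht l => by simpa only [map_add] using (h t ht l).fun_add (h' t ht l)

lemma sub (h : HD F G) (h' : HD F' G') : HD (fun t => F t - F' t) (fun t => G t - G' t) :=
  fun t ht l => by simpa only [map_sub] using (h t ht l).fun_sub (h' t ht l)

lemma neg (h : HD F G) : HD (fun t => -F t) (fun t => -G t) :=
  fun t ht l => by simpa only [map_neg] using (h t ht l).fun_neg

lemma const (w : W) : HD (fun _ => w) (fun _ => 0) :=
  fun t _ l => by simpa only [map_zero] using hasDerivAt_const t (l w)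

lemma map (h : HD F G) (L : W →ₗ[ℝ] W') : HD (fun t => L (F t)) (fun t => L (G t)) :=
  fun t ht l => h t ht (l ∘ₗ L)

lemma smul (h : HD F G) {f f' : ℝ → ℝ} (hf : ∀ t, 0 < t → HasDerivAt f (f' t) t) :
    HD (fun t => f t • F t) (fun t => f' t • F t + f t • G t) :=
  fun t ht l => by
    simpa only [map_smul, map_add, smul_eq_mul] using (hf t ht).fun_mul (h t ht l)

lemma const_smul (h : HD F G) (c : ℝ) : HD (fun t => c • F t) (fun t => c • G t) :=
  fun t ht l => by simpa only [map_smul, smul_eq_mul] using (h t ht l).const_mul c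

lemma smul_const {f f' : ℝ → ℝ} (hf : ∀ t, 0 < t → HasDerivAt f (f' t) t) (w : W) :
    HD (fun t => f t • w) (fun t => f' t • w) :=
  fun t ht l => by simpa only [map_smul, smul_eq_mul] using (hf t ht).mul_const (l w)

lemma sum {κ : Type} (s : Finset κ) {F G : κ → ℝ → W} (h : ∀ k ∈ s, HD (F k) (G k)) :
    HD (fun t => ∑ k ∈ s, F k t) (fun t => ∑ k ∈ s, G k t) :=
  fun t ht l => by
    simpa only [map_sum] using HasDerivAt.fun_sum fun k hk => h k hk t ht l

lemma congr_right (h : HD F G) (e : ∀ t, 0 < t → G t = G' t) : HD F G' :=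
  fun t ht l => e t ht ▸ h t ht l

lemma congr_left (h : HD F G) (e : ∀ t, 0 < t → F t = F' t) : HD F' G :=
  fun t ht l => (h t ht l).congr_of_eventuallyEq <| by
    filter_upwards [lt_mem_nhds ht] with s hs
    rw [e s hs]

/-- Linear functionals separate the points of any vector space, so uniqueness reduces to real
functions with zero derivative on a half-line. -/
lemma eq_of_eq {e : ℝ} (he : 0 < e) (h : HD F G) (h' : HD F' G') (hG : ∀ t, 0 < t → G t = G' t)
    (h0 : F e = F' e) (t : ℝ) (ht : 0 < t) : F t = F' t := by
  refine sub_eq_zero.mp ((Module.forall_dual_apply_eq_zero_iff ℝ _).mp fun l => ?_)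
  have hd : ∀ s ∈ Set.Ioi (0 : ℝ), HasDerivAt (fun s => l (F s - F' s)) 0 s := fun s hs => by
    have h1 := (h.sub h') s hs l
    simpa only [hG s hs, sub_self, map_zero] using h1
  have hc := isOpen_Ioi.is_const_of_deriv_eq_zero (isPreconnected_Ioi (a := (0 : ℝ)))
    (fun s hs => (hd s hs).differentiableAt.differentiableWithinAt)
    (fun s hs => (hd s hs).deriv) ht he
  simpa [h0] using hc

end HD

lemma hasDerivAt_inv_pow (n : ℕ) (t : ℝ) (ht : 0 < t) :
    HasDerivAt (fun t : ℝ => 1 / t ^ n) (-(n : ℝ) / t ^ (n + 1)) t := by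
  have h := (hasDerivAt_pow n t).fun_inv (pow_ne_zero n ht.ne')
  have e : -((n : ℝ) * t ^ (n - 1)) / (t ^ n) ^ 2 = -(n : ℝ) / t ^ (n + 1) := by
    cases n with
    | zero => simp
    | succ n =>
      have := ht.ne'
      rw [Nat.add_sub_cancel, div_eq_div_iff (by positivity) (by positivity)]
      ring
  rw [e] at h
  simpa only [one_div] using h

/-! ### Curves and families that are finite sums of scalar coefficients times fixed vectors -/

variable (W) in
/-- Finite sums of products of smooth functions of the parameter and constant vectors. -/
def Sep : Submodule ℝ (ℝ → W) := Submodule.span ℝ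
  {F | ∃ b : ℝ → ℝ, ContDiffOn ℝ ∞ b (Set.Ioi 0) ∧ ∃ w : W, F = fun t => b t • w}

lemma Sep.smul_mem {b : ℝ → ℝ} (hb : ContDiffOn ℝ ∞ b (Set.Ioi 0)) (w : W) :
    (fun t => b t • w) ∈ Sep W := Submodule.subset_span ⟨b, hb, w, rfl⟩

lemma Sep.map {F : ℝ → W} (h : F ∈ Sep W) (L : W →ₗ[ℝ] W') : (fun t => L (F t)) ∈ Sep W' := by
  induction h using Submodule.span_induction with
  | mem F hF =>
    obtain ⟨b, hb, w, rfl⟩ := hF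
    simp only [map_smul]
    exact Sep.smul_mem hb _
  | zero => convert (Sep W').zero_mem using 1; funext t; simp
  | add F G _ _ hF hG => convert (Sep W').add_mem hF hG using 1; funext t; simp
  | smul c F _ hF => convert (Sep W').smul_mem c hF using 1; funext t; simp

/-- A class of coefficient functions, depending on a parameter `i`. -/
structure CC (ι : Type) (e : ℝ) where
  B : Submodule ℝ (ι → ℝ → ℝ)
  smooth : ∀ b ∈ B, ∀ i, ContDiffOn ℝ ∞ (b i) (Set.Ioi 0)
  mul : ∀ b ∈ B, ∀ f : ℝ → ℝ, ContDiffOn ℝ ∞ f (Set.Ioi 0) → (fun i t => f t * b i t) ∈ B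
  prim : ∀ b ∈ B, ∃ b' ∈ B, ∀ i, b' i e = 0 ∧ ∀ t, 0 < t → HasDerivAt (b' i) (b i t) t

variable {ι : Type} {e : ℝ} (C : CC ι e)

variable (W) in
/-- Finite sums of products of coefficient functions and constant vectors. -/
def PF : Submodule ℝ (ι → ℝ → W) := Submodule.span ℝ
  {F | ∃ b ∈ C.B, ∃ w : W, F = fun i t => b i t • w}

namespace PF

variable {C}

lemma smul_mem {b : ι → ℝ → ℝ} (hb : b ∈ C.B) (w : W) : (fun i t => b i t • w) ∈ PF W C :=
  Submodule.subset_span ⟨b, hb, w, rfl⟩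

lemma map {F : ι → ℝ → W} (h : F ∈ PF W C) (L : W →ₗ[ℝ] W') :
    (fun i t => L (F i t)) ∈ PF W' C := by
  induction h using Submodule.span_induction with
  | mem F hF =>
    obtain ⟨b, hb, w, rfl⟩ := hF
    simp only [map_smul]
    exact smul_mem hb _
  | zero => convert (PF W' C).zero_mem using 1; funext i t; simp
  | add F G _ _ hF hG => convert (PF W' C).add_mem hF hG using 1; funext i t; simp
  | smul c F _ hF => convert (PF W' C).smul_mem c hF using 1; funext i t; simp

lemma fsmul {F : ι → ℝ → W} (h : F ∈ PF W C) {f : ℝ → ℝ} (hf : ContDiffOn ℝ ∞ f (Set.Ioi 0)) :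
    (fun i t => f t • F i t) ∈ PF W C := by
  induction h using Submodule.span_induction with
  | mem F hF =>
    obtain ⟨b, hb, w, rfl⟩ := hF
    simp only [smul_smul]
    exact smul_mem (C.mul b hb f hf) _
  | zero => convert (PF W C).zero_mem using 1; funext i t; simp
  | add F G _ _ hF hG => convert (PF W C).add_mem hF hG using 1; funext i t; simp
  | smul c F _ hF => convert (PF W C).smul_mem c hF using 1; funext i t; simp [smul_comm c]

lemma sum_mem {κ : Type} (s : Finset κ) {F : κ → ι → ℝ → W} (h : ∀ k ∈ s, F k ∈ PF W C) :
    (fun i t => ∑ k ∈ s, F k i t) ∈ PF W C := by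
  have := (PF W C).sum_mem h
  convert this using 1
  funext i t
  simp only [Finset.sum_apply]

lemma sep {F : ι → ℝ → W} (h : F ∈ PF W C) (i : ι) : F i ∈ Sep W := by
  induction h using Submodule.span_induction with
  | mem F hF =>
    obtain ⟨b, hb, w, rfl⟩ := hF
    exact Sep.smul_mem (C.smooth b hb i) _
  | zero => exact (Sep W).zero_mem
  | add F G _ _ hF hG => exact (Sep W).add_mem hF hG
  | smul c F _ hF => exact (Sep W).smul_mem c hF

lemma prim0 {F : ι → ℝ → W} (h : F ∈ PF W C) :
    ∃ G ∈ PF W C, ∀ i, G i e = 0 ∧ HD (G i) (F i) := by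
  induction h using Submodule.span_induction with
  | mem F hF =>
    obtain ⟨b, hb, w, rfl⟩ := hF
    obtain ⟨b', hb', h⟩ := C.prim b hb
    exact ⟨_, smul_mem hb' w, fun i => ⟨by simp [(h i).1], HD.smul_const (h i).2 w⟩⟩
  | zero => exact ⟨0, (PF W C).zero_mem, fun i => ⟨rfl, HD.const 0⟩⟩
  | add F F' _ _ hF hF' =>
    obtain ⟨G, hG, h⟩ := hF
    obtain ⟨G', hG', h'⟩ := hF'
    exact ⟨G + G', (PF W C).add_mem hG hG', fun i => ⟨by simp [(h i).1, (h' i).1],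
      (h i).2.add (h' i).2⟩⟩
  | smul c F _ hF =>
    obtain ⟨G, hG, h⟩ := hF
    exact ⟨c • G, (PF W C).smul_mem c hG, fun i => ⟨by simp [(h i).1], (h i).2.const_smul c⟩⟩

/-- Primitives with prescribed initial value. -/
lemma prim {F : ι → ℝ → W} (h : F ∈ PF W C) {lam : ι → ℝ} (hl : (fun i _ => lam i) ∈ C.B) (w : W) :
    ∃ G ∈ PF W C, ∀ i, G i e = lam i • w ∧ HD (G i) (F i) := by
  obtain ⟨G, hG, h'⟩ := prim0 h
  refine ⟨G + fun i _ => lam i • w, (PF W C).add_mem hG (smul_mem hl w), fun i => ⟨?_, ?_⟩⟩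
  · simp [(h' i).1]
  · exact ((h' i).2.add (HD.const (lam i • w))).congr_right fun t _ => add_zero _

/-- Although the fields live in infinite-dimensional spaces, their vanishing at one time is implied
by that of finitely many scalar coefficients. -/
lemma exists_control {F : ι → ℝ → W} (h : F ∈ PF W C) (t : ℝ) :
    ∃ S : Finset (ι → ℝ → ℝ), (∀ b ∈ S, b ∈ C.B) ∧
      ∀ i, (∀ b ∈ S, b i t = 0) → F i t = 0 := by
  classical
  induction h using Submodule.span_induction with
  | mem F hF =>
    obtain ⟨b, hb, w, rfl⟩ := hF
    exact ⟨{b}, by simpa using hb, fun i hi => by simp [hi b (Finset.mem_singleton_self b)]⟩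
  | zero => exact ⟨∅, by simp, fun i _ => rfl⟩
  | add F F' _ _ hF hF' =>
    obtain ⟨S, hS, h⟩ := hF
    obtain ⟨S', hS', h'⟩ := hF'
    refine ⟨S ∪ S', fun b hb => (Finset.mem_union.mp hb).elim (hS b) (hS' b), fun i hi => ?_⟩
    simp [h i fun b hb => hi b (Finset.mem_union_left _ hb),
      h' i fun b hb => hi b (Finset.mem_union_right _ hb)]
  | smul c F _ hF =>
    obtain ⟨S, hS, h⟩ := hF
    exact ⟨S, hS, fun i hi => by simp [h i hi]⟩

/-- Stands in for linearity in the parameter, the index type `ι` having no algebraic structure: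
additivity of the coefficients for the one triple is inherited by all fields. -/
lemma apply_eq_add {i j k : ι} (hC : ∀ b ∈ C.B, b k = b i + b j) {F : ι → ℝ → W}
    (h : F ∈ PF W C) : F k = F i + F j := by
  induction h using Submodule.span_induction with
  | mem F hF =>
    obtain ⟨b, hb, w, rfl⟩ := hF
    funext t
    simp [hC b hb, add_smul]
  | zero => simp
  | add F F' _ _ hF hF' =>
    simp only [Pi.add_apply, hF, hF']
    abel
  | smul c F _ hF => simp only [Pi.smul_apply, hF, smul_add]

end PF

end Curves

/-! ## The coefficient class used for the gluing -/

/-- Smooth functions on the real line. -/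
def CSsub : Submodule ℝ (ℝ → ℝ) where
  carrier := {c | ContDiff ℝ ∞ c}
  add_mem' h h' := ContDiff.add (𝕜 := ℝ) (n := ∞) h h'
  zero_mem' := contDiff_const (𝕜 := ℝ) (n := ∞) (c := (0 : ℝ))
  smul_mem' c _ h := ContDiff.smul (𝕜 := ℝ) (n := ∞) (contDiff_const (c := c)) h

abbrev CS : Type := CSsub

lemma CS.contDiff (c : CS) : ContDiff ℝ ∞ c.1 := c.2

/-- A scalar and `N` smooth functions. -/
abbrev Par (N : ℕ) : Type := ℝ × (Fin N → CS)

/-- A bound for the parameters on the interval between `e` and `e'`. -/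
def ParBound {N : ℕ} (e e' : ℝ) (i : Par N) (M : ℝ) : Prop :=
  |i.1| ≤ M ∧ ∀ k, ∀ t ∈ Set.uIcc e e', |(i.2 k).1 t| ≤ M

/-- The first parameter homogenises the problem: it multiplies the inhomogeneous data, so the affine
dependence on the curves becomes linear and `(1, c) = (1, 0) + (0, c)`. The bound uses only the sup
norm of the parameter curves, a property preserved by primitives; this is what lets corrections of
small sup norm but fixed jet act negligibly. -/
def gluB (N : ℕ) (e e' : ℝ) : Submodule ℝ (Par N → ℝ → ℝ) where
  carrier := {b | IsLinearMap ℝ b ∧ (∀ i, ContDiffOn ℝ ∞ (b i) (Set.Ioi 0)) ∧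
    ∃ K, 0 ≤ K ∧ ∀ i M, ParBound e e' i M → ∀ t ∈ Set.uIcc e e', |b i t| ≤ K * M}
  add_mem' := by
    rintro b b' ⟨h1, h2, K, hK, h3⟩ ⟨h1', h2', K', hK', h3'⟩
    refine ⟨⟨fun i j => ?_, fun c i => ?_⟩, fun i => (h2 i).add (h2' i), K + K', by positivity,
      fun i M hM t ht => ?_⟩
    · simp only [Pi.add_apply, h1.map_add, h1'.map_add]
      abel
    · simp only [Pi.add_apply, h1.map_smul, h1'.map_smul, smul_add]
    · refine (abs_add_le _ _).trans ?_
      have := h3 i M hM t ht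
      have := h3' i M hM t ht
      linarith
  zero_mem' := ⟨⟨fun _ _ => by simp, fun _ _ => by simp⟩, fun _ => contDiffOn_const, 0, le_rfl,
    fun _ _ _ _ _ => by simp⟩
  smul_mem' := by
    rintro c b ⟨h1, h2, K, hK, h3⟩
    refine ⟨⟨fun i j => ?_, fun c i => ?_⟩, fun i => ContDiffOn.smul (contDiffOn_const (c := c)) (h2 i), |c| * K,
      by positivity, fun i M hM t ht => ?_⟩
    · simp only [Pi.smul_apply, h1.map_add, smul_add]
    · simp only [Pi.smul_apply, h1.map_smul, smul_comm c]
    · simp only [Pi.smul_apply, smul_eq_mul, abs_mul, mul_assoc]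
      exact mul_le_mul_of_nonneg_left (h3 i M hM t ht) (abs_nonneg _)

lemma uIcc_subset_Ioi {e t : ℝ} (he : 0 < e) (ht : 0 < t) : Set.uIcc e t ⊆ Set.Ioi 0 :=
  Set.ordConnected_Ioi.uIcc_subset he ht

lemma ParBound.nonneg {N : ℕ} {e e' : ℝ} {i : Par N} {M : ℝ} (h : ParBound e e' i M) : 0 ≤ M :=
  (abs_nonneg _).trans h.1

def gluCC (N : ℕ) {e e' : ℝ} (he : 0 < e) (he' : 0 < e') : CC (Par N) e where
  B := gluB N e e'
  smooth b hb := hb.2.1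
  mul := by
    rintro b ⟨h1, h2, K, hK, h3⟩ f hf
    obtain ⟨L, hL⟩ := (isCompact_uIcc (a := e) (b := e')).exists_bound_of_continuousOn
      (hf.continuousOn.mono (uIcc_subset_Ioi he he'))
    have hL0 : 0 ≤ L := (norm_nonneg _).trans (hL e Set.left_mem_uIcc)
    refine ⟨⟨fun i j => ?_, fun c i => ?_⟩, fun i => hf.mul (h2 i), L * K, by positivity,
      fun i M hM t ht => ?_⟩
    · funext t
      simp only [h1.map_add, Pi.add_apply, mul_add]
    · funext t
      simp only [h1.map_smul, Pi.smul_apply, smul_eq_mul]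
      ring
    · rw [abs_mul, mul_assoc]
      exact mul_le_mul (hL t ht) (h3 i M hM t ht) (abs_nonneg _) hL0
  prim := by
    rintro b ⟨h1, h2, K, hK, h3⟩
    have hint : ∀ i t, 0 < t → IntervalIntegrable (b i) volume e t := fun i t ht =>
      ((h2 i).continuousOn.mono (uIcc_subset_Ioi he ht)).intervalIntegrable
    -- The primitive is cut off to `0` for `t ≤ 0`: the coefficients are regular only on the
    -- positive half-line, and additivity of the integral in the parameter needs integrability.
    have hd : ∀ i t, 0 < t →
        HasDerivAt (fun t => if 0 < t then ∫ s in e..t, b i s else 0) (b i t) t := by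
      intro i t ht
      have h := intervalIntegral.integral_hasDerivAt_right (hint i t ht)
        ((h2 i).continuousOn.stronglyMeasurableAtFilter isOpen_Ioi t ht)
        ((h2 i).continuousOn.continuousAt (isOpen_Ioi.mem_nhds ht))
      refine h.congr_of_eventuallyEq ?_
      filter_upwards [lt_mem_nhds ht] with s hs
      simp [hs]
    refine ⟨fun i t => if 0 < t then ∫ s in e..t, b i s else 0,
      ⟨⟨fun i j => ?_, fun c i => ?_⟩, fun i => ?_, K * |e' - e|, by positivity,
      fun i M hM t ht => ?_⟩, fun i => ⟨by simp [he], hd i⟩⟩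
    · funext t
      simp only [Pi.add_apply, h1.map_add]
      split_ifs with ht
      · exact intervalIntegral.integral_add (hint i t ht) (hint j t ht)
      · simp
    · funext t
      simp only [Pi.smul_apply, h1.map_smul]
      split_ifs with ht
      · exact intervalIntegral.integral_smul _ _
      · simp
    · refine (contDiffOn_infty_iff_deriv_of_isOpen isOpen_Ioi).mpr
        ⟨fun t ht => (hd i t ht).differentiableAt.differentiableWithinAt, ?_⟩
      exact (h2 i).congr fun t ht => (hd i t ht).deriv
    · have ht0 : 0 < t := uIcc_subset_Ioi he he' ht
      simp only [ht0, if_true]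
      have h4 := intervalIntegral.norm_integral_le_of_norm_le_const (a := e) (b := t)
        (f := b i) (C := K * M) fun s hs =>
        h3 i M hM s (Set.uIcc_subset_uIcc_left ht (Set.uIoc_subset_uIcc hs))
      refine h4.trans ?_
      have h5 : |t - e| ≤ |e' - e| := Set.abs_sub_left_of_mem_uIcc ht
      have := hM.nonneg
      nlinarith [mul_nonneg hK this]

lemma gluB_fst (N : ℕ) (e e' : ℝ) : (fun (i : Par N) _ => i.1) ∈ gluB N e e' :=
  ⟨⟨fun _ _ => rfl, fun _ _ => rfl⟩, fun _ => contDiffOn_const, 1, zero_le_one,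
    fun i M hM t _ => by simpa using hM.1⟩

lemma gluB_snd {N : ℕ} (e e' : ℝ) (k : Fin N) : (fun (i : Par N) t => (i.2 k).1 t) ∈ gluB N e e' :=
  ⟨⟨fun _ _ => rfl, fun _ _ => rfl⟩, fun i => (CS.contDiff (i.2 k)).contDiffOn, 1, zero_le_one,
    fun i M hM t ht => by simpa using hM.2 k t ht⟩

lemma gluB_fst_mul (N : ℕ) (e e' : ℝ) (he : 0 < e) (he' : 0 < e') {f : ℝ → ℝ}
    (hf : ContDiff ℝ ∞ f) : (fun (i : Par N) t => f t * i.1) ∈ gluB N e e' :=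
  (gluCC N he he').mul _ (gluB_fst N e e') f hf.contDiffOn

/-- Smooth functions with prescribed Taylor polynomials at `e'`, vanishing near `e`, that are
annihilated by given functionals. -/
lemma exists_parameters (N : ℕ) {e e' : ℝ} (hne : e ≠ e') (S : Finset (Par N → ℝ → ℝ))
    (hS : ∀ b ∈ S, b ∈ gluB N e e') :
    ∃ c : Fin N → CS, (∀ b ∈ S, b (0, c) e' = 0) ∧ ∀ k : Fin N,
      ((c k).1 =ᶠ[nhds e] fun _ => 0) ∧
      ((c k).1 =ᶠ[nhds e'] fun t => (t - e') ^ ((k : ℕ) + 1) / ((k : ℕ) + 1).factorial) := by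
  have hlin : ∀ b : S, IsLinearMap ℝ b.1 := fun b => (hS b.1 b.2).1
  let L : (Fin N → CS) →ₗ[ℝ] (S → ℝ) :=
    { toFun := fun c b => b.1 (0, c) e'
      map_add' := fun c d => by
        funext b
        have := congrFun ((hlin b).map_add (0, c) (0, d)) e'
        simpa using this
      map_smul' := fun a c => by
        funext b
        have := congrFun ((hlin b).map_smul a (0, c)) e'
        simpa using this }
  let V : Submodule ℝ (Fin N → CS) :=
    { carrier := {c | ∀ k, ((c k).1 =ᶠ[nhds e] 0) ∧ ((c k).1 =ᶠ[nhds e'] 0)}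
      add_mem' := fun {c d} hc hd k =>
        ⟨by simpa using (hc k).1.add (hd k).1, by simpa using (hc k).2.add (hd k).2⟩
      zero_mem' := fun k => ⟨Filter.EventuallyEq.rfl, Filter.EventuallyEq.rfl⟩
      smul_mem' := fun a c hc k =>
        ⟨by simpa using (hc k).1.const_smul a, by simpa using (hc k).2.const_smul a⟩ }
  let χ : ℕ → ContDiffBump e' := fun n => ⟨eps n / 2, eps n, half_pos (eps_pos n),
    half_lt_self (eps_pos n)⟩
  -- Monomials cut off at scale `eps n`. The jet at `e'` does not depend on `n`, while the sup norm
  -- is at most `eps n`, because the exponents are at least one.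
  let c : ℕ → Fin N → CS := fun n k =>
    ⟨fun t => (t - e') ^ ((k : ℕ) + 1) / ((k : ℕ) + 1).factorial * χ n t,
      ContDiff.mul (𝕜 := ℝ) (n := ∞) (((contDiff_id.sub contDiff_const).pow _).div_const _)
        (χ n).contDiff⟩
  have hc1 : ∀ n k, (c n k).1 =ᶠ[nhds e'] fun t =>
      (t - e') ^ ((k : ℕ) + 1) / ((k : ℕ) + 1).factorial := fun n k => by
    filter_upwards [(χ n).eventuallyEq_one] with t ht
    simp [c, ht]
  have hc0 : ∀ n k, eps n < dist e e' → (c n k).1 =ᶠ[nhds e] 0 := fun n k hn => by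
    have hU : {t | eps n < dist t e'} ∈ nhds e :=
      (isOpen_lt continuous_const (continuous_id.dist continuous_const)).mem_nhds hn
    filter_upwards [hU] with t ht
    have : χ n t = 0 := (χ n).zero_of_le_dist ht.le
    simp [c, this]
  have hbd : ∀ n, ParBound e e' ((0, c n) : Par N) (eps n) := fun n => by
    refine ⟨by simpa using (eps_pos n).le, fun k t _ => ?_⟩
    simp only [c]
    have hε := eps_pos n
    by_cases ht : dist t e' < eps n
    · rw [Real.dist_eq] at ht
      have h1 : |t - e'| ^ ((k : ℕ) + 1) ≤ eps n := by
        rw [pow_succ]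
        have : |t - e'| ^ (k : ℕ) ≤ 1 :=
          pow_le_one₀ (abs_nonneg _) (ht.le.trans (eps_le_one n))
        nlinarith [abs_nonneg (t - e')]
      have h2 : (1 : ℝ) ≤ ((k : ℕ) + 1).factorial := by exact_mod_cast Nat.factorial_pos _
      rw [abs_mul, abs_div, abs_pow, abs_of_nonneg (χ n).nonneg, Nat.abs_cast]
      calc |t - e'| ^ ((k : ℕ) + 1) / ((k : ℕ) + 1).factorial * χ n t
          ≤ |t - e'| ^ ((k : ℕ) + 1) * 1 :=
            mul_le_mul (div_le_self (by positivity) h2) (χ n).le_one (χ n).nonneg (by positivity)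
        _ ≤ eps n := by rwa [mul_one]
    · have : χ n t = 0 := (χ n).zero_of_le_dist (not_lt.mp ht)
      simp [this, hε.le]
  have hlim : Filter.Tendsto (fun n => L (c n)) Filter.atTop (nhds 0) := by
    refine tendsto_pi_nhds.mpr fun b => ?_
    obtain ⟨-, -, K, -, hK⟩ := hS b.1 b.2
    refine squeeze_zero_norm (a := fun n => K * eps n)
      (fun n => hK _ _ (hbd n) e' Set.right_mem_uIcc) ?_
    simpa using tendsto_eps.const_mul K
  obtain ⟨n0, hn0⟩ := Filter.eventually_atTop.mp
    (tendsto_eps.eventually_lt_const (dist_pos.mpr hne))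
  -- Differences of two cut-offs vanish near both ends, so `L (c n0) - L (c n)` lies in the image of
  -- `V` and tends to `L (c n0)`. The image is closed, being a subspace of a finite-dimensional
  -- space; subtracting a suitable element of `V` then kills all functionals without changing a jet.
  have hmem : L (c n0) ∈ V.map L := by
    refine (Submodule.closed_of_finiteDimensional (V.map L)).mem_of_tendsto
      (f := fun n => L (c n0) - L (c n)) (b := Filter.atTop) ?_ ?_
    · simpa using hlim.const_sub (L (c n0))
    · filter_upwards [Filter.eventually_ge_atTop n0] with n hn
      refine ⟨c n0 - c n, fun k => ⟨?_, ?_⟩, map_sub _ _ _⟩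
      · simpa using (hc0 n0 k (hn0 n0 le_rfl)).sub (hc0 n k (hn0 n hn))
      · filter_upwards [hc1 n0 k, hc1 n k] with t h1 h2
        simp only [Pi.sub_apply, Submodule.coe_sub, h1, h2, sub_self, Pi.zero_apply]
  obtain ⟨v, hv, hLv⟩ := hmem
  refine ⟨c n0 - v, fun b hb => ?_, fun k => ⟨?_, ?_⟩⟩
  · have : L (c n0 - v) ⟨b, hb⟩ = 0 := by rw [map_sub, hLv, sub_self]; rfl
    exact this
  · filter_upwards [hc0 n0 k (hn0 n0 le_rfl), (hv k).1] with t h1 h2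
    simp only [Pi.sub_apply, Submodule.coe_sub, h1, h2, sub_self, Pi.zero_apply]
  · filter_upwards [hc1 n0 k, (hv k).2] with t h1 h2
    simp only [Pi.sub_apply, Submodule.coe_sub, h1, h2, sub_zero, Pi.zero_apply]

/-! ## Solutions of the outgoing equations from free data -/

lemma contDiffOn_div_pow (c : ℝ) (n : ℕ) : ContDiffOn ℝ ∞ (fun t : ℝ => c / t ^ n) (Set.Ioi 0) :=
  contDiffOn_const.div (contDiffOn_id.pow n) fun _ ht => pow_ne_zero n (ne_of_gt ht)

lemma contDiffOn_dInv (i : ℕ) : ContDiffOn ℝ ∞ (fun t : ℝ => dInv 1 t i) (Set.Ioi 0) :=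
  contDiffOn_div_pow _ _

lemma contDiffOn_dInvSq (i : ℕ) : ContDiffOn ℝ ∞ (fun t : ℝ => dInvSq 1 t i) (Set.Ioi 0) :=
  contDiffOn_div_pow _ _

/-- The terms of lower order in the equation for the derivatives of `α̲ / r`. -/
def lowB (t : ℝ) (b : VF) (ρ : SF) (a : ℕ → TF) (k : ℕ) : TF :=
  (∑ i : Fin k, ((k.choose (i + 1) : ℝ) * dInv 1 t (i + 1)) • a (k - (i + 1)))
    + (2 : ℝ) • D2B (curvJetB 1 t b ρ a k).1

/-- Only the term `i = 0` contains the unknown of order `k`. Isolating it exhibits `1/t` as an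
integrating factor and makes the hierarchy triangular. -/
lemma sum_alb_eq (t : ℝ) (b : VF) (ρ : SF) (a : ℕ → TF) (k : ℕ) :
    (∑ i : Fin (k + 1), ((k.choose i : ℝ) * dInv 1 t i) • a (k - i))
      + (2 : ℝ) • D2B (curvJetB 1 t b ρ a k).1 = (1 / t) • a k + lowB t b ρ a k := by
  rw [Fin.sum_univ_succ, lowB, add_assoc]
  simp [dInv]

lemma lowB_congr {t : ℝ} {b : VF} {ρ : SF} {a a' : ℕ → TF} {k : ℕ} (h : ∀ j < k, a j = a' j) :
    lowB t b ρ a k = lowB t b ρ a' k := by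
  rw [lowB, lowB, curvJetB_congr h]
  congr 1
  exact Finset.sum_congr rfl fun i _ => by rw [h _ (by omega)]

/-- The transport equations on an outgoing cone (parametrised by the radius), for given `Ω` and
`χ̂`, with the initial values of `p` at `r = e`. -/
structure Fl (m : ℕ) (e : ℝ) (p : BD) (Z : ℝ → BD) : Prop where
  phi : HD (fun t => (Z t).phi) (fun t => (2 : ℝ) • (Z t).Om + p.Q1 e)
  gc : HD (fun t => (Z t).gc) (fun t => (2 / t ^ 2) • (Z t).chih)
  q0 : HD (fun t => (Z t).q0 t) (fun t => dvTB (Z t).chih)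
  Q1 : ∀ t, 0 < t → (Z t).Q1 t = p.Q1 e
  Q2 : ∀ t, 0 < t → (Z t).Q2 t = p.Q2 e
  Q3 : ∀ t, 0 < t → (Z t).Q3 t = p.Q3 e
  alb : ∀ k, k ≤ m → HD (fun t => (Z t).alb k) (fun t => (1 / t) • (Z t).alb k +
    lowB t ((Z t).betab t) ((Z t).rho t) (Z t).alb k)
  omb : ∀ k, k ≤ m + 1 → HD (fun t => (Z t).omb k)
    (fun t => -(curvJetB 1 t ((Z t).betab t) ((Z t).rho t) (Z t).alb k).2)
  phi_e : (Z e).phi = p.phi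
  gc_e : (Z e).gc = p.gc
  q0_e : (Z e).q0 e = p.q0 e
  alb_e : ∀ k, k ≤ m → (Z e).alb k = p.alb k
  omb_e : ∀ k, k ≤ m + 1 → (Z e).omb k = p.omb k

lemma hasDerivAt_one_div (t : ℝ) (ht : 0 < t) : HasDerivAt (fun t : ℝ => 1 / t) (-1 / t ^ 2) t := by
  have h := hasDerivAt_inv_pow 1 t ht
  simpa using h

/-- The basic fields of two data sets agree. -/
structure SameFields (m : ℕ) (x y : BD) : Prop where
  phi : x.phi = y.phi
  gc : x.gc = y.gc
  trX : x.trX = y.trX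
  eta : x.eta = y.eta
  trXb : x.trXb = y.trXb
  chibh : x.chibh = y.chibh
  alb : ∀ k, k ≤ m → x.alb k = y.alb k
  omb : ∀ k, k ≤ m + 1 → x.omb k = y.omb k

namespace Fl

variable {m : ℕ} {e : ℝ} {p : BD} {Z Z' : ℝ → BD}

/-- The fields `φ`, `g_c`, `q₀` are quadratures of the free data, and the charges determine the
other basic fields. The transversal derivatives then follow by induction on the order. -/
lemma unique (he : 0 < e) (h : Fl m e p Z) (h' : Fl m e p Z')
    (hOm : ∀ t, 0 < t → (Z t).Om = (Z' t).Om) (hchih : ∀ t, 0 < t → (Z t).chih = (Z' t).chih)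
    (t : ℝ) (ht : 0 < t) : SameFields m (Z t) (Z' t) := by
  have e1 := h.phi.eq_of_eq he h'.phi (fun t ht => by rw [hOm t ht]) (h.phi_e.trans h'.phi_e.symm)
  have e2 := h.gc.eq_of_eq he h'.gc (fun t ht => by rw [hchih t ht]) (h.gc_e.trans h'.gc_e.symm)
  have e3 := h.q0.eq_of_eq he h'.q0 (fun t ht => by rw [hchih t ht]) (h.q0_e.trans h'.q0_e.symm)
  have e4 : ∀ t : ℝ, 0 < t → _ := fun t ht => BD.eq_of_charges ht.ne' (hOm t ht) (e1 t ht) (e2 t ht)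
    (e3 t ht) ((h.Q1 t ht).trans (h'.Q1 t ht).symm) ((h.Q2 t ht).trans (h'.Q2 t ht).symm)
    ((h.Q3 t ht).trans (h'.Q3 t ht).symm)
  have eb : ∀ t, 0 < t → (Z t).betab t = (Z' t).betab t := fun t ht => by
    obtain ⟨-, h2, h3, h4⟩ := e4 t ht
    rw [BD.betab, BD.betab, h2, h3, h4]
  have er : ∀ t, 0 < t → (Z t).rho t = (Z' t).rho t := fun t ht => by
    obtain ⟨h1, -, h3, -⟩ := e4 t ht
    rw [BD.rho, BD.rho, BD.K, BD.K, h1, h3, hOm t ht, e1 t ht, e2 t ht]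
  have ea : ∀ k, k ≤ m → ∀ t, 0 < t → (Z t).alb k = (Z' t).alb k := by
    intro k
    induction k using Nat.strong_induction_on with
    | _ k ih =>
      intro hk
      -- Division by `t` removes the linear term, so that the derivative involves only orders below
      -- `k`.
      have hg : ∀ {Z : ℝ → BD}, Fl m e p Z → HD (fun t => (1 / t) • (Z t).alb k)
          (fun t => (1 / t) • lowB t ((Z t).betab t) ((Z t).rho t) (Z t).alb k) := fun {Z} hZ =>
        ((hZ.alb k hk).smul hasDerivAt_one_div).congr_right fun t ht => by
          match_scalars <;> field_simp
          ring
      have hq := (hg h).eq_of_eq he (hg h') (fun t ht => by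
        rw [eb t ht, er t ht, lowB_congr fun j hj => ih j hj (by omega) t ht])
        (by rw [h.alb_e k hk, h'.alb_e k hk])
      intro t ht
      have := congrArg (fun w => t • w) (hq t ht)
      simpa only [smul_smul, mul_one_div, div_self ht.ne', one_smul] using this
  have eo : ∀ k, k ≤ m + 1 → ∀ t, 0 < t → (Z t).omb k = (Z' t).omb k := fun k hk =>
    (h.omb k hk).eq_of_eq he (h'.omb k hk) (fun t ht => by
      rw [eb t ht, er t ht, curvJetB_congr fun j hj => ea j (by omega) t ht])
      ((h.omb_e k hk).trans (h'.omb_e k hk).symm)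
  obtain ⟨h1, h2, h3, h4⟩ := e4 t ht
  exact ⟨e1 t ht, e2 t ht, h1, h2, h3, h4, fun k hk => ea k hk t ht, fun k hk => eo k hk t ht⟩

end Fl

/-- Reconstruction of the data from the charges and the basic fields. -/
def recon (t : ℝ) (q1 q2 : SF) (q3 : TF) (Om phi : SF) (gc : TF) (q0 : VF) (chih : TF)
    (om omb : ℕ → SF) (al alb : ℕ → TF) : BD where
  Om := Om
  phi := phi
  gc := gc
  chih := chih
  trX := (4 / t) • Om + (2 / t) • q1 - (2 / t ^ 2) • phi
  eta := (1 / t ^ 2) • q0 - gradB q1 + (1 / t) • gradB phi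
  trXb := (1 / t ^ 2) • q2 + (2 / t ^ 3) • dvB q0 + (2 / t) • q1
    - (1 / t) • dvB (dvTB gc) + (2 / t ^ 2) • lapB phi + (2 / t ^ 2) • phi
  chibh := t • q3 + (t / 2) • (D2B (dvTB gc) + gc) - (1 / t) • D2B q0
    + (2 * t) • D2B (gradB q1) - (2 : ℝ) • D2B (gradB phi)
  om := om
  omb := omb
  al := al
  alb := alb

section Recon

variable (t : ℝ) (ht : t ≠ 0) (q1 q2 : SF) (q3 : TF) (Om phi : SF) (gc : TF) (q0 : VF) (chih : TF)
  (om omb : ℕ → SF) (al alb : ℕ → TF)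
include ht

lemma recon_X' : (recon t q1 q2 q3 Om phi gc q0 chih om omb al alb).X' t =
    (2 / t) • q1 - (2 / t ^ 2) • phi := by
  rw [BD.X', recon]
  match_scalars <;> field_simp
  ring

lemma recon_q0 : (recon t q1 q2 q3 Om phi gc q0 chih om omb al alb).q0 t = q0 := by
  rw [BD.q0, recon_X' t ht, recon]
  simp only [map_sub, map_smul]
  match_scalars <;> field_simp <;> ring

lemma recon_Q1 : (recon t q1 q2 q3 Om phi gc q0 chih om omb al alb).Q1 t = q1 := by
  rw [BD.Q1, recon_X' t ht, recon]
  match_scalars <;> field_simp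
  ring

lemma recon_Q2 : (recon t q1 q2 q3 Om phi gc q0 chih om omb al alb).Q2 t = q2 := by
  rw [BD.Q2, ← BD.q0, recon_q0 t ht, recon_X' t ht, BD.K, recon]
  match_scalars <;> field_simp <;> ring

lemma recon_Q3 : (recon t q1 q2 q3 Om phi gc q0 chih om omb al alb).Q3 t = q3 := by
  rw [BD.Q3, recon_X' t ht, recon]
  simp only [map_add, map_sub, map_smul]
  match_scalars <;> field_simp <;> ring

end Recon

section Existence

variable {ι : Type} {e : ℝ} {C : CC ι e}

lemma curvJetB_mem {b : ι → ℝ → VF} {ρ : ι → ℝ → SF} {a : ℕ → ι → ℝ → TF} (hb : b ∈ PF VF C)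
    (hρ : ρ ∈ PF SF C) (ha : ∀ k, a k ∈ PF TF C) (k : ℕ) :
    (fun i t => (curvJetB 1 t (b i t) (ρ i t) (fun j => a j i t) k).1) ∈ PF VF C ∧
    (fun i t => (curvJetB 1 t (b i t) (ρ i t) (fun j => a j i t) k).2) ∈ PF SF C := by
  induction k using Nat.strong_induction_on with
  | _ k ih =>
    cases k with
    | zero =>
      simp only [curvJetB]
      exact ⟨hb, hρ⟩
    | succ k =>
      simp only [curvJetB]
      constructor
      · refine PF.sum_mem _ fun j _ => PF.fsmul (F := fun i t => _) ?_ contDiffOn_const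
        exact (PF VF C).sub_mem (PF.fsmul (ih _ (by omega)).1
          (contDiffOn_const.mul (contDiffOn_dInv _)))
          (PF.fsmul (PF.map (ha _) dvTB) (contDiffOn_dInvSq _))
      · refine PF.sum_mem _ fun j _ => PF.fsmul (F := fun i t => _) ?_ contDiffOn_const
        exact (PF SF C).sub_mem (PF.fsmul (ih _ (by omega)).2
          (contDiffOn_const.mul (contDiffOn_dInv _)))
          (PF.fsmul (PF.map (ih _ (by omega)).1 dvB) (contDiffOn_dInvSq _))

lemma lowB_mem {b : ι → ℝ → VF} {ρ : ι → ℝ → SF} {a : ℕ → ι → ℝ → TF} (hb : b ∈ PF VF C)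
    (hρ : ρ ∈ PF SF C) (ha : ∀ k, a k ∈ PF TF C) (k : ℕ) :
    (fun i t => lowB t (b i t) (ρ i t) (fun j => a j i t) k) ∈ PF TF C := by
  simp only [lowB]
  refine (PF TF C).add_mem (PF.sum_mem _ fun j _ => PF.fsmul (ha _)
    (contDiffOn_const.mul (contDiffOn_dInv _))) ?_
  exact PF.fsmul (f := fun _ => 2) (PF.map (curvJetB_mem hb hρ ha k).1 D2B) contDiffOn_const

lemma exists_alb (he : 0 < e) {lam : ι → ℝ} (hl : (fun i _ => lam i) ∈ C.B) {b : ι → ℝ → VF}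
    {ρ : ι → ℝ → SF} (hb : b ∈ PF VF C) (hρ : ρ ∈ PF SF C) (p : ℕ → TF) (n : ℕ) :
    ∃ a : ℕ → ι → ℝ → TF, (∀ k, a k ∈ PF TF C) ∧ ∀ k < n, ∀ i, a k i e = lam i • p k ∧
      HD (a k i) (fun t => (1 / t) • a k i t + lowB t (b i t) (ρ i t) (fun j => a j i t) k) := by
  induction n with
  | zero => exact ⟨fun _ => 0, fun _ => (PF TF C).zero_mem, fun k hk => by omega⟩
  | succ n ih =>
    obtain ⟨a, ha, h⟩ := ih
    obtain ⟨G, hG, hG'⟩ := PF.prim (PF.fsmul (lowB_mem hb hρ ha n) (contDiffOn_div_pow 1 1)) hl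
      ((1 / e) • p n)
    -- `G` solves the equation for the quotient by `t`; this is why its initial value carries the
    -- factor `1/e`.
    refine ⟨Function.update a n fun i t => t • G i t, fun k => ?_, fun k hk i => ?_⟩
    · rcases eq_or_ne k n with rfl | hk
      · rw [Function.update_self]
        exact PF.fsmul hG contDiffOn_id
      · rw [Function.update_of_ne hk]
        exact ha k
    · have hlow : ∀ t, k ≤ n → lowB t (b i t) (ρ i t)
          (fun j => Function.update a n (fun i t => t • G i t) j i t) k =
          lowB t (b i t) (ρ i t) (fun j => a j i t) k := fun t hk => lowB_congr fun j hj => by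
        rw [Function.update_of_ne (by omega)]
      simp only [hlow _ (Nat.lt_succ_iff.mp hk)]
      rcases eq_or_ne k n with rfl | hkn
      · rw [Function.update_self]
        refine ⟨?_, ((hG' i).2.smul fun t _ => hasDerivAt_id' t).congr_right fun t ht => ?_⟩
        · rw [(hG' i).1]
          match_scalars
          field_simp
        · match_scalars <;> field_simp
      · rw [Function.update_of_ne hkn]
        exact h k (by omega) i

lemma exists_omb {lam : ι → ℝ} (hl : (fun i _ => lam i) ∈ C.B) {b : ι → ℝ → VF}
    {ρ : ι → ℝ → SF} (hb : b ∈ PF VF C) (hρ : ρ ∈ PF SF C) {a : ℕ → ι → ℝ → TF}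
    (ha : ∀ k, a k ∈ PF TF C) (p : ℕ → SF) :
    ∃ o : ℕ → ι → ℝ → SF, (∀ k, o k ∈ PF SF C) ∧ ∀ k i, o k i e = lam i • p k ∧
      HD (o k i) (fun t => -(curvJetB 1 t (b i t) (ρ i t) (fun j => a j i t) k).2) := by
  choose o ho h using fun k => PF.prim ((PF SF C).neg_mem (curvJetB_mem hb hρ ha k).2) hl (p k)
  exact ⟨o, ho, h⟩

/-- Membership of all the reconstructed fields in the class of families. -/
structure Fam (C : CC ι e) (Z : ι → ℝ → BD) : Prop where
  phi : (fun i t => (Z i t).phi) ∈ PF SF C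
  gc : (fun i t => (Z i t).gc) ∈ PF TF C
  trX : (fun i t => (Z i t).trX) ∈ PF SF C
  eta : (fun i t => (Z i t).eta) ∈ PF VF C
  trXb : (fun i t => (Z i t).trXb) ∈ PF SF C
  chibh : (fun i t => (Z i t).chibh) ∈ PF TF C
  omb : ∀ k, (fun i t => (Z i t).omb k) ∈ PF SF C
  alb : ∀ k, (fun i t => (Z i t).alb k) ∈ PF TF C

/-- All initial values and charges are weighted by `lam`, which keeps the dependence on the
parameters linear. Only the members with `lam i = 1` are solutions with data `p`; the others serve
to split a solution into a reference solution and a correction. -/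
theorem exists_family (m : ℕ) (he : 0 < e) {lam : ι → ℝ} (hl : (fun i _ => lam i) ∈ C.B) (p : BD)
    {Om : ι → ℝ → SF} {chih : ι → ℝ → TF} (hOm : Om ∈ PF SF C) (hchih : chih ∈ PF TF C)
    (om : ι → ℝ → ℕ → SF) (al : ι → ℝ → ℕ → TF) :
    ∃ Z : ι → ℝ → BD, (∀ i t, (Z i t).Om = Om i t ∧ (Z i t).chih = chih i t ∧
      (Z i t).om = om i t ∧ (Z i t).al = al i t) ∧ Fam C Z ∧
      ∀ i, lam i = 1 → Fl m e p (Z i) := by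
  have hq : ∀ {W : Type} [AddCommGroup W] [Module ℝ W] (w : W),
      (fun i (_ : ℝ) => lam i • w) ∈ PF W C := fun w => PF.smul_mem hl w
  have hc : ∀ c : ℝ, ContDiffOn ℝ ∞ (fun _ : ℝ => c) (Set.Ioi 0) := fun c => contDiffOn_const
  obtain ⟨phi, hphi, hphi'⟩ := PF.prim ((PF SF C).add_mem (PF.fsmul hOm (hc 2)) (hq (p.Q1 e)))
    hl p.phi
  obtain ⟨gc, hgc, hgc'⟩ := PF.prim (PF.fsmul hchih (contDiffOn_div_pow 2 2)) hl p.gc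
  obtain ⟨q0, hq0, hq0'⟩ := PF.prim (PF.map hchih dvTB) hl (p.q0 e)
  have hp1 : ∀ c : ℝ, ContDiffOn ℝ ∞ (fun t : ℝ => c / t) (Set.Ioi 0) := fun c => by
    simpa using contDiffOn_div_pow c 1
  have hid : ∀ c : ℝ, ContDiffOn ℝ ∞ (fun t : ℝ => c * t) (Set.Ioi 0) := fun c =>
    contDiffOn_const.mul contDiffOn_id
  have hid' : ContDiffOn ℝ ∞ (fun t : ℝ => t / 2) (Set.Ioi 0) := contDiffOn_id.div_const 2
  -- `β̲` and `ρ` do not involve `ω̲` and `α̲`, so the basic fields can be assembled with zeros in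
  -- these slots before the transversal hierarchy is solved.
  let R (omb : ℕ → ι → ℝ → SF) (alb : ℕ → ι → ℝ → TF) (i : ι) (t : ℝ) : BD :=
    recon t (lam i • p.Q1 e) (lam i • p.Q2 e) (lam i • p.Q3 e) (Om i t) (phi i t) (gc i t) (q0 i t)
      (chih i t) (om i t) (fun k => omb k i t) (al i t) (fun k => alb k i t)
  have htrX : (fun i t => (R 0 0 i t).trX) ∈ PF SF C :=
    (PF SF C).sub_mem ((PF SF C).add_mem (PF.fsmul hOm (hp1 4)) (PF.fsmul (hq _) (hp1 2)))
      (PF.fsmul hphi (contDiffOn_div_pow 2 2))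
  have heta : (fun i t => (R 0 0 i t).eta) ∈ PF VF C :=
    (PF VF C).add_mem ((PF VF C).sub_mem (PF.fsmul hq0 (contDiffOn_div_pow 1 2))
      (PF.map (hq _) gradB)) (PF.fsmul (PF.map hphi gradB) (hp1 1))
  have htrXb : (fun i t => (R 0 0 i t).trXb) ∈ PF SF C :=
    (PF SF C).add_mem ((PF SF C).add_mem ((PF SF C).sub_mem ((PF SF C).add_mem ((PF SF C).add_mem
      (PF.fsmul (hq _) (contDiffOn_div_pow 1 2)) (PF.fsmul (PF.map hq0 dvB)
        (contDiffOn_div_pow 2 3))) (PF.fsmul (hq _) (hp1 2)))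
      (PF.fsmul (PF.map (PF.map hgc dvTB) dvB) (hp1 1)))
      (PF.fsmul (PF.map hphi lapB) (contDiffOn_div_pow 2 2)))
      (PF.fsmul hphi (contDiffOn_div_pow 2 2))
  have hchibh : (fun i t => (R 0 0 i t).chibh) ∈ PF TF C :=
    (PF TF C).sub_mem ((PF TF C).add_mem ((PF TF C).sub_mem ((PF TF C).add_mem
      (PF.fsmul (hq _) contDiffOn_id) (PF.fsmul ((PF TF C).add_mem (PF.map (PF.map hgc dvTB) D2B)
        hgc) hid')) (PF.fsmul (PF.map hq0 D2B) (hp1 1)))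
      (PF.fsmul (PF.map (PF.map (hq _) gradB) D2B) (hid 2)))
      (PF.fsmul (PF.map (PF.map hphi gradB) D2B) (hc 2))
  have hb : (fun i t => (R 0 0 i t).betab t) ∈ PF VF C :=
    (PF VF C).sub_mem ((PF VF C).sub_mem (PF.fsmul (PF.map hchibh dvTB) (contDiffOn_div_pow 1 2))
      (PF.fsmul (PF.map htrXb gradB) (hc (1 / 2)))) (PF.fsmul heta (hp1 1))
  have h2r : ContDiffOn ℝ ∞ (fun t : ℝ => 1 / (2 * t)) (Set.Ioi 0) :=
    contDiffOn_const.div (hid 2) fun t ht => mul_ne_zero two_ne_zero (ne_of_gt ht)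
  have h2r2 : ContDiffOn ℝ ∞ (fun t : ℝ => 1 / (2 * t ^ 2)) (Set.Ioi 0) :=
    contDiffOn_const.div (contDiffOn_const.mul (contDiffOn_id.pow 2))
      fun t ht => mul_ne_zero two_ne_zero (pow_ne_zero 2 (ne_of_gt ht))
  have hr : (fun i t => (R 0 0 i t).rho t) ∈ PF SF C :=
    (PF SF C).neg_mem ((PF SF C).add_mem ((PF SF C).sub_mem ((PF SF C).add_mem
      ((PF SF C).sub_mem (PF.fsmul (PF.map (PF.map hgc dvTB) dvB) h2r2)
        (PF.fsmul ((PF SF C).add_mem (PF.map hphi lapB) (PF.fsmul hphi (hc 2)))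
          (contDiffOn_div_pow 1 3))) (PF.fsmul htrXb h2r)) (PF.fsmul htrX h2r))
      (PF.fsmul hOm (contDiffOn_div_pow 2 2)))
  obtain ⟨alb, halb, halb'⟩ := exists_alb he hl hb hr p.alb (m + 1)
  obtain ⟨omb, homb, homb'⟩ := exists_omb hl hb hr halb p.omb
  refine ⟨R omb alb, fun i t => ⟨rfl, rfl, rfl, rfl⟩,
    ⟨hphi, hgc, htrX, heta, htrXb, hchibh, homb, halb⟩, fun i hi => ?_⟩
  have hsm : ∀ {W : Type} [AddCommGroup W] [Module ℝ W] (w : W), lam i • w = w := fun w => by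
    rw [hi, one_smul]
  have hq0eq : ∀ t, 0 < t → q0 i t = (R omb alb i t).q0 t := fun t ht =>
    (recon_q0 t ht.ne' ..).symm
  exact
    { phi := (hphi' i).2.congr_right fun t _ => by simp only [Pi.add_apply, hsm]; rfl
      gc := (hgc' i).2
      q0 := (hq0' i).2.congr_left hq0eq
      Q1 := fun t ht => (recon_Q1 t ht.ne' ..).trans (hsm _)
      Q2 := fun t ht => (recon_Q2 t ht.ne' ..).trans (hsm _)
      Q3 := fun t ht => (recon_Q3 t ht.ne' ..).trans (hsm _)
      alb := fun k hk => (halb' k (by omega) i).2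
      omb := fun k _ => (homb' k i).2
      phi_e := ((hphi' i).1).trans (hsm _)
      gc_e := ((hgc' i).1).trans (hsm _)
      q0_e := (hq0eq e he).symm.trans ((hq0' i).1.trans (hsm _))
      alb_e := fun k hk => ((halb' k (by omega) i).1).trans (hsm _)
      omb_e := fun k _ => ((homb' k i).1).trans (hsm _) }

end Existence

/-! ## The outgoing equations for smooth fields -/

/-- A smooth solution of the outgoing equations, parametrised by the radius. -/
structure BOut (m : ℕ) (Z : ℝ → BD) : Prop where
  sep_Om : (fun t => (Z t).Om) ∈ Sep SF
  sep_phi : (fun t => (Z t).phi) ∈ Sep SF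
  sep_gc : (fun t => (Z t).gc) ∈ Sep TF
  sep_trX : (fun t => (Z t).trX) ∈ Sep SF
  sep_chih : (fun t => (Z t).chih) ∈ Sep TF
  sep_trXb : (fun t => (Z t).trXb) ∈ Sep SF
  sep_chibh : (fun t => (Z t).chibh) ∈ Sep TF
  sep_eta : (fun t => (Z t).eta) ∈ Sep VF
  sep_om : ∀ k, (fun t => (Z t).om k) ∈ Sep SF
  sep_omb : ∀ k, (fun t => (Z t).omb k) ∈ Sep SF
  sep_al : ∀ k, (fun t => (Z t).al k) ∈ Sep TF
  sep_alb : ∀ k, (fun t => (Z t).alb k) ∈ Sep TF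
  phi : HD (fun t => (1 / t) • (Z t).phi) (fun t => (1 / 2 : ℝ) • (Z t).trX)
  ray : ∃ ψ, HD (fun t => (Z t).phi) ψ ∧ HD ψ (fun t => (2 : ℝ) • (Z t).om 0)
  gc : HD (fun t => (Z t).gc) (fun t => (2 / t ^ 2) • (Z t).chih)
  eta : HD (fun t => t ^ 2 • (Z t).eta) (fun t => (4 * t) • gradB (Z t).Om + dvTB (Z t).chih
    - (t ^ 2 / 2) • gradB (Z t).trX)
  trXb : HD (fun t => t ^ 2 • (Z t).trXb) (fun t => (2 * t) • (Z t).trX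
    - (2 : ℝ) • dvB ((Z t).eta - (2 : ℝ) • gradB (Z t).Om) - (2 * t ^ 2) • (Z t).K t
    - (4 : ℝ) • (Z t).Om)
  chibh : HD (fun t => (1 / t) • (Z t).chibh) (fun t => (2 / t) • D2B ((Z t).eta
    - (2 : ℝ) • gradB (Z t).Om) + (1 / t ^ 2) • (Z t).chih)
  chih : HD (fun t => (Z t).chih) (fun t => -(Z t).al 0)
  Om : HD (fun t => (Z t).Om) (fun t => (Z t).om 0)
  om : ∀ k, HD (fun t => (Z t).om k) (fun t => (Z t).om (k + 1))
  al : ∀ k, HD (fun t => (Z t).al k) (fun t => (Z t).al (k + 1))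
  omb : ∀ k, k ≤ m + 1 → HD (fun t => (Z t).omb k)
    (fun t => -(curvJetB 1 t ((Z t).betab t) ((Z t).rho t) (Z t).alb k).2)
  alb : ∀ k, k ≤ m → HD (fun t => (Z t).alb k) (fun t => (∑ i : Fin (k + 1),
      ((k.choose i : ℝ) * dInv 1 t i) • (Z t).alb (k - i))
      + (2 : ℝ) • D2B (curvJetB 1 t ((Z t).betab t) ((Z t).rho t) (Z t).alb k).1)

lemma BD.X'_eq {r : ℝ} (hr : r ≠ 0) (x : BD) :
    x.X' r = (2 / r) • x.Q1 r - (2 / r ^ 2) • x.phi := by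
  rw [X', trX_eq hr]
  match_scalars <;> field_simp
  ring

namespace Fl

variable {m : ℕ} {e : ℝ} {p : BD} {Z : ℝ → BD} (h : Fl m e p Z)
include h

lemma trX_eq {t : ℝ} (ht : 0 < t) :
    (Z t).trX = (4 / t) • (Z t).Om + (2 / t) • p.Q1 e - (2 / t ^ 2) • (Z t).phi := by
  rw [BD.trX_eq ht.ne', h.Q1 t ht]

lemma eta_eq {t : ℝ} (ht : 0 < t) :
    (Z t).eta = (1 / t ^ 2) • (Z t).q0 t - gradB (p.Q1 e) + (1 / t) • gradB (Z t).phi := by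
  rw [BD.eta_eq ht.ne', BD.X'_eq ht.ne', h.Q1 t ht, map_sub, map_smul, map_smul]
  match_scalars <;> field_simp

lemma trXb_eq {t : ℝ} (ht : 0 < t) :
    (Z t).trXb = (1 / t ^ 2) • p.Q2 e + (2 / t ^ 3) • dvB ((Z t).q0 t) + (2 / t) • p.Q1 e
      - (1 / t) • dvB (dvTB (Z t).gc) + (2 / t ^ 2) • lapB (Z t).phi + (2 / t ^ 2) • (Z t).phi := by
  rw [BD.trXb_eq ht.ne', BD.X'_eq ht.ne', h.Q1 t ht, h.Q2 t ht, BD.K]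
  match_scalars <;> field_simp
  ring

lemma chibh_eq {t : ℝ} (ht : 0 < t) :
    (Z t).chibh = t • p.Q3 e + (t / 2) • (D2B (dvTB (Z t).gc) + (Z t).gc)
      - (1 / t) • D2B ((Z t).q0 t) + (2 * t) • D2B (gradB (p.Q1 e))
      - (2 : ℝ) • D2B (gradB (Z t).phi) := by
  rw [BD.chibh_eq ht.ne', BD.X'_eq ht.ne', h.Q1 t ht, h.Q3 t ht]
  simp only [map_sub, map_smul]
  match_scalars <;> field_simp

/-- Here and in the next three lemmas a null structure equation is recovered by differentiating the
explicit expression in `Ω, φ, g_c, q₀`, with the charges constant. -/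
lemma eq_phi : HD (fun t => (1 / t) • (Z t).phi) (fun t => (1 / 2 : ℝ) • (Z t).trX) :=
  (h.phi.smul hasDerivAt_one_div).congr_right fun t ht => by
    rw [h.trX_eq ht]
    match_scalars <;> field_simp
    ring

lemma eq_eta : HD (fun t => t ^ 2 • (Z t).eta) (fun t => (4 * t) • gradB (Z t).Om
    + dvTB (Z t).chih - (t ^ 2 / 2) • gradB (Z t).trX) := by
  have h1 := (h.q0.sub (HD.smul_const (fun t _ => hasDerivAt_pow 2 t) (gradB (p.Q1 e)))).add
    ((h.phi.map gradB).smul fun t _ => hasDerivAt_id' t)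
  refine (h1.congr_left fun t ht => ?_).congr_right fun t ht => ?_
  · rw [h.eta_eq ht]
    match_scalars <;> field_simp
  · rw [h.trX_eq ht]
    simp only [map_add, map_sub, map_smul]
    match_scalars <;> field_simp <;> ring

lemma eq_trXb : HD (fun t => t ^ 2 • (Z t).trXb) (fun t => (2 * t) • (Z t).trX
    - (2 : ℝ) • dvB ((Z t).eta - (2 : ℝ) • gradB (Z t).Om) - (2 * t ^ 2) • (Z t).K t
    - (4 : ℝ) • (Z t).Om) := by
  have h1 := (((((HD.const (p.Q2 e)).add (((h.q0.map dvB).smul hasDerivAt_one_div).const_smul 2)).add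
    (HD.smul_const (fun t _ => (hasDerivAt_id' t).const_mul 2) (p.Q1 e))).sub
    ((h.gc.map (dvB ∘ₗ dvTB)).smul fun t _ => hasDerivAt_id' t)).add
    ((h.phi.map lapB).const_smul 2)).add (h.phi.const_smul 2)
  refine (h1.congr_left fun t ht => ?_).congr_right fun t ht => ?_
  · rw [h.trXb_eq ht]
    simp only [LinearMap.comp_apply]
    match_scalars <;> field_simp
  · rw [h.trX_eq ht, h.eta_eq ht, BD.K]
    simp only [map_add, map_sub, map_smul, LinearMap.comp_apply, dvB_gradB]
    match_scalars <;> field_simp <;> ring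

lemma eq_chibh : HD (fun t => (1 / t) • (Z t).chibh) (fun t => (2 / t) • D2B ((Z t).eta
    - (2 : ℝ) • gradB (Z t).Om) + (1 / t ^ 2) • (Z t).chih) := by
  have h1 := ((((HD.const (p.Q3 e + (2 : ℝ) • D2B (gradB (p.Q1 e)))).add
    (((h.gc.map (D2B ∘ₗ dvTB)).add h.gc).const_smul (1 / 2))).sub
    ((h.q0.map D2B).smul (hasDerivAt_inv_pow 2))).sub
    (((h.phi.map (D2B ∘ₗ gradB)).smul hasDerivAt_one_div).const_smul 2))
  refine (h1.congr_left fun t ht => ?_).congr_right fun t ht => ?_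
  · rw [h.chibh_eq ht]
    simp only [LinearMap.comp_apply]
    match_scalars <;> field_simp
  · rw [h.eta_eq ht]
    simp only [map_add, map_sub, map_smul, LinearMap.comp_apply]
    match_scalars <;> field_simp
    ring

end Fl

theorem bOut_of_fl {m N : ℕ} {e e' : ℝ} (he : 0 < e) (he' : 0 < e') {p : BD} {Z : Par N → ℝ → BD}
    (hF : Fam (gluCC N he he') Z) {i : Par N} (h : Fl m e p (Z i))
    (sep_Om : (fun t => (Z i t).Om) ∈ Sep SF) (sep_chih : (fun t => (Z i t).chih) ∈ Sep TF)
    (sep_om : ∀ k, (fun t => (Z i t).om k) ∈ Sep SF)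
    (sep_al : ∀ k, (fun t => (Z i t).al k) ∈ Sep TF)
    (hOm : HD (fun t => (Z i t).Om) (fun t => (Z i t).om 0))
    (hchih : HD (fun t => (Z i t).chih) (fun t => -(Z i t).al 0))
    (hom : ∀ k, HD (fun t => (Z i t).om k) (fun t => (Z i t).om (k + 1)))
    (hal : ∀ k, HD (fun t => (Z i t).al k) (fun t => (Z i t).al (k + 1))) : BOut m (Z i) where
  sep_Om := sep_Om
  sep_phi := PF.sep hF.phi i
  sep_gc := PF.sep hF.gc i
  sep_trX := PF.sep hF.trX i
  sep_chih := sep_chih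
  sep_trXb := PF.sep hF.trXb i
  sep_chibh := PF.sep hF.chibh i
  sep_eta := PF.sep hF.eta i
  sep_om := sep_om
  sep_omb k := PF.sep (hF.omb k) i
  sep_al := sep_al
  sep_alb k := PF.sep (hF.alb k) i
  phi := h.eq_phi
  -- As `Dφ = 2Ω + Q₁` with `Q₁` constant along the cone, the Raychaudhuri equation is the
  -- derivative of this relation.
  ray := ⟨_, h.phi, ((hOm.const_smul 2).add (HD.const _)).congr_right fun _ _ => add_zero _⟩
  gc := h.gc
  eta := h.eq_eta
  trXb := h.eq_trXb
  chibh := h.eq_chibh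
  chih := hchih
  Om := hOm
  om := hom
  al := hal
  omb := h.omb
  alb k hk := (h.alb k hk).congr_right fun _ _ => (sum_alb_eq ..).symm

/-! ## Curves with prescribed jets -/

section Jets

variable {W : Type} [AddCommGroup W] [Module ℝ W]

/-- The derivatives of the curve `f • w`. -/
def jc (f : ℝ → ℝ) (w : W) (j : ℕ) (t : ℝ) : W := iteratedDeriv j f t • w

lemma jc_HD {f : ℝ → ℝ} (hf : ContDiff ℝ ∞ f) (w : W) (j : ℕ) : HD (jc f w j) (jc f w (j + 1)) :=
  HD.smul_const (fun t _ => by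
    rw [iteratedDeriv_succ]
    exact (hf.differentiable_iteratedDeriv j (by exact_mod_cast ENat.natCast_lt_top j) t).hasDerivAt) w

lemma contDiff_iteratedDeriv {f : ℝ → ℝ} (hf : ContDiff ℝ ∞ f) (j : ℕ) :
    ContDiff ℝ ∞ (iteratedDeriv j f) := by
  induction j with
  | zero => rwa [iteratedDeriv_zero]
  | succ j ih =>
    rw [iteratedDeriv_succ]
    exact (contDiff_infty_iff_deriv.mp ih).2

lemma jc_sep {f : ℝ → ℝ} (hf : ContDiff ℝ ∞ f) (w : W) (j : ℕ) : jc f w j ∈ Sep W :=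
  Sep.smul_mem (contDiff_iteratedDeriv hf j).contDiffOn w

lemma jc_zero (f : ℝ → ℝ) (w : W) (t : ℝ) : jc f w 0 t = f t • w := by
  rw [jc, iteratedDeriv_zero]

lemma jc_of_eventuallyEq_zero {f : ℝ → ℝ} {t : ℝ} (h : f =ᶠ[nhds t] fun _ => 0) (w : W) (j : ℕ) :
    jc f w j t = 0 := by
  rw [jc, (h.iteratedDeriv j).eq_of_nhds, iteratedDeriv_const]
  simp

lemma iteratedDeriv_monomial (e : ℝ) (j k : ℕ) :
    iteratedDeriv j (fun t : ℝ => (t - e) ^ k / k.factorial) e = if j = k then 1 else 0 := by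
  induction j generalizing k with
  | zero => cases k <;> simp [iteratedDeriv_zero]
  | succ j ih =>
    rw [iteratedDeriv_succ']
    cases k with
    | zero => simp
    | succ k =>
      have : deriv (fun t : ℝ => (t - e) ^ (k + 1) / ((k + 1).factorial : ℝ)) =
          fun t => (t - e) ^ k / (k.factorial : ℝ) := by
        funext t
        have h := (((hasDerivAt_id' t).sub_const e).fun_pow (k + 1)).div_const
          ((k + 1).factorial : ℝ)
        rw [h.deriv, Nat.factorial_succ]
        have : (k.factorial : ℝ) ≠ 0 := by exact_mod_cast k.factorial_ne_zero
        push_cast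
        simp only [mul_one]
        field_simp
      rw [this, ih]
      simp

lemma jc_monomial {f : ℝ → ℝ} {e : ℝ} {k : ℕ}
    (h : f =ᶠ[nhds e] fun t => (t - e) ^ k / k.factorial) (w : W) (j : ℕ) :
    jc f w j e = if j = k then w else 0 := by
  rw [jc, (h.iteratedDeriv j).eq_of_nhds, iteratedDeriv_monomial]
  split_ifs <;> simp

/-! ### Cut-off functions with prescribed moments, and curves with prescribed jets -/

/-- A smooth step from `e` to `e'`. -/
lemma exists_step {e e' : ℝ} (hne : e ≠ e') : ∃ γ : ℝ → ℝ, ContDiff ℝ ∞ γ ∧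
    (γ =ᶠ[nhds e] fun _ => 0) ∧ (γ =ᶠ[nhds e'] fun _ => 1) := by
  have h0 : e' - e ≠ 0 := sub_ne_zero.mpr hne.symm
  have hc : Continuous fun t : ℝ => (t - e) / (e' - e) * 3 - 1 := by fun_prop
  refine ⟨fun t => Real.smoothTransition ((t - e) / (e' - e) * 3 - 1),
    Real.smoothTransition.contDiff.comp
      ((((contDiff_id.sub contDiff_const).div_const _).mul contDiff_const).sub contDiff_const),
    ?_, ?_⟩
  · have : {t : ℝ | (t - e) / (e' - e) * 3 - 1 < 0} ∈ nhds e :=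
      (isOpen_lt hc continuous_const).mem_nhds (by simp)
    filter_upwards [this] with t ht
    exact Real.smoothTransition.zero_of_nonpos (le_of_lt ht)
  · have : {t : ℝ | 1 < (t - e) / (e' - e) * 3 - 1} ∈ nhds e' :=
      (isOpen_lt continuous_const hc).mem_nhds (by
        simp only [Set.mem_ofPred_eq, div_self h0]
        norm_num)
    filter_upwards [this] with t ht
    exact Real.smoothTransition.one_of_one_le (le_of_lt ht)

/-- A smooth function that is `0` near `e` and `1` near `e'`. -/
structure Step (e e' : ℝ) where
  γ : ℝ → ℝ
  smooth : ContDiff ℝ ∞ γ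
  left : γ =ᶠ[nhds e] fun _ => 0
  right : γ =ᶠ[nhds e'] fun _ => 1

namespace Step

variable {e e' : ℝ} (s : Step e e')

lemma smooth_deriv : ContDiff ℝ ∞ (deriv s.γ) := (contDiff_infty_iff_deriv.mp s.smooth).2
lemma smooth_deriv2 : ContDiff ℝ ∞ (deriv (deriv s.γ)) :=
  (contDiff_infty_iff_deriv.mp s.smooth_deriv).2

lemma hasDerivAt (t : ℝ) : HasDerivAt s.γ (deriv s.γ t) t :=
  ((contDiff_infty_iff_deriv.mp s.smooth).1 t).hasDerivAt
lemma hasDerivAt_deriv (t : ℝ) : HasDerivAt (deriv s.γ) (deriv (deriv s.γ) t) t :=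
  ((contDiff_infty_iff_deriv.mp s.smooth_deriv).1 t).hasDerivAt

lemma deriv_left : deriv s.γ =ᶠ[nhds e] fun _ => 0 := by simpa using s.left.deriv
lemma deriv_right : deriv s.γ =ᶠ[nhds e'] fun _ => 0 := by simpa using s.right.deriv
lemma deriv2_left : deriv (deriv s.γ) =ᶠ[nhds e] fun _ => 0 := by simpa using s.deriv_left.deriv
lemma deriv2_right : deriv (deriv s.γ) =ᶠ[nhds e'] fun _ => 0 := by simpa using s.deriv_right.deriv

end Step

/-- Smooth functions that vanish near `e` and near `e'`. -/
structure Bump (e e' : ℝ) (ψ : ℝ → ℝ) : Prop where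
  smooth : ContDiff ℝ ∞ ψ
  left : ψ =ᶠ[nhds e] fun _ => 0
  right : ψ =ᶠ[nhds e'] fun _ => 0

lemma Step.bump_half {e e' : ℝ} (s : Step e e') : Bump e e' fun t => 1 / 2 * deriv s.γ t where
  smooth := contDiff_const.mul s.smooth_deriv
  left := by filter_upwards [s.deriv_left] with t h; simp [h]
  right := by filter_upwards [s.deriv_right] with t h; simp [h]

/-- This is the derivative of `γ - (t/2)γ'`, while its product with `2/t²` is that of `-γ'/t`. Hence
its integral is `1` and its integral against `2/t²` is `0`. -/
lemma Step.bump_one {e e' : ℝ} (s : Step e e') :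
    Bump e e' fun t => 1 / 2 * deriv s.γ t - t / 2 * deriv (deriv s.γ) t where
  smooth := (contDiff_const.mul s.smooth_deriv).sub
    ((contDiff_id.div_const 2).mul s.smooth_deriv2)
  left := by filter_upwards [s.deriv_left, s.deriv2_left] with t h h2; simp [h, h2]
  right := by filter_upwards [s.deriv_right, s.deriv2_right] with t h h2; simp [h, h2]

/-- The dual bump: the derivative of `(t³/4)γ'`, while its product with `2/t²` is that of `(t/2)γ' +
γ`. The two integrals are `0` and `1`. -/
lemma Step.bump_two {e e' : ℝ} (s : Step e e') :
    Bump e e' fun t => 3 / 4 * t ^ 2 * deriv s.γ t + t ^ 3 / 4 * deriv (deriv s.γ) t where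
  smooth := ((contDiff_const.mul (contDiff_id.pow 2)).mul s.smooth_deriv).add
    (((contDiff_id.pow 3).div_const 4).mul s.smooth_deriv2)
  left := by filter_upwards [s.deriv_left, s.deriv2_left] with t h h2; simp [h, h2]
  right := by filter_upwards [s.deriv_right, s.deriv2_right] with t h h2; simp [h, h2]

lemma Bump.zero (e e' : ℝ) : Bump e e' fun _ => 0 :=
  ⟨contDiff_const, Filter.EventuallyEq.rfl, Filter.EventuallyEq.rfl⟩

/-- The coefficient of the `k`-th derivative at `e`. -/
def Step.mono {e e' : ℝ} (s : Step e e') (k : ℕ) (t : ℝ) : ℝ :=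
  (t - e) ^ k / k.factorial * (1 - s.γ t)

lemma Step.smooth_mono {e e' : ℝ} (s : Step e e') (k : ℕ) : ContDiff ℝ ∞ (s.mono k) :=
  (((contDiff_id.sub contDiff_const).pow k).div_const _).mul (contDiff_const.sub s.smooth)

lemma Step.mono_left {e e' : ℝ} (s : Step e e') (k : ℕ) :
    s.mono k =ᶠ[nhds e] fun t => (t - e) ^ k / k.factorial := by
  filter_upwards [s.left] with t h
  simp [mono, h]

lemma Step.mono_right {e e' : ℝ} (s : Step e e') (k : ℕ) : s.mono k =ᶠ[nhds e'] fun _ => 0 := by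
  filter_upwards [s.right] with t h
  simp [mono, h]

variable {e e' : ℝ}

/-- The part with prescribed derivatives at `e`, prescribed value at `e'` and moments. -/
def baseJ (s : Step e e') (n : ℕ) (P : ℕ → W) (q : W) (ψ1 ψ2 : ℝ → ℝ) (A B : W) (j : ℕ) (t : ℝ) : W :=
  ∑ k ∈ Finset.range (n + 1), jc (s.mono k) (P k) j t + jc s.γ q j t
    + (jc ψ1 A j t + jc ψ2 B j t)

/-- The full curve, with parameters. -/
def fullJ (s : Step e e') (n : ℕ) (P : ℕ → W) (q : W) (ψ1 ψ2 : ℝ → ℝ) (A B : W) {N : ℕ}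
    (w₀ : ℕ → W) (i : Par N) (j : ℕ) (t : ℝ) : W :=
  i.1 • baseJ s n P q ψ1 ψ2 A B j t + ∑ k : Fin N, jc (i.2 k).1 (w₀ k) j t

section

variable (s : Step e e') (n : ℕ) (P : ℕ → W) (q : W) {ψ1 ψ2 : ℝ → ℝ} (A B : W) {N : ℕ} (w₀ : ℕ → W)

lemma fullJ_HD (h1 : Bump e e' ψ1) (h2 : Bump e e' ψ2) (i : Par N) (j : ℕ) :
    HD (fullJ s n P q ψ1 ψ2 A B w₀ i j) (fullJ s n P q ψ1 ψ2 A B w₀ i (j + 1)) :=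
  (((((HD.sum _ fun k _ => jc_HD (s.smooth_mono k) (P k) j).add (jc_HD s.smooth q j)).add
    ((jc_HD h1.smooth A j).add (jc_HD h2.smooth B j))).const_smul i.1)).add
    (HD.sum _ fun k _ => jc_HD (CS.contDiff (i.2 k)) (w₀ k) j)

lemma fullJ_sep (h1 : Bump e e' ψ1) (h2 : Bump e e' ψ2) (i : Par N) (j : ℕ) :
    fullJ s n P q ψ1 ψ2 A B w₀ i j ∈ Sep W := by
  have hs : ∀ {κ : Type} (S : Finset κ) (F : κ → ℝ → W), (∀ k ∈ S, F k ∈ Sep W) →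
      (fun t => ∑ k ∈ S, F k t) ∈ Sep W := fun S F h => by
    convert (Sep W).sum_mem h using 1
    funext t
    simp
  exact (Sep W).add_mem ((Sep W).smul_mem i.1 ((Sep W).add_mem ((Sep W).add_mem
    (hs _ _ fun k _ => jc_sep (s.smooth_mono k) (P k) j) (jc_sep s.smooth q j))
    ((Sep W).add_mem (jc_sep h1.smooth A j) (jc_sep h2.smooth B j))))
    (hs _ _ fun k _ => jc_sep (CS.contDiff (i.2 k)) (w₀ k) j)

lemma fullJ_PF (he : 0 < e) (he' : 0 < e') (h1 : Bump e e' ψ1) (h2 : Bump e e' ψ2) :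
    (fun i t => fullJ s n P q ψ1 ψ2 A B w₀ i 0 t) ∈ PF W (gluCC N he he') := by
  have hb : ∀ {f : ℝ → ℝ}, ContDiff ℝ ∞ f → ∀ w : W,
      (fun (i : Par N) t => i.1 • jc f w 0 t) ∈ PF W (gluCC N he he') := fun {f} hf w => by
    have := PF.smul_mem (C := gluCC N he he') (gluB_fst_mul N e e' he he' hf) w
    simpa only [jc_zero, smul_smul, mul_comm] using this
  have hw : ∀ k : Fin N, (fun (i : Par N) t => jc (i.2 k).1 (w₀ k) 0 t) ∈
      PF W (gluCC N he he') := fun k => by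
    simp only [jc_zero]
    exact PF.smul_mem (C := gluCC N he he') (gluB_snd e e' k) (w₀ k)
  simp only [fullJ, baseJ, smul_add, Finset.smul_sum]
  exact (PF W _).add_mem ((PF W _).add_mem ((PF W _).add_mem
    (PF.sum_mem _ fun k _ => hb (s.smooth_mono k) (P k)) (hb s.smooth q))
    ((PF W _).add_mem (hb h1.smooth A) (hb h2.smooth B))) (PF.sum_mem _ fun k _ => hw k)

lemma fullJ_left (h1 : Bump e e' ψ1) (h2 : Bump e e' ψ2) {c : Fin N → CS}
    (hc : ∀ k, (c k).1 =ᶠ[nhds e] fun _ => 0) {j : ℕ} (hj : j ≤ n) :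
    fullJ s n P q ψ1 ψ2 A B w₀ (1, c) j e = P j := by
  have h3 : ∀ k : Fin N, jc (c k).1 (w₀ k) j e = 0 := fun k => jc_of_eventuallyEq_zero (hc k) _ _
  simp only [fullJ, baseJ, jc_of_eventuallyEq_zero h1.left, jc_of_eventuallyEq_zero h2.left,
    jc_of_eventuallyEq_zero s.left, jc_monomial (s.mono_left _), h3, Finset.sum_const_zero, add_zero,
    one_smul]
  rw [Finset.sum_ite_eq, if_pos (Finset.mem_range.mpr (by omega))]

lemma fullJ_right_zero (h1 : Bump e e' ψ1) (h2 : Bump e e' ψ2) {c : Fin N → CS}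
    (hc : ∀ k, (c k).1 =ᶠ[nhds e'] fun t => (t - e') ^ ((k : ℕ) + 1) / ((k : ℕ) + 1).factorial) :
    fullJ s n P q ψ1 ψ2 A B w₀ (1, c) 0 e' = q := by
  have h3 : ∀ k : Fin N, jc (c k).1 (w₀ k) 0 e' = 0 := fun k => by
    rw [jc_monomial (hc k), if_neg (by omega)]
  simp only [fullJ, baseJ, jc_of_eventuallyEq_zero h1.right, jc_of_eventuallyEq_zero h2.right,
    jc_of_eventuallyEq_zero (s.mono_right _), h3, Finset.sum_const_zero, add_zero, one_smul, zero_add,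
    jc_zero, s.right.eq_of_nhds]

/-- The parameter with index `k` starts at Taylor order `k + 1`, so the value at `e'` stays
untouched and `w₀ j` is the derivative of order `j + 1`. All other terms are locally constant near
`e'`. -/
lemma fullJ_right_succ (h1 : Bump e e' ψ1) (h2 : Bump e e' ψ2) {c : Fin N → CS}
    (hc : ∀ k, (c k).1 =ᶠ[nhds e'] fun t => (t - e') ^ ((k : ℕ) + 1) / ((k : ℕ) + 1).factorial)
    {j : ℕ} (hj : j < N) : fullJ s n P q ψ1 ψ2 A B w₀ (1, c) (j + 1) e' = w₀ j := by
  have h3 : ∀ k : Fin N, jc (c k).1 (w₀ k) (j + 1) e' = if (⟨j, hj⟩ : Fin N) = k then w₀ k else 0 :=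
    fun k => by
      rw [jc_monomial (hc k)]
      exact if_congr (by rw [Fin.ext_iff]; simp) rfl rfl
  have h4 : jc s.γ q (j + 1) e' = 0 := by
    rw [jc, (s.right.iteratedDeriv (j + 1)).eq_of_nhds, iteratedDeriv_const]
    simp
  simp only [fullJ, baseJ, jc_of_eventuallyEq_zero h1.right, jc_of_eventuallyEq_zero h2.right,
    jc_of_eventuallyEq_zero (s.mono_right _), h3, h4, Finset.sum_const_zero, add_zero, one_smul,
    zero_add]
  rw [Finset.sum_ite_eq, if_pos (Finset.mem_univ _)]

lemma fullJ_base (j : ℕ) (t : ℝ) :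
    fullJ s n P q ψ1 ψ2 A B w₀ ((1, 0) : Par N) j t = baseJ s n P q ψ1 ψ2 A B j t := by
  have h3 : ∀ k : Fin N, jc ((0 : Fin N → CS) k).1 (w₀ k) j t = 0 := fun k =>
    jc_of_eventuallyEq_zero (Filter.EventuallyEq.rfl) _ _
  simp only [fullJ, h3, Finset.sum_const_zero, add_zero, one_smul]

end

lemma Sep.fsmul {f : ℝ → ℝ} (hf : ContDiffOn ℝ ∞ f (Set.Ioi 0)) {F : ℝ → W} (h : F ∈ Sep W) :
    (fun t => f t • F t) ∈ Sep W := by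
  induction h using Submodule.span_induction with
  | mem F hF =>
    obtain ⟨b, hb, w, rfl⟩ := hF
    simpa only [smul_smul] using Sep.smul_mem (hf.mul hb) w
  | zero => convert (Sep W).zero_mem using 1; funext t; simp
  | add F G _ _ hF hG => convert (Sep W).add_mem hF hG using 1; funext t; simp
  | smul c F _ hF => convert (Sep W).smul_mem c hF using 1; funext t; simp [smul_comm c]

lemma Sep.prim (he : 0 < e) {F : ℝ → W} (h : F ∈ Sep W) (w : W) : ∃ G, HD G F ∧ G e = w := by
  have hP : (fun (i : Par 0) t => i.1 • F t) ∈ PF W (gluCC 0 he he) := by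
    induction h using Submodule.span_induction with
    | mem F hF =>
      obtain ⟨b, hb, w, rfl⟩ := hF
      have := PF.smul_mem ((gluCC 0 he he).mul _ (gluB_fst 0 e e) b hb) w
      simpa only [smul_smul, mul_comm] using this
    | zero => convert (PF W _).zero_mem using 1; funext i t; simp
    | add F G _ _ hF hG => convert (PF W _).add_mem hF hG using 1; funext i t; simp
    | smul c F _ hF => convert (PF W _).smul_mem c hF using 1; funext i t; simp [smul_comm c]
  obtain ⟨G, -, hG⟩ := PF.prim hP (gluB_fst 0 e e) w
  refine ⟨G (1, 0), ?_, by rw [(hG (1, 0)).1]; exact one_smul ℝ w⟩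
  have h1 := (hG (1, 0)).2
  simpa only [one_smul] using h1

lemma baseJ_zero_moment (s : Step e e') (n : ℕ) (P : ℕ → W) (q : W) (ψ1 ψ2 : ℝ → ℝ) (A B : W)
    (t : ℝ) : baseJ s n P q ψ1 ψ2 A B 0 t =
      baseJ s n P q (fun _ => 0) (fun _ => 0) 0 0 0 t + (ψ1 t • A + ψ2 t • B) := by
  simp only [baseJ, jc_zero, smul_zero, add_zero]

lemma baseJ_sep (s : Step e e') (n : ℕ) (P : ℕ → W) (q : W) (j : ℕ) :
    baseJ s n P q (fun _ => 0) (fun _ => 0) 0 0 j ∈ Sep W := by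
  have h := fullJ_sep s n P q (N := 0) 0 0 (0 : ℕ → W) (Bump.zero e e') (Bump.zero e e') (1, 0) j
  convert h using 1
  funext t
  rw [fullJ_base]

/-- A base curve with prescribed integral. -/
lemma exists_base_integral (he : 0 < e) (s : Step e e') (n : ℕ) (P : ℕ → W) (q : W) (a c w : W) :
    ∃ A : W, ∃ Ψ, HD Ψ (fun t => (2 : ℝ) •
      baseJ s n P q (fun t => 1 / 2 * deriv s.γ t) (fun _ => 0) A 0 0 t + c) ∧ Ψ e = a ∧ Ψ e' = w := by
  obtain ⟨Ψ, hΨ, hΨe⟩ := Sep.prim he ((Sep W).add_mem ((Sep W).smul_mem 2 (baseJ_sep s n P q 0))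
    (Sep.smul_mem (b := fun _ => 1) contDiffOn_const c)) a
  -- `A` is the defect in the end value. Twice the bump is `γ'`, so adding it changes the primitive
  -- by `γ A`.
  refine ⟨w - Ψ e', fun t => Ψ t + s.γ t • (w - Ψ e'), ?_, ?_, ?_⟩
  · refine (hΨ.add (HD.smul_const (fun t _ => s.hasDerivAt t) (w - Ψ e'))).congr_right fun t _ => ?_
    rw [baseJ_zero_moment s n P q (fun t => 1 / 2 * deriv s.γ t)]
    simp only [Pi.add_apply, Pi.smul_apply, smul_zero, add_zero]
    module
  · simp [hΨe, s.left.eq_of_nhds]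
  · simp [s.right.eq_of_nhds]

/-- A base curve with prescribed integral and prescribed integral against `2 / r²`. -/
lemma exists_base_integrals (he : 0 < e) (s : Step e e') (n : ℕ) (P : ℕ → W) (q : W) (G a w : W) :
    ∃ A B : W, ∃ F, (∀ t, F t = baseJ s n P q (fun t => 1 / 2 * deriv s.γ t - t / 2 * deriv (deriv s.γ) t)
      (fun t => 3 / 4 * t ^ 2 * deriv s.γ t + t ^ 3 / 4 * deriv (deriv s.γ) t) A B 0 t) ∧
      (∃ Ψ, HD Ψ F ∧ Ψ e = 0 ∧ Ψ e' = G) ∧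
      ∃ Φ, HD Φ (fun t => (2 / t ^ 2) • F t) ∧ Φ e = a ∧ Φ e' = w := by
  have hB := baseJ_sep s n P q 0
  obtain ⟨Ψ, hΨ, hΨe⟩ := Sep.prim he hB 0
  have hB2 : (fun t : ℝ => (2 / t ^ 2) • baseJ s n P q (fun _ => 0) (fun _ => 0) 0 0 0 t) ∈ Sep W :=
    Sep.fsmul (contDiffOn_div_pow 2 2) hB
  obtain ⟨Φ, hΦ, hΦe⟩ := Sep.prim he hB2 a
  have hl := s.left.eq_of_nhds
  have hr := s.right.eq_of_nhds
  have hl' := s.deriv_left.eq_of_nhds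
  have hr' := s.deriv_right.eq_of_nhds
  -- Because the two bumps are dual to the two moments, each coefficient is simply the defect of one
  -- moment.
  refine ⟨G - Ψ e', w - Φ e', _, fun t => rfl, ⟨fun t => Ψ t + ((s.γ t - t / 2 * deriv s.γ t) •
    (G - Ψ e') + (t ^ 3 / 4 * deriv s.γ t) • (w - Φ e')), ?_, ?_, ?_⟩,
    ⟨fun t => Φ t + ((-(1 / t * deriv s.γ t)) • (G - Ψ e') + (t / 2 * deriv s.γ t + s.γ t) •
    (w - Φ e')), ?_, ?_, ?_⟩⟩
  · have d1 : ∀ t : ℝ, 0 < t → HasDerivAt (fun t => s.γ t - t / 2 * deriv s.γ t)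
        (1 / 2 * deriv s.γ t - t / 2 * deriv (deriv s.γ) t) t := fun t _ => by
      refine ((s.hasDerivAt t).fun_sub
        (((hasDerivAt_id' t).div_const 2).fun_mul (s.hasDerivAt_deriv t))).congr_deriv ?_
      ring
    have d2 : ∀ t : ℝ, 0 < t → HasDerivAt (fun t => t ^ 3 / 4 * deriv s.γ t)
        (3 / 4 * t ^ 2 * deriv s.γ t + t ^ 3 / 4 * deriv (deriv s.γ) t) t := fun t _ => by
      refine (((hasDerivAt_pow 3 t).div_const 4).fun_mul (s.hasDerivAt_deriv t)).congr_deriv ?_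
      push_cast
      ring
    refine (hΨ.add ((HD.smul_const d1 _).add (HD.smul_const d2 _))).congr_right fun t _ => ?_
    rw [baseJ_zero_moment s n P q _ _ (G - Ψ e')]
  · simp [hΨe, hl, hl']
  · simp [hr, hr']
  · have d1 : ∀ t : ℝ, 0 < t → HasDerivAt (fun t => -(1 / t * deriv s.γ t))
        (2 / t ^ 2 * (1 / 2 * deriv s.γ t - t / 2 * deriv (deriv s.γ) t)) t := fun t ht => by
      refine ((hasDerivAt_one_div t ht).fun_mul (s.hasDerivAt_deriv t)).fun_neg.congr_deriv ?_
      field_simp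
      ring
    have d2 : ∀ t : ℝ, 0 < t → HasDerivAt (fun t => t / 2 * deriv s.γ t + s.γ t)
        (2 / t ^ 2 * (3 / 4 * t ^ 2 * deriv s.γ t + t ^ 3 / 4 * deriv (deriv s.γ) t)) t :=
      fun t ht => by
      refine ((((hasDerivAt_id' t).div_const 2).fun_mul (s.hasDerivAt_deriv t)).fun_add
        (s.hasDerivAt t)).congr_deriv ?_
      field_simp
      ring
    refine (hΦ.add ((HD.smul_const d1 _).add (HD.smul_const d2 _))).congr_right fun t _ => ?_
    rw [baseJ_zero_moment s n P q _ _ (G - Ψ e'), smul_add, smul_add, smul_smul, smul_smul]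
  · simp [hΦe, hl, hl']
  · simp [hr, hr']

end Jets

/-! ## Gluing along one cone -/

/-- Collects finitely many scalars whose vanishing on a correction `j` ensures that adding it to `i`
leaves all basic fields and transversal derivatives at time `t` unchanged. -/
lemma Fam.exists_controls {ι : Type} {e : ℝ} {C : CC ι e} {Z : ι → ℝ → BD} (hF : Fam C Z) (m : ℕ)
    (t : ℝ) : ∃ S : Finset (ι → ℝ → ℝ), (∀ b ∈ S, b ∈ C.B) ∧ ∀ i j k, (∀ b ∈ C.B, b k = b i + b j) →
      (∀ b ∈ S, b j t = 0) → SameFields m (Z k t) (Z i t) := by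
  classical
  obtain ⟨S1, h1, h1'⟩ := PF.exists_control hF.phi t
  obtain ⟨S2, h2, h2'⟩ := PF.exists_control hF.gc t
  obtain ⟨S3, h3, h3'⟩ := PF.exists_control hF.trX t
  obtain ⟨S4, h4, h4'⟩ := PF.exists_control hF.eta t
  obtain ⟨S5, h5, h5'⟩ := PF.exists_control hF.trXb t
  obtain ⟨S6, h6, h6'⟩ := PF.exists_control hF.chibh t
  choose S7 h7 h7' using fun k => PF.exists_control (hF.omb k) t
  choose S8 h8 h8' using fun k => PF.exists_control (hF.alb k) t
  refine ⟨S1 ∪ S2 ∪ S3 ∪ S4 ∪ S5 ∪ S6 ∪ (Finset.range (m + 2)).biUnion S7 ∪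
    (Finset.range (m + 1)).biUnion S8, fun b hb => ?_, fun i j k hk hS => ?_⟩
  · simp only [Finset.mem_union, Finset.mem_biUnion] at hb
    rcases hb with ((((((hb | hb) | hb) | hb) | hb) | hb) | ⟨k, -, hb⟩) | ⟨k, -, hb⟩
    exacts [h1 b hb, h2 b hb, h3 b hb, h4 b hb, h5 b hb, h6 b hb, h7 k b hb, h8 k b hb]
  · simp only [Finset.mem_union, Finset.mem_biUnion, Finset.mem_range] at hS
    have key : ∀ {W : Type} [AddCommGroup W] [Module ℝ W] {F : ι → ℝ → W}, F ∈ PF W C →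
        F j t = 0 → F k t = F i t := fun {W} _ _ {F} hF h0 => by
      rw [PF.apply_eq_add hk hF, Pi.add_apply, h0, add_zero]
    exact
      { phi := key hF.phi (h1' j fun b hb => hS b (by tauto))
        gc := key hF.gc (h2' j fun b hb => hS b (by tauto))
        trX := key hF.trX (h3' j fun b hb => hS b (by tauto))
        eta := key hF.eta (h4' j fun b hb => hS b (by tauto))
        trXb := key hF.trXb (h5' j fun b hb => hS b (by tauto))
        chibh := key hF.chibh (h6' j fun b hb => hS b (by tauto))
        alb := fun l hl => key (hF.alb l) (h8' l j fun b hb => hS b (Or.inr ⟨l, by omega, hb⟩))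
        omb := fun l hl => key (hF.omb l)
          (h7' l j fun b hb => hS b (Or.inl (Or.inr ⟨l, by omega, hb⟩))) }

lemma BD.toHSD_eq {m : ℕ} {x y : BD} (h : SameFields m x y) (hOm : x.Om = y.Om)
    (hchih : x.chih = y.chih) (hom : ∀ k, k ≤ m + 1 → x.om k = y.om k)
    (hal : ∀ k, k ≤ m → x.al k = y.al k) : x.toHSD m = y.toHSD m := by
  have h1 : ∀ k : Fin (m + 2), x.om k = y.om k := fun k => hom k (by omega)
  have h2 : ∀ k : Fin (m + 2), x.omb k = y.omb k := fun k => h.omb k (by omega)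
  have h3 : ∀ k : Fin (m + 1), x.al k = y.al k := fun k => hal k (by omega)
  have h4 : ∀ k : Fin (m + 1), x.alb k = y.alb k := fun k => h.alb k (by omega)
  simp only [toHSD, hOm, hchih, h.phi, h.gc, h.trX, h.eta, h.trXb, h.chibh, h1, h2, h3, h4]

/-- Gluing along an outgoing cone: if the conserved charges of `p` and `q` agree, they are connected
by a solution, after a change of the transversal derivatives of `q` that does not depend on the
tangential derivatives at the sphere of `q`; the latter may be prescribed. -/
theorem exists_glue (m : ℕ) {e e' : ℝ} (he : 0 < e) (he' : 0 < e') (hne : e ≠ e') (p q : BD)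
    (h1 : q.Q1 e' = p.Q1 e) (h2 : q.Q2 e' = p.Q2 e) (h3 : q.Q3 e' = p.Q3 e) (G : TF)
    (hG : q.q0 e' = p.q0 e + dvTB G) :
    ∃ (ombs : ℕ → SF) (albs : ℕ → TF), ∀ (oms : ℕ → SF) (als : ℕ → TF), ∃ Z : ℝ → BD,
      BOut m Z ∧ (Z e).toHSD m = p.toHSD m ∧
      (Z e').toHSD m = ({ q with om := oms, omb := ombs, al := als, alb := albs } : BD).toHSD m := by
  obtain ⟨γ, hγ, hγl, hγr⟩ := exists_step hne
  let s : Step e e' := ⟨γ, hγ, hγl, hγr⟩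
  -- The jets of the free data at `e`: since `DΩ = ω` and `Dχ̂ = -α`, derivative `k + 1` is `om k`,
  -- respectively `-al k`.
  let P : ℕ → SF := fun k => Nat.casesOn k p.Om p.om
  let P' : ℕ → TF := fun k => Nat.casesOn k p.chih fun k => -p.al k
  let N := m + 2
  obtain ⟨A, Ψ, hΨ, hΨe, hΨe'⟩ := exists_base_integral he s N P q.Om p.phi (p.Q1 e) q.phi
  obtain ⟨A', B', F', hF', ⟨Ψ', hΨ', hΨ'e, hΨ'e'⟩, Φ, hΦ, hΦe, hΦe'⟩ :=
    exists_base_integrals he s N P' q.chih G p.gc q.gc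
  have b1 := s.bump_half
  have b2 := Bump.zero e e'
  have b1' := s.bump_one
  have b2' := s.bump_two
  set ψ1 := fun t => 1 / 2 * deriv s.γ t
  set ψ1' := fun t => 1 / 2 * deriv s.γ t - t / 2 * deriv (deriv s.γ) t
  set ψ2' := fun t => 3 / 4 * t ^ 2 * deriv s.γ t + t ^ 3 / 4 * deriv (deriv s.γ) t
  let OmJ (w₀ : ℕ → SF) (i : Par N) (j : ℕ) (t : ℝ) : SF :=
    fullJ s N P q.Om ψ1 (fun _ => 0) A 0 w₀ i j t
  let chJ (w₀ : ℕ → TF) (i : Par N) (j : ℕ) (t : ℝ) : TF :=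
    fullJ s N P' q.chih ψ1' ψ2' A' B' w₀ i j t
  have hex : ∀ (w₀ : ℕ → SF) (a : ℕ → TF), _ := fun w₀ a => exists_family (C := gluCC N he he') m he
    (gluB_fst N e e') p (fullJ_PF s N P q.Om A 0 w₀ he he' b1 b2)
    (fullJ_PF s N P' q.chih A' B' a he he' b1' b2')
    (fun i t k => OmJ w₀ i (k + 1) t) (fun i t k => -chJ a i (k + 1) t)
  -- A reference solution chosen before the tangential jets at `e'` are given; its transversal
  -- derivatives there are the ones announced in the conclusion.
  obtain ⟨Z0, hZ0, -, hfl0⟩ := hex 0 0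
  have hf0 : Fl m e p (Z0 (1, 0)) := hfl0 (1, 0) rfl
  have hOm0 : ∀ t, (Z0 (1, 0) t).Om = baseJ s N P q.Om ψ1 (fun _ => 0) A 0 0 t := fun t => by
    rw [(hZ0 (1, 0) t).1, fullJ_base]
  have hch0 : ∀ t, (Z0 (1, 0) t).chih = F' t := fun t => by
    rw [(hZ0 (1, 0) t).2.1, fullJ_base, hF']
  have hphi0 : (Z0 (1, 0) e').phi = q.phi := by
    rw [← hΨe']
    exact hf0.phi.eq_of_eq he hΨ (fun t _ => by rw [hOm0]) (hf0.phi_e.trans hΨe.symm) e' he'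
  have hgc0 : (Z0 (1, 0) e').gc = q.gc := by
    rw [← hΦe']
    exact hf0.gc.eq_of_eq he hΦ (fun t _ => by rw [hch0]) (hf0.gc_e.trans hΦe.symm) e' he'
  -- The integral of `χ̂` was arranged to be `G`, and `div G` is the required change of `q₀`.
  have hq00 : (Z0 (1, 0) e').q0 e' = q.q0 e' := by
    have h := hf0.q0.eq_of_eq he ((HD.const (p.q0 e)).add (hΨ'.map dvTB))
      (fun t _ => by rw [hch0, zero_add]) (by rw [hf0.q0_e, hΨ'e, map_zero, add_zero]) e' he'
    rw [h, hΨ'e', hG]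
  refine ⟨(Z0 (1, 0) e').omb, (Z0 (1, 0) e').alb, fun oms als => ?_⟩
  obtain ⟨Z, hZ, hFam, hfl⟩ := hex oms fun k => -als k
  -- The parameter curves `c` realise the prescribed jets at `e'`, while the correction `(0, c)` is
  -- invisible to every field other than `Ω`, `χ̂` and their derivatives.
  obtain ⟨S, hS, hS'⟩ := hFam.exists_controls m e'
  obtain ⟨c, hc, hc'⟩ := exists_parameters N hne S hS
  have hf : Fl m e p (Z (1, c)) := hfl (1, c) rfl
  have hs1 : SameFields m (Z (1, c) e') (Z (1, 0) e') := by
    refine hS' (1, 0) (0, c) (1, c) (fun b hb => ?_) hc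
    rw [← hb.1.map_add]
    simp
  -- The two families were chosen separately. For the parameter `(1, 0)` their free data coincide,
  -- since the prescribed jets enter only through the second parameter.
  have hs2 : SameFields m (Z (1, 0) e') (Z0 (1, 0) e') :=
    (hfl (1, 0) rfl).unique he hf0 (fun t _ => by rw [(hZ (1, 0) t).1, hOm0, fullJ_base])
      (fun t _ => by rw [(hZ (1, 0) t).2.1, hch0, fullJ_base, hF']) e' he'
  have hOmq : (Z0 (1, 0) e').Om = q.Om := by
    have h := fullJ_right_zero s N P q.Om A 0 0 b1 b2 (c := c) fun k => (hc' k).2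
    rw [hOm0, ← fullJ_base s N P q.Om A 0 (N := N) 0]
    refine Eq.trans ?_ h
    simp only [fullJ, Pi.zero_apply, jc, smul_zero]
  obtain ⟨e1, e2, e3, e4⟩ := BD.eq_of_charges he'.ne' hOmq hphi0 hgc0 hq00
    ((hf0.Q1 e' he').trans h1.symm) ((hf0.Q2 e' he').trans h2.symm) ((hf0.Q3 e' he').trans h3.symm)
  have hOmc : (Z (1, c) e').Om = q.Om := by
    rw [(hZ (1, c) e').1]
    exact fullJ_right_zero s N P q.Om A 0 _ b1 b2 fun k => (hc' k).2
  have hchc : (Z (1, c) e').chih = q.chih := by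
    rw [(hZ (1, c) e').2.1]
    exact fullJ_right_zero s N P' q.chih A' B' _ b1' b2' fun k => (hc' k).2
  have hOme : (Z (1, c) e).Om = p.Om := by
    rw [(hZ (1, c) e).1]
    exact fullJ_left s N P q.Om A 0 _ b1 b2 (fun k => (hc' k).1) (Nat.zero_le _)
  have hche : (Z (1, c) e).chih = p.chih := by
    rw [(hZ (1, c) e).2.1]
    exact fullJ_left s N P' q.chih A' B' _ b1' b2' (fun k => (hc' k).1) (Nat.zero_le _)
  have eom : ∀ t k, (Z (1, c) t).om k = OmJ oms (1, c) (k + 1) t := fun t k => by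
    rw [(hZ (1, c) t).2.2.1]
  have eal : ∀ t k, (Z (1, c) t).al k = -chJ (fun k => -als k) (1, c) (k + 1) t := fun t k => by
    rw [(hZ (1, c) t).2.2.2]
  refine ⟨Z (1, c), bOut_of_fl he he' hFam hf ?_ ?_ ?_ ?_ ?_ ?_ ?_ ?_, ?_, ?_⟩
  · simp only [(hZ _ _).1]
    exact fullJ_sep s N P q.Om A 0 _ b1 b2 _ 0
  · simp only [(hZ _ _).2.1]
    exact fullJ_sep s N P' q.chih A' B' _ b1' b2' _ 0
  · intro k
    simp only [eom]
    exact fullJ_sep s N P q.Om A 0 _ b1 b2 _ (k + 1)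
  · intro k
    simp only [eal]
    exact (Sep TF).neg_mem (fullJ_sep s N P' q.chih A' B' _ b1' b2' _ (k + 1))
  · simp only [(hZ _ _).1, eom]
    exact fullJ_HD s N P q.Om A 0 _ b1 b2 _ 0
  · simp only [(hZ _ _).2.1, eal, neg_neg]
    exact fullJ_HD s N P' q.chih A' B' _ b1' b2' _ 0
  · intro k
    simp only [eom]
    exact fullJ_HD s N P q.Om A 0 _ b1 b2 _ (k + 1)
  · intro k
    simp only [eal]
    exact (fullJ_HD s N P' q.chih A' B' _ b1' b2' _ (k + 1)).neg
  · obtain ⟨f1, f2, f3, f4⟩ := BD.eq_of_charges he.ne' hOme hf.phi_e hf.gc_e hf.q0_e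
      (hf.Q1 e he) (hf.Q2 e he) (hf.Q3 e he)
    refine BD.toHSD_eq ⟨hf.phi_e, hf.gc_e, f1, f2, f3, f4, hf.alb_e, hf.omb_e⟩ hOme hche
      (fun k hk => ?_) fun k hk => ?_
    · rw [eom]
      exact fullJ_left s N P q.Om A 0 _ b1 b2 (fun k => (hc' k).1) (by omega)
    · rw [eal, neg_eq_iff_eq_neg]
      exact fullJ_left s N P' q.chih A' B' _ b1' b2' (fun k => (hc' k).1) (by omega)
  · refine BD.toHSD_eq ⟨(hs1.phi.trans hs2.phi).trans hphi0, (hs1.gc.trans hs2.gc).trans hgc0,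
      (hs1.trX.trans hs2.trX).trans e1, (hs1.eta.trans hs2.eta).trans e2,
      (hs1.trXb.trans hs2.trXb).trans e3, (hs1.chibh.trans hs2.chibh).trans e4,
      fun k hk => (hs1.alb k hk).trans (hs2.alb k hk),
      fun k hk => (hs1.omb k hk).trans (hs2.omb k hk)⟩ hOmc hchc (fun k hk => ?_) fun k hk => ?_
    · rw [eom]
      exact fullJ_right_succ s N P q.Om A 0 _ b1 b2 (fun k => (hc' k).2) (by omega)
    · rw [eal, neg_eq_iff_eq_neg]
      exact fullJ_right_succ s N P' q.chih A' B' _ b1' b2' (fun k => (hc' k).2) (by omega)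

/-! ## From families of smooth fields to null data -/

/-- The components of a covector field. -/
def VF.cL (i : Fin 3) : VF →ₗ[ℝ] SF where
  toFun X := X.c i
  map_add' _ _ := rfl
  map_smul' _ _ := rfl

/-- The components of a tensor field. -/
def TF.cL (i j : Fin 3) : TF →ₗ[ℝ] SF where
  toFun W := W.c i j
  map_add' _ _ := rfl
  map_smul' _ _ := rfl

/-- The evaluation at a point of the sphere. -/
def SF.ev (x : Sph) : SF →ₗ[ℝ] ℝ where
  toFun f := (f : Scal) x
  map_add' _ _ := rfl
  map_smul' _ _ := rfl

section

variable {a b s : ℝ} {τ : ℝ → ℝ} (hτ : ∀ t, HasDerivAt τ s t) (hpos : ∀ t ∈ Set.Icc a b, 0 < τ t)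
include hpos

/-- For finite sums of products, joint smoothness up to the ends needs no more than smoothness of
each factor. -/
lemma smoothFam_of_sep (hτ' : ContDiff ℝ ∞ τ) {F : ℝ → SF} (hF : F ∈ Sep SF) :
    SmoothFam a b fun t => (F (τ t) : Scal) := by
  have hadd : ∀ (f g : SF) (y : E3), rext ((f + g : SF) : Scal) y = rext f y + rext g y :=
    fun f g y => rext_add _ _ y
  have hsmul : ∀ (c : ℝ) (f : SF) (y : E3), rext ((c • f : SF) : Scal) y = c * rext f y :=
    fun c f y => by by_cases hy : y = 0 <;> simp [rext, hy]
  unfold SmoothFam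
  induction hF using Submodule.span_induction with
  | mem F hF =>
    obtain ⟨f, hf, w, rfl⟩ := hF
    simp only [hsmul]
    exact ContDiffOn.mul (hf.comp (hτ'.comp contDiff_fst).contDiffOn fun p hp => hpos _ hp.1)
      (w.contDiffOn.comp contDiff_snd.contDiffOn fun p hp => hp.2)
  | zero => exact (contDiffOn_const (c := (0 : ℝ))).congr fun p _ => by simp [rext]
  | add F G _ _ hF hG =>
    simp only [Pi.add_apply, hadd]
    exact hF.add hG
  | smul c F _ hF =>
    simp only [Pi.smul_apply, hsmul]
    exact contDiffOn_const.mul hF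

lemma smoothFam_VF (hτ' : ContDiff ℝ ∞ τ) {F : ℝ → VF} (hF : F ∈ Sep VF) (i : Fin 3) :
    SmoothFam a b fun t y => toCov (F (τ t)) y i :=
  smoothFam_of_sep hpos hτ' (Sep.map hF (VF.cL i))

lemma smoothFam_TF (hτ' : ContDiff ℝ ∞ τ) {F : ℝ → TF} (hF : F ∈ Sep TF) (i j : Fin 3) :
    SmoothFam a b fun t y => toTen (F (τ t)) y i j :=
  smoothFam_of_sep hpos hτ' (Sep.map hF (TF.cL i j))

include hτ

lemma HD.hasDerivWithinAt {W : Type} [AddCommGroup W] [Module ℝ W] {F G : ℝ → W} (h : HD F G)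
    (l : W →ₗ[ℝ] ℝ) {t : ℝ} (ht : t ∈ Set.Icc a b) :
    HasDerivWithinAt (fun u => l (F (τ u))) (s * l (G (τ t))) (Set.Icc a b) t := by
  have := (h _ (hpos t ht) l).comp t (hτ t)
  rw [mul_comm]
  exact this.hasDerivWithinAt

lemma evolves_SF {F G : ℝ → SF} (h : HD F G) :
    Evolves a b (fun t => (F (τ t) : Scal)) fun t => ((s • G (τ t) : SF) : Scal) :=
  fun _ ht x => h.hasDerivWithinAt hτ hpos (SF.ev x) ht

lemma evolves_VF {F G : ℝ → VF} (h : HD F G) :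
    Evolves a b (fun t => toCov (F (τ t))) fun t => toCov (s • G (τ t)) :=
  fun _ ht x => hasDerivWithinAt_pi.mpr fun i =>
    h.hasDerivWithinAt hτ hpos (SF.ev x ∘ₗ VF.cL i) ht

lemma evolves_TF {F G : ℝ → TF} (h : HD F G) :
    Evolves a b (fun t => toTen (F (τ t))) fun t => toTen (s • G (τ t)) :=
  fun _ ht x => hasDerivWithinAt_pi.mpr fun i => hasDerivWithinAt_pi.mpr fun j =>
    h.hasDerivWithinAt hτ hpos (SF.ev x ∘ₗ TF.cL i j) ht

omit hpos hτ in
lemma Evolves.congr {V : Type} [NormedAddCommGroup V] [NormedSpace ℝ V]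
    {F G F' G' : ℝ → Sph → V} (h : Evolves a b F G) (hF : ∀ t ∈ Set.Icc a b, F' t = F t)
    (hG : ∀ t ∈ Set.Icc a b, G' t = G t) : Evolves a b F' G' := fun t ht x => by
  rw [hG t ht]
  exact (h t ht x).congr (fun u hu => congrFun (hF u hu) x) (congrFun (hF t ht) x)

end

lemma evolves_SF_deriv {a b s : ℝ} {τ : ℝ → ℝ} (hτ : ∀ t, HasDerivAt τ s t)
    (hpos : ∀ t ∈ Set.Icc a b, 0 < τ t) (hab : a < b) {F G H : ℝ → SF} (h : HD F G) (h' : HD G H) :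
    Evolves a b (fun t x => derivWithin (fun u => (F (τ u) : Scal) x) (Set.Icc a b) t)
      fun t => (((s * s) • H (τ t) : SF) : Scal) := by
  have h1 := evolves_SF hτ hpos (h'.const_smul s)
  refine h1.congr (fun t ht => funext fun x => ?_) fun t _ => by rw [smul_smul]
  exact (evolves_SF hτ hpos h t ht x).derivWithin (uniqueDiffOn_Icc hab t ht)

lemma curvJet_toHSD (m : ℕ) (s r : ℝ) (x : BD) (b : VF) (ρ : SF) {k : ℕ} (hk : k ≤ m + 1) :
    curvJet s r (toCov b) ρ (x.toHSD m).albN k =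
      (toCov (curvJetB s r b ρ x.alb k).1, ((curvJetB s r b ρ x.alb k).2 : Scal)) :=
  curvJet_coe s r b ρ x.alb _ k fun j hj => x.albN_toHSD m (by omega)

lemma curvJet_toHSD' (m : ℕ) (s r : ℝ) (x : BD) (b : VF) (ρ : SF) {k : ℕ} (hk : k ≤ m + 1) :
    curvJet s r (toCov b) ρ (x.toHSD m).alN k =
      (toCov (curvJetB s r b ρ x.al k).1, ((curvJetB s r b ρ x.al k).2 : Scal)) :=
  curvJet_coe s r b ρ x.al _ k fun j hj => x.alN_toHSD m (by omega)

lemma dv_sub_grad (X : VF) (c : ℝ) (f : SF) :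
    dv (toCov X - c • grad f) = dvB (X - c • gradB f) := by
  rw [grad_coe, ← map_smul, ← map_sub, dv_toCov]

lemma D2s_sub_grad (X : VF) (c : ℝ) (f : SF) :
    D2s (toCov X - c • grad f) = toTen (D2B (X - c • gradB f)) := by
  rw [grad_coe, ← map_smul, ← map_sub, D2s_toCov]

theorem BOut.outgoingSolution {m : ℕ} {Z : ℝ → BD} (h : BOut m Z) {u₀ a b : ℝ} (hab : a < b)
    (hu : u₀ < a) : OutgoingSolution u₀ a b fun v => (Z (v - u₀)).toHSD m := by
  have hτ : ∀ t, HasDerivAt (fun v => v - u₀) 1 t := fun t => (hasDerivAt_id' t).sub_const u₀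
  have hτ' : ContDiff ℝ ∞ fun v : ℝ => v - u₀ := contDiff_id.sub contDiff_const
  have hpos : ∀ t ∈ Set.Icc a b, 0 < t - u₀ := fun t ht => by linarith [ht.1]
  constructor
  · exact
      { sphere := fun t _ => BD.smooth_toHSD m _
        Om := smoothFam_of_sep hpos hτ' h.sep_Om
        phi := smoothFam_of_sep hpos hτ' h.sep_phi
        gc := smoothFam_TF hpos hτ' h.sep_gc
        trX := smoothFam_of_sep hpos hτ' h.sep_trX
        chih := smoothFam_TF hpos hτ' h.sep_chih
        trXb := smoothFam_of_sep hpos hτ' h.sep_trXb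
        chibh := smoothFam_TF hpos hτ' h.sep_chibh
        eta := smoothFam_VF hpos hτ' h.sep_eta
        om := fun k => smoothFam_of_sep hpos hτ' (h.sep_om k)
        omb := fun k => smoothFam_of_sep hpos hτ' (h.sep_omb k)
        al := fun k => smoothFam_TF hpos hτ' (h.sep_al k)
        alb := fun k => smoothFam_TF hpos hτ' (h.sep_alb k) }
  · exact (evolves_SF hτ hpos h.phi).congr (fun _ _ => rfl) fun _ _ => by rw [one_smul]; rfl
  · obtain ⟨ψ, h1, h2⟩ := h.ray
    exact (evolves_SF_deriv hτ hpos hab h1 h2).congr (fun _ _ => rfl) fun _ _ => by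
      rw [mul_one, one_smul]; rfl
  · exact (evolves_TF hτ hpos h.gc).congr (fun _ _ => rfl) fun _ _ => by rw [one_smul]; rfl
  · refine (evolves_VF hτ hpos h.eta).congr (fun _ _ => rfl) fun _ _ => ?_
    simp only [one_smul, map_sub, map_add, map_smul, BD.toHSD, dvT_toTen, grad_coe]
  · refine (evolves_SF hτ hpos h.trXb).congr (fun _ _ => rfl) fun _ _ => ?_
    simp only [one_smul, BD.K_toHSD]
    simp only [BD.toHSD, dv_sub_grad, SF.coe_sub, SF.coe_smul]
  · refine (evolves_TF hτ hpos h.chibh).congr (fun _ _ => rfl) fun _ _ => ?_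
    simp only [one_smul, map_add, map_smul, BD.toHSD, D2s_sub_grad]
  · exact (evolves_TF hτ hpos h.chih).congr (fun _ _ => rfl) fun _ _ => by rw [one_smul]; rfl
  · exact (evolves_SF hτ hpos h.Om).congr (fun _ _ => rfl) fun _ _ => by rw [one_smul]; rfl
  · intro k hk
    exact (evolves_SF hτ hpos (h.om k)).congr (fun _ _ => BD.omN_toHSD _ _ (by omega)) fun _ _ => by
      rw [one_smul, BD.omN_toHSD _ _ (by omega)]
  · intro k hk
    exact (evolves_TF hτ hpos (h.al k)).congr (fun _ _ => BD.alN_toHSD _ _ (by omega)) fun _ _ => by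
      rw [one_smul, BD.alN_toHSD _ _ (by omega)]
  · intro k hk
    refine (evolves_SF hτ hpos (h.omb k hk)).congr (fun _ _ => BD.ombN_toHSD _ _ hk) fun _ _ => ?_
    rw [one_smul, BD.betab_toHSD, BD.rho_toHSD, curvJet_toHSD m _ _ _ _ _ hk]
    rfl
  · intro k hk
    refine (evolves_TF hτ hpos (h.alb k hk)).congr (fun _ _ => BD.albN_toHSD _ _ hk) fun _ _ => ?_
    rw [one_smul, BD.betab_toHSD, BD.rho_toHSD, curvJet_toHSD m _ _ _ _ _ (by omega)]
    simp only [D2s_toCov, map_add, map_sum, map_smul,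
      fun (x : BD) (i : Fin (k + 1)) => x.albN_toHSD m (show k - i ≤ m by omega)]

/-! ## The reflection which exchanges the two null directions -/

/-- The reflection of sphere data, which exchanges the two null directions. -/
def BD.mirror (x : BD) : BD where
  Om := x.Om
  phi := x.phi
  gc := x.gc
  trX := -x.trXb
  chih := -x.chibh
  trXb := -x.trX
  chibh := -x.chih
  eta := -x.eta + (2 : ℝ) • gradB x.Om
  om k := (-1 : ℝ) ^ (k + 1) • x.omb k
  omb k := (-1 : ℝ) ^ (k + 1) • x.om k
  al k := (-1 : ℝ) ^ k • x.alb k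
  alb k := (-1 : ℝ) ^ k • x.al k

namespace BD

lemma mirror_mirror (x : BD) : x.mirror.mirror = x := by
  have h : ∀ k : ℕ, (-1 : ℝ) ^ k * (-1) ^ k = 1 := fun k => by rw [← mul_pow]; norm_num
  obtain ⟨_, _, _, _, _, _, _, _, _, _, _, _⟩ := x
  simp only [mirror, neg_neg, smul_smul, h, one_smul, neg_add, neg_add_cancel_right]

variable (r : ℝ) (x : BD)

lemma etab_mirror : x.mirror.etab = x.eta := by
  simp only [etab, mirror]
  abel

lemma K_mirror : x.mirror.K r = x.K r := rfl

lemma rho_mirror : x.mirror.rho r = x.rho r := by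
  simp only [rho, K_mirror]
  simp only [mirror]
  module

lemma beta_mirror : x.mirror.beta r = x.betab r := by
  rw [beta, etab_mirror, betab]
  simp only [mirror, map_neg]
  module

end BD

/-- Each differentiation reverses sign with the direction of `r`; the derivatives of the inverse
powers of `r` of order `i` contribute `(-1)^i`, the remaining jet `(-1)^(k - i)`. -/
lemma curvJetB_neg (r : ℝ) (b : VF) (ρ : SF) (a : ℕ → TF) (k : ℕ) :
    curvJetB (-1) r b ρ (fun k => (-1 : ℝ) ^ k • a k) k = (-1 : ℝ) ^ k • curvJetB 1 r b ρ a k := by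
  induction k using Nat.strong_induction_on with
  | _ k ih =>
    cases k with
    | zero => rw [curvJetB, curvJetB, pow_zero, one_smul]
    | succ k =>
      have hi : ∀ i : Fin (k + 1), curvJetB (-1) r b ρ (fun k => (-1 : ℝ) ^ k • a k) (k - i) =
          (-1 : ℝ) ^ (k - i : ℕ) • curvJetB 1 r b ρ a (k - i) := fun i => ih _ (by omega)
      have hp : ∀ i : Fin (k + 1), (-1 : ℝ) ^ k = (-1) ^ (i : ℕ) * (-1) ^ (k - i : ℕ) := fun i => by
        rw [← pow_add, show (i : ℕ) + (k - i) = k by omega]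
      rw [curvJetB, curvJetB]
      refine Prod.ext ?_ ?_
      · simp only [Prod.smul_fst, Finset.smul_sum]
        refine Finset.sum_congr rfl fun i _ => ?_
        rw [hi, Prod.smul_fst, map_smul, dInv, dInv, dInvSq, dInvSq, pow_succ (-1 : ℝ) k, hp i]
        match_scalars <;> ring
      · simp only [Prod.smul_snd, Finset.smul_sum]
        refine Finset.sum_congr rfl fun i _ => ?_
        rw [hi, Prod.smul_snd, Prod.smul_fst, map_smul, dInv, dInv, dInvSq, dInvSq, pow_succ (-1 : ℝ) k, hp i]
        match_scalars <;> ring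

/-- With `r = v₀ - u` one has `D̲ = -d/dr`, so the reflected fields are run backwards in `r`. The
powers of `-1` in the reflection account for this reversal in each derivative, with one further sign
for `ω` and `ω̲`. -/
theorem BOut.ingoingSolution {m : ℕ} {Z : ℝ → BD} (h : BOut m Z) {v₀ a b : ℝ} (hab : a < b)
    (hv : b < v₀) : IngoingSolution v₀ a b fun u => (Z (v₀ - u)).mirror.toHSD m := by
  have hτ : ∀ t, HasDerivAt (fun u => v₀ - u) (-1) t := fun t => (hasDerivAt_id' t).const_sub v₀
  have hτ' : ContDiff ℝ ∞ fun u : ℝ => v₀ - u := contDiff_const.sub contDiff_id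
  have hpos : ∀ t ∈ Set.Icc a b, 0 < v₀ - t := fun t ht => by linarith [ht.2]
  constructor
  · exact
      { sphere := fun t _ => BD.smooth_toHSD m _
        Om := smoothFam_of_sep hpos hτ' h.sep_Om
        phi := smoothFam_of_sep hpos hτ' h.sep_phi
        gc := smoothFam_TF hpos hτ' h.sep_gc
        trX := smoothFam_of_sep hpos hτ' ((Sep SF).neg_mem h.sep_trXb)
        chih := smoothFam_TF hpos hτ' ((Sep TF).neg_mem h.sep_chibh)
        trXb := smoothFam_of_sep hpos hτ' ((Sep SF).neg_mem h.sep_trX)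
        chibh := smoothFam_TF hpos hτ' ((Sep TF).neg_mem h.sep_chih)
        eta := smoothFam_VF hpos hτ' ((Sep VF).add_mem ((Sep VF).neg_mem h.sep_eta)
          ((Sep VF).smul_mem 2 (Sep.map h.sep_Om gradB)))
        om := fun k => smoothFam_of_sep hpos hτ' ((Sep SF).smul_mem _ (h.sep_omb k))
        omb := fun k => smoothFam_of_sep hpos hτ' ((Sep SF).smul_mem _ (h.sep_om k))
        al := fun k => smoothFam_TF hpos hτ' ((Sep TF).smul_mem _ (h.sep_alb k))
        alb := fun k => smoothFam_TF hpos hτ' ((Sep TF).smul_mem _ (h.sep_al k)) }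
  · refine (evolves_SF hτ hpos h.phi).congr (fun _ _ => rfl) fun _ _ => ?_
    simp only [BD.toHSD, BD.mirror, SF.coe_smul, SF.coe_neg]
    module
  · obtain ⟨ψ, h1, h2⟩ := h.ray
    refine (evolves_SF_deriv hτ hpos hab h1 h2).congr (fun _ _ => rfl) fun _ _ => ?_
    simp only [BD.toHSD, BD.mirror, SF.coe_smul, Fin.val_zero]
    module
  · refine (evolves_TF hτ hpos h.gc).congr (fun _ _ => rfl) fun _ _ => ?_
    simp only [BD.toHSD, BD.mirror, map_smul, map_neg]
    module
  · refine (evolves_VF hτ hpos h.eta).congr (fun _ _ => ?_) fun _ _ => ?_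
    · rw [BD.etab_toHSD, BD.etab_mirror, map_smul]
    · simp only [BD.toHSD, BD.mirror, dvT_toTen, grad_coe]
      simp only [map_sub, map_add, map_smul, map_neg]
      module
  · refine (evolves_SF hτ hpos h.trXb.neg).congr (fun _ _ => ?_) fun _ _ => ?_
    · simp only [BD.toHSD, BD.mirror, SF.coe_smul, SF.coe_neg, smul_neg]
    · rw [BD.etab_toHSD, BD.etab_mirror, BD.K_toHSD, BD.K_mirror]
      simp only [BD.toHSD, BD.mirror, dv_sub_grad, SF.coe_sub, SF.coe_smul, SF.coe_neg]
      module
  · refine (evolves_TF hτ hpos h.chibh.neg).congr (fun _ _ => ?_) fun _ _ => ?_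
    · simp only [BD.toHSD, BD.mirror, map_smul, map_neg, smul_neg]
    · rw [BD.etab_toHSD, BD.etab_mirror]
      simp only [BD.toHSD, BD.mirror, D2s_sub_grad]
      simp only [map_add, map_smul, map_neg]
      module
  · refine (evolves_TF hτ hpos h.chih.neg).congr (fun _ _ => rfl) fun _ _ => ?_
    simp only [BD.toHSD, BD.mirror, map_smul, map_neg, Fin.val_zero]
    module
  · refine (evolves_SF hτ hpos h.Om).congr (fun _ _ => rfl) fun _ _ => ?_
    simp only [BD.toHSD, BD.mirror, SF.coe_smul, Fin.val_zero]
    module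
  · intro k hk
    refine (evolves_SF hτ hpos ((h.om k).const_smul ((-1) ^ (k + 1)))).congr
      (fun _ _ => BD.ombN_toHSD _ _ (by omega)) fun _ _ => ?_
    rw [BD.ombN_toHSD _ _ (by omega)]
    simp only [BD.mirror, SF.coe_smul]
    module
  · intro k hk
    refine (evolves_TF hτ hpos ((h.al k).const_smul ((-1) ^ k))).congr
      (fun _ _ => BD.albN_toHSD _ _ (by omega)) fun _ _ => ?_
    rw [BD.albN_toHSD _ _ (by omega)]
    simp only [BD.mirror, map_smul]
    module
  · intro k hk
    refine (evolves_SF hτ hpos ((h.omb k hk).const_smul ((-1) ^ (k + 1)))).congr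
      (fun _ _ => BD.omN_toHSD _ _ (by omega)) fun _ _ => ?_
    rw [BD.beta_toHSD, BD.rho_toHSD, curvJet_toHSD' m _ _ _ _ _ hk, BD.beta_mirror, BD.rho_mirror]
    simp only [BD.mirror, curvJetB_neg, Prod.smul_snd, SF.coe_smul, SF.coe_neg]
    module
  · intro k hk
    refine (evolves_TF hτ hpos ((h.alb k hk).const_smul ((-1) ^ k))).congr
      (fun _ _ => BD.alN_toHSD _ _ (by omega)) fun t _ => ?_
    have hi : ∀ i : Fin (k + 1), ((k.choose i : ℝ) * dInv (-1) (v₀ - t) i) •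
        ((Z (v₀ - t)).mirror.toHSD m).alN (k - i) = (-1 : ℝ) ^ k •
        ((k.choose i : ℝ) * dInv 1 (v₀ - t) i) • toTen ((Z (v₀ - t)).alb (k - i)) := fun i => by
      rw [BD.alN_toHSD _ _ (by omega), BD.mirror, map_smul, smul_smul, smul_smul, dInv, dInv,
        show (-1 : ℝ) ^ k = (-1) ^ (i : ℕ) * (-1) ^ (k - i : ℕ) by
          rw [← pow_add, show (i : ℕ) + (k - i) = k by omega]]
      congr 1
      ring
    rw [BD.beta_toHSD, BD.rho_toHSD, curvJet_toHSD' m _ _ _ _ _ (by omega), BD.beta_mirror,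
      BD.rho_mirror, Finset.sum_congr rfl fun i _ => hi i, ← Finset.smul_sum]
    simp only [BD.mirror, curvJetB_neg, Prod.smul_fst, D2s_toCov]
    simp only [map_smul, map_add, map_sum]
    module

/-! ## Charges of smooth data -/

lemma m1B_dvB_D1B (f g : SF) : m1B (dvB (D1B f g)) = (2 : ℝ) • m1B f := by
  rw [dvB_D1B, map_neg, m1B_lapB]
  module

lemma dvB_D1B_m1B (f g : SF) : dvB (D1B (m1B f) (m1B g)) = (2 : ℝ) • m1B f := by
  rw [dvB_D1B, lapB_m1B]
  module

namespace BD

variable (r : ℝ) (x : BD) (m : ℕ)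

lemma Q0_toHSD {f g : SF} (h : x.eta = D1B f g) : (x.toHSD m).Q0 r =
    toCov (r ^ 2 • D1B (m1B f) (m1B g) + (r ^ 3 / 2) • gradB (m1B (x.X' r))) := by
  have h1 : m1 (x.toHSD m).trX - (4 / r) • m1 (x.toHSD m).Om = (m1B (x.X' r) : Scal) := by
    simp only [toHSD, m1_coe, X', map_sub, map_smul, SF.coe_sub, SF.coe_smul]
  rw [HSD.Q0, h1, show (x.toHSD m).eta = toCov x.eta from rfl, h, cm1_D1B, map_add, map_smul,
    map_smul, grad_coe]

/-- A Hodge representation of `η` reduces the projection in `Q₀` to its potentials, so that charge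
computations can use `q₀` instead of `Q₀`. -/
lemma dv_Q0_toHSD : dv ((x.toHSD m).Q0 r) = m1B (dvB (x.q0 r)) := by
  obtain ⟨f, g, h⟩ := exists_D1B_eq x.eta
  rw [Q0_toHSD r x m h, dv_toCov, q0, h]
  congr 1
  simp only [map_add, map_smul, m1B_dvB_D1B, dvB_D1B_m1B, dvB_gradB, m1B_lapB, lapB_m1B]

lemma Qhigh_toHSD (k : Fin (m + 2)) : (x.toHSD m).Qhigh r k =
    (le1B (x.omb k) + (((k : ℕ) + 1).factorial / (4 * r ^ ((k : ℕ) + 2))) • le1B (x.Q2 r)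
      + (((k : ℕ) + 2).factorial / (6 * r ^ ((k : ℕ) + 3))) • m1B (dvB (x.q0 r))
      + ((k : ℕ) * ((k : ℕ) + 1).factorial / (6 * r ^ ((k : ℕ) + 2))) • m1B (x.Q2 r) : SF) := by
  simp only [HSD.Qhigh, Q2_toHSD, dv_Q0_toHSD, le1_coe, m1_coe, SF.coe_add, SF.coe_smul,
    show (x.toHSD m).omb k = x.omb k from rfl]

lemma Q5_toHSD : (x.toHSD m).Q5 r = (x.toHSD m).Qhigh r 0 := by
  rw [Qhigh_toHSD]
  simp only [HSD.Q5, Q2_toHSD, dv_Q0_toHSD, le1_coe, ← SF.coe_add, ← SF.coe_smul,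
    show (x.toHSD m).omb 0 = x.omb 0 from rfl]
  congr 1
  simp only [Fin.val_zero, zero_add, Nat.factorial, Nat.cast_zero, zero_mul, zero_div,
    zero_smul, add_zero]
  congr 2
  norm_num
  ring

lemma Q6_toHSD : (x.toHSD m).Q6 r = (x.toHSD m).Qhigh r 1 := by
  rw [Qhigh_toHSD]
  simp only [HSD.Q6, Q2_toHSD, dv_Q0_toHSD, le1_coe, lap_coe, ← SF.coe_sub, ← SF.coe_add,
    ← SF.coe_smul, show (x.toHSD m).omb 1 = x.omb 1 from rfl]
  congr 1
  simp only [Fin.val_one, Nat.factorial, le1B_apply, map_add, lapB_m0B, lapB_m1B]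
  match_scalars <;> norm_num <;> ring

variable {r}

lemma intB_Q2 (hr : r ≠ 0) : intB (x.Q2 r) = -2 * (2 * intB x.phi - 2 * r * intB x.Om
    + r ^ 2 / 2 * intB x.trX - r ^ 2 / 2 * intB x.trXb) := by
  have h : intB (lapB x.phi) = 0 := intB_dvB _
  simp only [Q2, K, X', map_sub, map_add, map_smul, intB_dvB, smul_eq_mul, h]
  field_simp
  ring

/-- The curvature drops out: neither a double divergence of a tracefree tensor nor `(Δ + 2)φ` has a
degree-one part. What remains is proportional to the linear momentum. -/
lemma c1B_Q2 (hr : r ≠ 0) (i : Fin 3) : c1B i (x.Q2 r) = -2 * (2 * r * c1B i x.Om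
    - r ^ 2 / 2 * c1B i x.trX - r ^ 2 / 2 * c1B i x.trXb + r * c1B i (dvB x.eta)) := by
  simp only [Q2, K, X', map_sub, map_add, map_smul, dvB_gradB, c1B_lapB, c1B_dvB_dvTB, smul_eq_mul]
  field_simp
  ring

lemma c1B_dvB_q0 (hr : r ≠ 0) (i : Fin 3) : c1B i (dvB (x.q0 r)) =
    r ^ 2 * c1B i (dvB x.eta) - r ^ 3 * c1B i x.trX + 4 * r ^ 2 * c1B i x.Om := by
  simp only [q0, X', map_sub, map_add, map_smul, dvB_gradB, c1B_lapB, smul_eq_mul]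
  field_simp
  ring

lemma dvB_hodgeB_q0 : dvB (hodgeB (x.q0 r)) = r ^ 2 • dvB (hodgeB x.eta) := by
  simp only [q0, map_add, map_smul, dvB_hodgeB_gradB, smul_zero, add_zero]

lemma Edot_toHSD (hr : r ≠ 0) : (x.toHSD m).Edot r =
    √(4 * Real.pi) / (8 * Real.pi) * (1 / √(4 * Real.pi) * intB (x.Q2 r) / 2) := by
  rw [intB_Q2 x hr]
  simp only [HSD.Edot, toHSD, c0_coe]
  ring

lemma Pdot_toHSD (hr : r ≠ 0) (i : Fin 3) : (x.toHSD m).Pdot r i =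
    √(4 * Real.pi / 3) / (8 * Real.pi) * (c1B i (x.Q2 r) / 2) := by
  rw [c1B_Q2 x hr]
  simp only [HSD.Pdot, toHSD, dv_toCov, c1_coe]
  ring

lemma Ldot_toHSD (i : Fin 3) : (x.toHSD m).Ldot r i =
    √(8 * Real.pi / 3) / (16 * Real.pi) * (2 * (1 / √2 * c1B i (dvB (hodgeB (x.q0 r))))) := by
  rw [dvB_hodgeB_q0, map_smul, smul_eq_mul]
  simp only [HSD.Ldot, toHSD, cH_toCov]
  ring

lemma Gdot_toHSD (hr : r ≠ 0) (i : Fin 3) : (x.toHSD m).Gdot r i =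
    √(4 * Real.pi / 3) / (8 * Real.pi) * c1B i (dvB (x.q0 r)) := by
  have h2 : √(8 * Real.pi / 3) = √2 * √(4 * Real.pi / 3) := by
    rw [← Real.sqrt_mul (by norm_num)]
    congr 1
    ring
  rw [c1B_dvB_q0 x hr]
  simp only [HSD.Gdot, toHSD, grad_coe, cE_toCov, dvB_gradB, c1B_lapB, h2]
  field_simp
  ring

lemma intB_Q2_mirror (hr : r ≠ 0) : intB (x.mirror.Q2 r) = intB (x.Q2 r) := by
  rw [intB_Q2 _ hr, intB_Q2 _ hr]
  simp only [mirror, map_neg]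
  ring

lemma c1B_Q2_mirror (hr : r ≠ 0) (i : Fin 3) : c1B i (x.mirror.Q2 r) = -c1B i (x.Q2 r) := by
  rw [c1B_Q2 _ hr, c1B_Q2 _ hr]
  simp only [mirror, map_neg, map_add, map_smul, dvB_gradB, c1B_lapB, smul_eq_mul]
  ring

/-- The extra term, linear in `r`, is the origin of the drift of `G` by a multiple of `P`. -/
lemma c1B_dvB_q0_mirror (hr : r ≠ 0) (i : Fin 3) : c1B i (dvB (x.mirror.q0 r)) =
    c1B i (dvB (x.q0 r)) + r * c1B i (x.Q2 r) := by
  rw [c1B_dvB_q0 _ hr, c1B_dvB_q0 _ hr, c1B_Q2 _ hr]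
  simp only [mirror, map_neg, map_add, map_smul, dvB_gradB, c1B_lapB, smul_eq_mul]
  ring

lemma dvB_hodgeB_q0_mirror : dvB (hodgeB (x.mirror.q0 r)) = -dvB (hodgeB (x.q0 r)) := by
  rw [dvB_hodgeB_q0, dvB_hodgeB_q0]
  simp only [mirror, map_neg, map_add, map_smul, dvB_hodgeB_gradB, smul_zero, add_zero, smul_neg]

/-! ## Changes of the modes `l ≤ 1` -/

/-- The change of sphere data in `η`, `Ω tr χ̲` and the derivatives of `ω̲`. -/
def shift (E : VF) (d : SF) (w : ℕ → SF) : BD :=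
  { x with eta := x.eta + E, trXb := x.trXb + d, omb := fun k => x.omb k + w k }

variable (E : VF) (d : SF) (w : ℕ → SF)

lemma X'_shift : (x.shift E d w).X' r = x.X' r := rfl
lemma Q1_shift : (x.shift E d w).Q1 r = x.Q1 r := rfl
lemma K_shift : (x.shift E d w).K r = x.K r := rfl

lemma q0_shift : (x.shift E d w).q0 r = x.q0 r + r ^ 2 • E := by
  rw [q0, q0, X'_shift]
  simp only [shift]
  module

lemma Q2_shift (hr : r ≠ 0) :
    (x.shift E d w).Q2 r = x.Q2 r + (r ^ 2 • d - (2 * r) • dvB E) := by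
  rw [Q2, Q2, X'_shift, K_shift]
  simp only [shift, map_add, map_smul]
  match_scalars <;> field_simp

lemma Q3_shift (h : D2B E = 0) : (x.shift E d w).Q3 r = x.Q3 r := by
  rw [Q3, Q3, X'_shift]
  simp only [shift, map_add, h, add_zero]

/-- The change of `D̲^k ω̲` in the modes `l ≤ 1` which preserves the higher-order charges. -/
def shiftOmb (r : ℝ) (E : VF) (d : SF) (k : ℕ) : SF :=
  -(((k + 1).factorial / (4 * r ^ (k + 2)) : ℝ) • le1B (r ^ 2 • d - (2 * r) • dvB E)
    + ((k + 2).factorial / (6 * r ^ (k + 3)) : ℝ) • m1B (dvB (r ^ 2 • E))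
    + (k * (k + 1).factorial / (6 * r ^ (k + 2)) : ℝ) • m1B (r ^ 2 • d - (2 * r) • dvB E))

lemma le1B_shiftOmb (k : ℕ) : le1B (shiftOmb r E d k) = shiftOmb r E d k := by
  simp only [shiftOmb, map_neg, map_add, map_smul _ _ (le1B _), map_smul _ _ (m1B _), le1B_le1B,
    le1B_m1B]

/-- The change of `η` is a degree-one field, hence in the kernel of `D₂*`, and its divergence has
degree one. The changes of `Ω tr χ̲` and `D̲^k ω̲` lie in `l ≤ 1`, so their gradients are also
annihilated by `D₂*`. The projections to `l ≥ 2` and `l = 2` therefore see none of these changes,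
and `shiftOmb` was chosen to keep the higher-order charges. -/
theorem matchUpTo_shift (hr : r ≠ 0) (a b : SF) (hE : E = D1B (m1B a) (m1B b)) (hd : le1B d = d) :
    MatchUpTo r ((x.shift E d (shiftOmb r E d)).toHSD m) (x.toHSD m) := by
  set w := shiftOmb r E d with hw
  have hwl : ∀ k, le1B (w k) = w k := le1B_shiftOmb E d
  have hD : D2B E = 0 := by rw [hE, D2B_D1B_m1B]
  have hdE : le1B (dvB E) = dvB E := by rw [hE, dvB_D1B_m1B, map_smul, le1B_m1B]
  obtain ⟨f, g, hfg⟩ := exists_D1B_eq x.eta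
  have hfg' : (x.shift E d w).eta = D1B (f + m1B a) (g + m1B b) := by
    rw [D1B_add, ← hE, ← hfg]
    rfl
  have hge : ∀ u v : SF, le1B v = v → ge2 ((u + v : SF) : Scal) = ge2 (u : Scal) := fun u v hv => by
    rw [ge2_coe, ge2_coe, map_add, hv, add_sub_add_right_eq_sub]
  have hQ2 : (x.shift E d w).Q2 r = x.Q2 r + le1B (r ^ 2 • d - (2 * r) • dvB E) := by
    rw [Q2_shift x E d w hr, map_sub, map_smul, map_smul, hd, hdE]
  have hhigh : ∀ k, ((x.shift E d w).toHSD m).Qhigh r k = (x.toHSD m).Qhigh r k := fun k => by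
    rw [Qhigh_toHSD, Qhigh_toHSD, Q2_shift x E d w hr, q0_shift,
      show (x.shift E d w).omb k = x.omb k + w k from rfl, map_add le1B, hwl]
    congr 1
    simp only [hw, shiftOmb, map_add]
    module
  have h5 : ((x.shift E d w).toHSD m).Q5 r = (x.toHSD m).Q5 r := by
    rw [Q5_toHSD, Q5_toHSD, hhigh]
  have h6 : ((x.shift E d w).toHSD m).Q6 r = (x.toHSD m).Q6 r := by
    rw [Q6_toHSD, Q6_toHSD, hhigh]
  have homb : ∀ k, ge2 (((x.shift E d w).toHSD m).omb k) = ge2 ((x.toHSD m).omb k) :=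
    fun k => hge _ _ (hwl k)
  have hchibh : ((x.shift E d w).toHSD m).chibh = (x.toHSD m).chibh := rfl
  constructor
  · have h1 : ge2 ((x.shift E d w).toHSD m).trXb = ge2 (x.toHSD m).trXb := hge _ _ hd
    have h2 : cge2 ((x.shift E d w).toHSD m).eta = cge2 (x.toHSD m).eta := by
      rw [show ((x.shift E d w).toHSD m).eta = toCov (x.shift E d w).eta from rfl, hfg',
        show (x.toHSD m).eta = toCov x.eta from rfl, hfg, cge2, cge2, cm1_D1B, cm1_D1B, ← map_sub,
        ← map_sub, ← D1B_sub, ← D1B_sub, map_add, map_add, m1B_m1B, m1B_m1B,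
        add_sub_add_right_eq_sub, add_sub_add_right_eq_sub]
    simp only [HSD.Match, h1, h2, h5, h6, homb]
    rfl
  · exact fun _ => rfl
  · exact fun _ => rfl
  · rw [Q1_toHSD, Q1_toHSD, Q1_shift]
  · rw [Q2_toHSD, Q2_toHSD, hQ2]
    exact hge _ _ (le1B_le1B _)
  · rw [Q3_toHSD, Q3_toHSD, Q3_shift x E d w hD]
  · have : ((x.shift E d w).toHSD m).Q4pre r = (x.toHSD m).Q4pre r := by
      have key : ∀ z : BD, (z.toHSD m).Q4pre r = toTen ((1 / r) • z.alb 0 + (2 : ℝ) •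
          D2B ((1 / r ^ 2) • dvTB z.chibh - (1 / r) • z.eta - (1 / 2 : ℝ) • gradB z.trXb
            - gradB (z.omb 0))) := fun z => by
        have h1 : D1s (z.omb 0) 0 = toCov (-gradB (z.omb 0)) := by
          rw [← SF.coe_zero, D1s_coe, D1B, map_zero, map_zero, add_zero]
        rw [sub_eq_add_neg _ (gradB _)]
        simp only [HSD.Q4pre, toHSD, Fin.val_zero, h1, dvT_toTen, grad_coe, ← map_smul, ← map_sub,
          ← map_add, D2s_toCov]
      have h1 : D2B (gradB d) = 0 := by rw [← hd, D2B_gradB_le1B]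
      have h2 : D2B (gradB (w 0)) = 0 := by rw [← hwl, D2B_gradB_le1B]
      rw [key, key]
      simp only [shift, map_add, map_sub, map_smul, hD, h1, h2, add_zero]
    rw [this]
    exact fun _ _ => rfl
  · exact h5
  · exact h6
  · have key : ∀ z : BD, (z.toHSD m).Q7 r = m2 (z.omb 1) + (3 / (2 * r ^ 3)) • m2 (z.Q2 r)
        + (1 / (2 * r ^ 2)) • m2 (dvB (dvTB (z.Q3 r))) - (12 / r ^ 2) • m2 (z.Q1 r)
        + (3 / (2 * r ^ 2)) • m2 (dvB (z.eta + (r / 2) • gradB (z.X' r)))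
        - (3 / (4 * r ^ 2)) • m2 (dvB (dvTB z.gc)) := fun z => by
      have h1 : dv ((z.toHSD m).eta + (r / 2) • grad (z.X' r)) =
          dvB (z.eta + (r / 2) • gradB (z.X' r)) := by
        rw [← dv_toCov, map_add, map_smul, grad_coe]
        rfl
      simp only [HSD.Q7, Q2_toHSD, Q3_toHSD, Q1_toHSD, X'_toHSD, h1, dv_dvT]
      rfl
    have h1 : m2 ((x.shift E d w).omb 1) = m2 (x.omb 1) :=
      m2_eq_of_sub_le1B (h := w 1) (by rw [hwl]; rfl)
    have h2 : m2 (dvB ((x.shift E d w).eta + (r / 2) • gradB (x.X' r))) =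
        m2 (dvB (x.eta + (r / 2) • gradB (x.X' r))) :=
      m2_eq_of_sub_le1B (h := dvB E) (by
        rw [hdE]
        simp only [shift, map_add]
        abel)
    rw [key, key, h1, Q3_shift x E d w hD, Q1_shift, X'_shift, h2, m2_eq_of_sub_le1B hQ2]
    rfl
  · exact hhigh
  · exact homb
  · exact fun _ => rfl
  -- Equality of `Q₀` forces `E = 0`; then equality of `Q₂^{[≤1]}` forces `d = 0`, and with both the
  -- compensating changes vanish.
  · intro h0 h2
    rw [Q0_toHSD r _ m hfg', Q0_toHSD r _ m hfg, map_add m1B, map_add m1B, m1B_m1B, m1B_m1B, D1B_add,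
      ← hE, X'_shift] at h0
    have h0' : E = 0 := by
      have := toCov_injective h0
      rw [smul_add, add_right_comm, add_eq_left] at this
      exact (smul_eq_zero.mp this).resolve_left (pow_ne_zero 2 hr)
    rw [Q2_toHSD, Q2_toHSD, le1_coe, le1_coe, hQ2, h0', map_zero, smul_zero, sub_zero, map_smul, hd,
      map_add, map_smul, hd] at h2
    have hd0 : d = 0 := by
      have h3 : le1B (x.Q2 r) + r ^ 2 • d = le1B (x.Q2 r) := SF.ext fun y => congrFun h2 y
      rw [add_eq_left] at h3
      exact (smul_eq_zero.mp h3).resolve_left (pow_ne_zero 2 hr)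
    have hw0 : w = fun _ => 0 := by
      funext k
      rw [hw, shiftOmb, h0', hd0]
      simp
    rw [hw0, h0', hd0, shift]
    simp only [add_zero]

end BD

/-! ## The middle sphere -/

/-- Supplies the tensor `G` needed in `exists_glue`: only the degree-one parts of two values of `q₀`
have to agree. -/
lemma exists_D1B_eq_add_dvTB {f g f' g' : SF} (hf : m1B f = m1B f') (hg : m1B g = m1B g') :
    ∃ W : TF, D1B f g = D1B f' g' + dvTB W := by
  obtain ⟨W, hW⟩ := exists_dvTB_eq (f - f') (g - g')
  refine ⟨W, ?_⟩
  rw [hW, map_sub, map_sub, hf, hg, sub_self, sub_self, sub_zero, sub_zero, D1B_sub]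
  abel

lemma c1B_dvB_hodgeB_dvTB (i : Fin 3) (W : TF) : c1B i (dvB (hodgeB (dvTB W))) = 0 := by
  have h := intB_dotB_dvTB W (hodgeB (gradB (cx i)))
  rw [D2B_hodgeB_gradB_cx, dotB_hodgeB, dotB_comm, map_neg, intB_dotB_gradB] at h
  have h0 : ddotB W 0 = 0 := by simp [ddotB]
  rw [h0, map_zero, neg_neg] at h
  rw [c1B_eq, h, mul_zero]

/-- There are sphere data with prescribed charges `Q₁, Q₂^{[≥2]}, Q₃` for the outgoing direction and
prescribed charges for the ingoing direction. -/
theorem exists_middle {r : ℝ} (hr : r ≠ 0) (A A' B C fs gs : SF) (T T' : TF) : ∃ y : BD,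
    y.Q1 r = A ∧ y.mirror.Q1 r = A' ∧ y.Q3 r = T ∧ y.mirror.Q3 r = T' ∧ y.mirror.Q2 r = B ∧
    (∃ D, y.Q2 r = C + le1B D) ∧
    ∃ f g, y.mirror.q0 r = D1B f g ∧ m1B f = m1B fs ∧ m1B g = m1B gs := by
  -- The sum of `Q₂` and its reflection is `-4r(Δ + 2)w` with `w = Ω + ½(A + A')`; `φ` and `η`
  -- cancel. Its degree-one part must therefore vanish, and its mean is twice that of `B`, because
  -- `Q₂` and its reflection have the same mean. This is why only `C^{[≥2]}` can be prescribed.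
  obtain ⟨F, hF⟩ : ∃ F : SF, F = -(1 / (4 * r)) • ((C - le1B C) + (B - le1B B))
    - (1 / (2 * r)) • m0B B := ⟨_, rfl⟩
  have hF1 : m1B F = 0 := by
    rw [hF]
    simp only [map_sub, map_smul, map_add, m1B_le1B, m1B_m0B, sub_self, add_zero, smul_zero]
  have hF0 : m0B F = -(1 / (2 * r)) • m0B B := by
    rw [hF]
    simp only [map_sub, map_smul, map_add, m0B_le1B, m0B_m0B]
    module
  obtain ⟨w, hw⟩ := exists_lapB_add_two_eq F
  have hw' : lapB w = F - (2 : ℝ) • w := by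
    rw [hF1, sub_zero] at hw
    rw [← hw, two_smul, two_mul, add_sub_cancel_right]
  have hw0 : (2 : ℝ) • m0B w = -(1 / (2 * r)) • m0B B := by
    have := congrArg m0B hw'
    rw [m0B_lapB, map_sub, hF0, map_smul] at this
    exact (sub_eq_zero.mp this.symm).symm
  obtain ⟨Om, hOm⟩ : ∃ Om : SF, Om = w - (1 / 2 : ℝ) • (A + A') := ⟨_, rfl⟩
  -- With `Ω` fixed, the reflected `Q₂` becomes a Poisson equation for the electric potential of
  -- `η`. The mean chosen in `F` is exactly its solvability condition.
  obtain ⟨v, hv⟩ : ∃ v : SF, v = (1 / (2 * r)) • B + A + (lapB A' + A') + (2 : ℝ) • (lapB Om + Om) :=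
    ⟨_, rfl⟩
  have hv0 : m0B v = 0 := by
    have : m0B v = (1 / (2 * r)) • m0B B + (2 : ℝ) • m0B w := by
      rw [hv]
      simp only [hOm, map_add, map_smul, map_sub, m0B_lapB]
      module
    rw [this, hw0]
    module
  obtain ⟨h, hh⟩ := exists_lapB_eq v
  rw [hv0, sub_zero, hv] at hh
  -- A pure degree-one `φ` does not contribute to the curvature, so it remains free for adjusting
  -- the electric degree-one part of the reflected `q₀`; the magnetic part is adjusted by `k`.
  obtain ⟨phi, hphi⟩ : ∃ phi : SF, phi = (1 / r) • m1B (fs - r ^ 2 • h + (2 * r ^ 2) • Om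
    + r ^ 2 • A') := ⟨_, rfl⟩
  have hphi1 : m1B phi = phi := by rw [hphi, map_smul, m1B_m1B]
  have hphi2 : lapB phi = (-2 : ℝ) • phi := by rw [← hphi1, lapB_m1B]
  obtain ⟨k, hk⟩ : ∃ k : SF, k = -(1 / r ^ 2) • m1B gs := ⟨_, rfl⟩
  let y : BD :=
    { Om := Om
      phi := phi
      gc := 0
      trX := (2 / r) • (A + (2 : ℝ) • Om - (1 / r) • phi)
      chih := 0
      trXb := (2 / r) • (-A' - (2 : ℝ) • Om + (1 / r) • phi)
      chibh := 0
      eta := D1B (-h) k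
      om := 0
      omb := 0
      al := 0
      alb := 0 }
  have e1 : y.Q1 r = A := by
    simp only [BD.Q1, BD.X', y]
    match_scalars <;> field_simp <;> ring
  have e1' : y.mirror.Q1 r = A' := by
    simp only [BD.Q1, BD.X', BD.mirror, y]
    match_scalars <;> field_simp <;> ring
  have hde : dvB (D1B (-h) k) = lapB h := by rw [dvB_D1B, map_neg, neg_neg]
  have e2' : y.mirror.Q2 r = B := by
    simp only [BD.Q2, BD.X', BD.K, BD.mirror, y, map_add, map_sub, map_smul, map_neg, map_zero,
      dvB_gradB, hde, hh, hphi2]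
    match_scalars <;> field_simp <;> ring
  have e2 : y.Q2 r = C + le1B (-C - B + (2 : ℝ) • m0B B) := by
    simp only [BD.Q2, BD.X', BD.K, y, map_add, map_sub, map_smul, map_neg, map_zero,
      dvB_gradB, hde, hh, hphi2, le1B_m0B]
    simp only [hOm, hw', hF, map_add, map_sub, map_smul]
    match_scalars <;> field_simp <;> ring
  -- `χ̂` and `χ̲̂` enter only the two versions of `Q₃`, one each, and can be corrected last.
  let y' : BD :=
    { y with
      chih := -(r • (T' - y.mirror.Q3 r))
      chibh := r • (T - y.Q3 r) }
  have e3 : y'.Q3 r = (1 / r) • y'.chibh + y.Q3 r := by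
    simp only [BD.Q3, BD.X', y', y, smul_zero]
    abel
  have e3' : y'.mirror.Q3 r = -((1 / r) • y'.chih) + y.mirror.Q3 r := by
    simp only [BD.Q3, BD.X', BD.mirror, y', y, smul_zero, smul_neg, neg_zero]
    abel
  refine ⟨y', e1, e1', ?_, ?_, e2', ⟨_, e2⟩, r ^ 2 • h - (2 * r ^ 2) • Om - r ^ 2 • A' + r • phi,
    -(r ^ 2 • k), ?_, ?_, ?_⟩
  · rw [e3]
    simp only [y']
    match_scalars <;> field_simp
    ring
  · rw [e3']
    simp only [y']
    match_scalars <;> field_simp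
    ring
  · simp only [BD.q0, BD.X', BD.mirror, y', y, D1B, map_add, map_sub, map_smul, map_neg]
    match_scalars <;> field_simp
    ring
  · rw [map_add, map_smul, hphi1, hphi, smul_smul, mul_one_div_cancel hr, one_smul, ← map_add]
    congr 1
    module
  · rw [map_neg, map_smul, hk, map_smul, m1B_m1B]
    match_scalars
    field_simp

/-! ## The reflection of truncated sphere data -/

/-- The reflection of truncated sphere data. -/
def HSD.mirror {m : ℕ} (x : HSD m) : HSD m where
  Om := x.Om
  phi := x.phi
  gc := x.gc
  trX := -x.trXb
  chih := -x.chibh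
  trXb := -x.trX
  chibh := -x.chih
  eta := -x.eta + (2 : ℝ) • grad x.Om
  om k := (-1 : ℝ) ^ ((k : ℕ) + 1) • x.omb k
  omb k := (-1 : ℝ) ^ ((k : ℕ) + 1) • x.om k
  al k := (-1 : ℝ) ^ (k : ℕ) • x.alb k
  alb k := (-1 : ℝ) ^ (k : ℕ) • x.al k

lemma BD.toHSD_mirror (m : ℕ) (x : BD) : x.mirror.toHSD m = (x.toHSD m).mirror := by
  simp only [BD.toHSD, BD.mirror, HSD.mirror, map_neg, map_add, map_smul, grad_coe, SF.coe_neg,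
    SF.coe_smul]

/-- Sphere data with prescribed normal derivatives. -/
def BD.withDerivs (y : BD) (om omb : ℕ → SF) (al alb : ℕ → TF) : BD :=
  { y with om := om, omb := omb, al := al, alb := alb }

/-- Sign bookkeeping for the middle sphere: the data reached by the reflected problem, once
reflected back, agree with those reached by the outgoing one. -/
lemma BD.mirror_withDerivs (y : BD) (om omb : ℕ → SF) (al alb : ℕ → TF) :
    (y.mirror.withDerivs (fun k => (-1 : ℝ) ^ (k + 1) • omb k) om
      (fun k => (-1 : ℝ) ^ k • alb k) al).mirror =
    y.withDerivs (fun k => (-1 : ℝ) ^ (k + 1) • om k) omb (fun k => (-1 : ℝ) ^ k • al k) alb := by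
  have h : ∀ k : ℕ, (-1 : ℝ) ^ k * (-1) ^ k = 1 := fun k => by rw [← mul_pow]; norm_num
  simp only [withDerivs, mirror, neg_neg, smul_smul, h, one_smul, neg_add, neg_add_cancel_right]

end LinGlue

end

/-! ### Gluing of the two cones at the middle sphere -/

theorem theorem6p3 (m : ℕ) (x01 xm12 : HSD m) (h01 : x01.Smooth) (hm12 : xm12.Smooth) :
    ∃ (z zb : ℝ → HSD m) (y : HSD m),
      -- solutions on the outgoing and on the ingoing hypersurface, data on the middle sphere
      OutgoingSolution (-1) 1 2 z ∧ IngoingSolution 1 (-1) 0 zb ∧ y.Smooth ∧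
      -- full matching at the middle sphere and at the sphere `u = 0`, `v = 1`
      z 1 = y ∧ zb (-1) = y ∧ zb 0 = x01 ∧
      -- matching up to `Q₀` and `Q₂^{[≤1]}` at the sphere `u = -1`, `v = 2` of radius `3`
      MatchUpTo 3 (z 2) xm12 ∧
      -- transport of the charges `E, P, L, G` from the sphere of radius `1` to that of radius `3`
      (z 2).Edot 3 = x01.Edot 1 ∧
      (∀ i, (z 2).Pdot 3 i = x01.Pdot 1 i) ∧
      (∀ i, (z 2).Ldot 3 i = x01.Ldot 1 i) ∧
      (∀ i, (z 2).Gdot 3 i = x01.Gdot 1 i - 2 * x01.Pdot 1 i) := by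
  obtain ⟨x, rfl⟩ := BD.exists_toHSD h01
  obtain ⟨t, rfl⟩ := BD.exists_toHSD hm12
  have two0 : (2 : ℝ) ≠ 0 := by norm_num
  have three0 : (3 : ℝ) ≠ 0 := by norm_num
  obtain ⟨fs, gs, hs⟩ := exists_D1B_eq (x.mirror.q0 1)
  obtain ⟨y, y1, y1', y3, y3', y2', ⟨D, y2⟩, fy', gy', hy', hfy', hgy'⟩ :=
    exists_middle two0 (t.Q1 3) (x.mirror.Q1 1) (x.mirror.Q2 1) (t.Q2 3) fs gs (t.Q3 3)
      (x.mirror.Q3 1)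
  obtain ⟨f, g, hy⟩ := exists_D1B_eq (y.q0 2)
  obtain ⟨ft, gt, ht⟩ := exists_D1B_eq (t.q0 3)
  -- A shift by `E` adds `r²E = 9E` to `q₀` on the sphere of radius `3`; this `E` gives `q₀` there
  -- the degree-one part found on the middle sphere.
  obtain ⟨a, ha⟩ : ∃ a : SF, a = (1 / 9 : ℝ) • (f - ft) := ⟨_, rfl⟩
  obtain ⟨b, hb⟩ : ∃ b : SF, b = (1 / 9 : ℝ) • (g - gt) := ⟨_, rfl⟩
  obtain ⟨E, hE⟩ : ∃ E : VF, E = D1B (m1B a) (m1B b) := ⟨_, rfl⟩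
  -- Solves `9d - 6 div E = D^{[≤1]}`, the remaining discrepancy in `Q₂` at `r = 3`.
  obtain ⟨d, hd⟩ : ∃ d : SF, d = (1 / 9 : ℝ) • (le1B D + (6 : ℝ) • dvB E) := ⟨_, rfl⟩
  have hdl : le1B d = d := by
    rw [hd, map_smul, map_add, map_smul, le1B_le1B, hE, dvB_D1B_m1B, map_smul, le1B_m1B]
  obtain ⟨t', ht'⟩ : ∃ t', t' = t.shift E d (BD.shiftOmb 3 E d) := ⟨_, rfl⟩
  have hmatch : MatchUpTo 3 (t'.toHSD m) (t.toHSD m) := by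
    rw [ht']
    exact BD.matchUpTo_shift t m E d three0 a b hE hdl
  have q1 : y.Q1 2 = t'.Q1 3 := by rw [ht', BD.Q1_shift, y1]
  have q2 : y.Q2 2 = t'.Q2 3 := by
    rw [ht', BD.Q2_shift _ _ _ _ three0, y2, hd]
    congr 1
    module
  have q3 : y.Q3 2 = t'.Q3 3 := by rw [ht', BD.Q3_shift _ _ _ _ (by rw [hE, D2B_D1B_m1B]), y3]
  obtain ⟨G, q0⟩ : ∃ G, y.q0 2 = t'.q0 3 + dvTB G := by
    have h9 : t'.q0 3 = D1B (ft + (9 : ℝ) • m1B a) (gt + (9 : ℝ) • m1B b) := by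
      rw [ht', BD.q0_shift, ht, hE, D1B_add, D1B_smul]
      norm_num
    rw [hy, h9]
    refine exists_D1B_eq_add_dvTB ?_ ?_
    · rw [map_add, map_smul, m1B_m1B, ha, map_smul, map_sub]
      module
    · rw [map_add, map_smul, m1B_m1B, hb, map_smul, map_sub]
      module
  obtain ⟨G', q0'⟩ : ∃ G, y.mirror.q0 2 = x.mirror.q0 1 + dvTB G := by
    rw [hy', hs]
    exact exists_D1B_eq_add_dvTB hfy' hgy'
  -- Both cones run towards `r = 2`, from `r = 3` and from `r = 1`. Each yields its transversal
  -- derivatives first; only then are they exchanged as tangential jets for the other cone.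
  obtain ⟨omb1, alb1, h1⟩ := exists_glue m (by norm_num) (by norm_num) (by norm_num) t' y q1 q2 q3 G q0
  obtain ⟨omb2, alb2, h2⟩ := exists_glue m (by norm_num) (by norm_num) (by norm_num) x.mirror y.mirror
    y1' y2' y3' G' q0'
  obtain ⟨Z, hZ, hZt, hZy⟩ := h1 (fun k => (-1 : ℝ) ^ (k + 1) • omb2 k) fun k => (-1 : ℝ) ^ k • alb2 k
  obtain ⟨Z', hZ', hZx, hZy'⟩ :=
    h2 (fun k => (-1 : ℝ) ^ (k + 1) • omb1 k) fun k => (-1 : ℝ) ^ k • alb1 k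
  have e3 : (Z (2 - -1)).toHSD m = t'.toHSD m := by
    rw [← hZt]
    norm_num
  have iQ2 : intB (t'.Q2 3) = intB (x.Q2 1) := by
    rw [← q2, ← BD.intB_Q2_mirror y two0, y2', BD.intB_Q2_mirror x one_ne_zero]
  have cQ2 : ∀ i, c1B i (t'.Q2 3) = c1B i (x.Q2 1) := fun i => by
    rw [← q2, ← neg_neg (c1B i (y.Q2 2)), ← BD.c1B_Q2_mirror y two0, y2',
      BD.c1B_Q2_mirror x one_ne_zero, neg_neg]
  -- The reflection contributes `r` times the coefficient of `Q₂`, taken at `r = 2` on leaving the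
  -- ingoing cone and at `r = 1` on entering it; the difference is one.
  have cq0 : ∀ i, c1B i (dvB (t'.q0 3)) = c1B i (dvB (x.q0 1)) - c1B i (x.Q2 1) := fun i => by
    have e1 : c1B i (dvB (y.q0 2)) = c1B i (dvB (t'.q0 3)) := by
      rw [q0, map_add, map_add, c1B_dvB_dvTB, add_zero]
    have e2 : c1B i (dvB (y.mirror.q0 2)) = c1B i (dvB (x.mirror.q0 1)) := by
      rw [q0', map_add, map_add, c1B_dvB_dvTB, add_zero]
    rw [BD.c1B_dvB_q0_mirror y two0, BD.c1B_dvB_q0_mirror x one_ne_zero, e1, q2, cQ2] at e2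
    linarith
  have chq0 : ∀ i, c1B i (dvB (hodgeB (t'.q0 3))) = c1B i (dvB (hodgeB (x.q0 1))) := fun i => by
    have e1 : c1B i (dvB (hodgeB (y.q0 2))) = c1B i (dvB (hodgeB (t'.q0 3))) := by
      rw [q0, map_add, map_add, map_add, c1B_dvB_hodgeB_dvTB, add_zero]
    have e2 : c1B i (dvB (hodgeB (y.mirror.q0 2))) = c1B i (dvB (hodgeB (x.mirror.q0 1))) := by
      rw [q0', map_add, map_add, map_add, c1B_dvB_hodgeB_dvTB, add_zero]
    rwa [BD.dvB_hodgeB_q0_mirror, BD.dvB_hodgeB_q0_mirror, map_neg, map_neg, neg_inj, e1] at e2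
  refine ⟨fun v => (Z (v - -1)).toHSD m, fun u => (Z' (1 - u)).mirror.toHSD m,
    (y.withDerivs (fun k => (-1 : ℝ) ^ (k + 1) • omb2 k) omb1 (fun k => (-1 : ℝ) ^ k • alb2 k)
      alb1).toHSD m, hZ.outgoingSolution (by norm_num) (by norm_num),
    hZ'.ingoingSolution (by norm_num) (by norm_num), BD.smooth_toHSD _ _, ?_, ?_, ?_, ?_, ?_, ?_, ?_,
    ?_⟩
  · refine Eq.trans ?_ hZy
    norm_num
  · rw [← BD.mirror_withDerivs, BD.toHSD_mirror m (BD.withDerivs ..)]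
    refine Eq.trans ?_ (congrArg HSD.mirror hZy')
    show (Z' (1 - -1)).mirror.toHSD m = _
    rw [BD.toHSD_mirror]
    norm_num
  · show (Z' (1 - 0)).mirror.toHSD m = _
    rw [sub_zero, BD.toHSD_mirror, hZx, ← BD.toHSD_mirror, BD.mirror_mirror]
  · show MatchUpTo 3 ((Z (2 - -1)).toHSD m) _
    rwa [e3]
  · show ((Z (2 - -1)).toHSD m).Edot 3 = _
    rw [e3, BD.Edot_toHSD _ _ three0, BD.Edot_toHSD _ _ one_ne_zero, iQ2]
  · intro i
    show ((Z (2 - -1)).toHSD m).Pdot 3 i = _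
    rw [e3, BD.Pdot_toHSD _ _ three0, BD.Pdot_toHSD _ _ one_ne_zero, cQ2]
  · intro i
    show ((Z (2 - -1)).toHSD m).Ldot 3 i = _
    rw [e3, BD.Ldot_toHSD, BD.Ldot_toHSD, chq0]
  · intro i
    show ((Z (2 - -1)).toHSD m).Gdot 3 i = _
    rw [e3, BD.Gdot_toHSD _ _ three0, BD.Gdot_toHSD _ _ one_ne_zero, BD.Pdot_toHSD _ _ one_ne_zero, cq0]
    ring
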